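/- **Setting.** Fix countably infinite sets $\Lambda$ (letters) and $\mathbb V$ (variables). *$\pi$-terms.* A $\pi$-algebra is a semigroup with an additional unary operation $u\mapsto u^\pi$; $\pi$-terms are the elements of the free $\pi$-algebra $T_\Lambda$ generated by $\Lambda$. In a finite semigroup $S$, let $u^\pi$ be the unique idempotent in $\{u^k\mid k\ge 1\}$. The identity $s=t$ of $\pi$-terms *holds in* $S$ if $h(s)=h(t)$ for every $\pi$-algebra morphism $h\colon T_\Lambda\to S$. *Generalized words.* A (generalized) word $u$ is a countable, possibly empty, linearly ordered set $\operatorname{dom}(u)$ of positions, each labeled by an element of $\Lambda$; isomorphic words are identified, and finite words are regarded as generalized words. Let $\varrho=\omega+\zeta\cdot\eta+\omega^*$, where $\omega,\zeta,\eta,\omega^*$ are the order types of $\mathbb N,\mathbb Z,\mathbb Q,\mathbb Z_{<0}$ and $\zeta\cdot\eta$ is the order type of $\eta$ many copies of $\mathbb Z$. The $\varrho$-power $u^\varrho$ of a word $u$ is obtained by replacing each point of a linear order of type $\varrho$ by a copy of $u$. Let $[\![\cdot]\!]_\varrho$ be the unique $\pi$-algebra morphism from $T_\Lambda$ to words, with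 concatenation and $u^\pi=u^\varrho$, that maps each $a\in\Lambda$ to the one-position word $a$. *Logic.* Formulae over words are given by $$\varphi ::= \top\mid\bot\mid\mathsf{empty}\mid x=y\mid\lambda(x)=a\mid x<y\mid x\le y\mid\mathsf{suc}(x,y)\mid\min(x)\mid\max(x)\mid\neg\varphi\mid\varphi\lor\varphi\mid\varphi\land\varphi\mid\exists x\,\varphi\mid\forall x\,\varphi$$ with $x,y\in\mathbb V$ and $a\in\Lambda$. Variables range over positions, $\mathsf{empty}$ says that there is no position, $\lambda(x)$ is the label of $x$, $\mathsf{suc}(x,y)$ says that $y$ is the immediate successor of $x$, and $\min(x)$, $\max(x)$ say that $x$ is the first, respectively last, position. A *literal* is an atomic formula or the negation of one. $\mathrm{FV}(\varphi)$ is the set of free variables of $\varphi$, and a sentence is a formula without free variables. A *context* $\mu$ is a formula with exactly one occurrence of a placeholder, and $\mu(\varphi)$ is the result of replacing the placeholder by $\varphi$. A *fragment* is a non-empty set $\mathcal F$ of formulae such that for all contexts $\mu$, formulae $\varphi,\psi$, $x\in\mathbb V$ and $a\in\Lambda$: 1. if $\mu(\varphi)\in\mathcal F$, then $\mu(\top),\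 \mu(\bot),\ \mu(\lambda(x)=a)\in\mathcal F$; 2. $\mu(\varphi\lor\psi)\in\mathcal F$ iff $\mu(\varphi),\mu(\psi)\in\mathcal F$; 3. $\mu(\varphi\land\psi)\in\mathcal F$ iff $\mu(\varphi),\mu(\psi)\in\mathcal F$; 4. if $\mu(\neg\neg\varphi)\in\mathcal F$, then $\mu(\varphi)\in\mathcal F$; 5. if $x\notin\mathrm{FV}(\varphi)$ and $\mu(\exists x\,\varphi)\in\mathcal F$ or $\mu(\forall x\,\varphi)\in\mathcal F$, then $\mu(\varphi)\in\mathcal F$. It is *order-stable* if, for all $\mu,x,y$, $\mu(x<y)\in\mathcal F$ iff $\mu(x\le y)\in\mathcal F$. It is *$\mathsf{suc}$-stable* if, for all $\mu,x,y$, $\mu(\mathsf{suc}(x,y))\in\mathcal F$ implies $\mu(x=y),\mu(\max(x)),\mu(\min(y))\in\mathcal F$, and each of $\mu(\min(x))\in\mathcal F$ and $\mu(\max(x))\in\mathcal F$ implies $\mu(\mathsf{empty})\in\mathcal F$. *Languages.* Let $A\subseteq\Lambda$ be finite and let $A^+$ be the set of non-empty finite words over $A$. A language $L\subseteq A^+$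 is *$\mathcal F$-definable over non-empty words* if $L=\{w\in A^+\mid w\models\varphi\}$ for some sentence $\varphi\in\mathcal F$. Its *syntactic semigroup* is $A^+/{\equiv_L}$, where $w\equiv_L w'$ if for all $x,y\in A^*$ we have $xwy\in L$ iff $xw'y\in L$; it is finite for every such $L$. *The $\mathcal F$-game on $(u,v)$.* Configurations are triples $(\mathcal G,\langle u,\alpha\rangle,\langle v,\beta\rangle)$, where $\mathcal G$ is a set of formulae, $u,v$ are words, and $\alpha\colon X\to\operatorname{dom}(u)$, $\beta\colon X\to\operatorname{dom}(v)$ for the same finite $X\subseteq\mathbb V$. The game starts in $(\mathcal F,\langle u,\emptyset\rangle,\langle v,\emptyset\rangle)$. In a round, Spoiler chooses $\mathsf Q\in\{\exists,\forall,\neg\exists,\neg\forall\}$ and $x\in\mathbb V$ such that $\mathcal G'=\{\varphi\mid \mathsf Qx\,\varphi\in\mathcal G\}$ is non-empty, and then a position $q$ in $\operatorname{dom}(u)$ if $\mathsf Q\in\{\exists,\neg\forall\}$ and in $\operatorname{dom}(v)$ if $\mathsf Q\in\{\forall,\neg\exists\}$. Duplicator replies with a position $r$ of the other word. The new configuration is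 $(\mathcal G',\langle u,\alpha'\rangle,\langle v,\beta'\rangle)$ if $\mathsf Q\in\{\exists,\forall\}$ and $(\mathcal G',\langle v,\beta'\rangle,\langle u,\alpha'\rangle)$ if $\mathsf Q\in\{\neg\exists,\neg\forall\}$, where $\alpha',\beta'$ arise from $\alpha,\beta$ by mapping $x$ to the position chosen in $u$, respectively $v$. A player who cannot make a required choice loses. Spoiler also wins as soon as, in the current configuration $(\mathcal G,\langle u,\alpha\rangle,\langle v,\beta\rangle)$ with $\alpha,\beta$ defined on $X$, there is a literal $\varphi\in\mathcal G$ with $\mathrm{FV}(\varphi)\subseteq X$, $\langle u,\alpha\rangle\models\varphi$ and $\langle v,\beta\rangle\not\models\varphi$. Duplicator wins all plays that go on forever. **Theorem.** Let $\mathcal F$ be a $\mathsf{suc}$-stable and order-stable fragment. For all $\pi$-terms $s,t\in T_\Lambda$ the following are equivalent: 1. For every finite $A\subseteq\Lambda$ and every $L\subseteq A^+$ that is $\mathcal F$-definable over non-empty words, the identity $s=t$ holds in the syntactic semigroup of $L$. 2. Duplicator has winning strategies in the $\mathcal F$-games on $([\![s]\!]_\varrho,[\![t]\!]_\varrho)$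 and on $([\![t]\!]_\varrho,[\![s]\!]_\varrho)$. -/

import Mathlib

namespace PiGames

universe u v

/-! ### `π`-terms

A `π`-algebra is a semigroup with an additional unary operation `π`.  `PiTerm Λ` is the free
`π`-algebra generated by `Λ`: every element is uniquely a finite non-empty product of factors,
each of which is a letter or a `π`-power, and the constructors read off the first factor. -/

/-- The free `π`-algebra generated by `Λ` (see `PiTerm.existsUnique_hom`): `letterMul a t` is the
product `a t`, and `piMul s t` is the product `s^π t`. -/
inductive PiTerm (Λ : Type u) : Type u
  | letter (a : Λ) : PiTerm Λ
  | letterMul (a : Λ) (t : PiTerm Λ) : PiTerm Λ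
  | pi (s : PiTerm Λ) : PiTerm Λ
  | piMul (s t : PiTerm Λ) : PiTerm Λ

namespace PiTerm

variable {Λ : Type u}

/-- Concatenation of `π`-terms. -/
def append : PiTerm Λ → PiTerm Λ → PiTerm Λ
  | letter a, w => letterMul a w
  | letterMul a t, w => letterMul a (append t w)
  | pi s, w => piMul s w
  | piMul s t, w => piMul s (append t w)

instance : Semigroup (PiTerm Λ) where
  mul := append
  mul_assoc r s t := by
    change append (append r s) t = append r (append s t)
    induction r with
    | letter a => rfl
    | letterMul a r ih => simp [append, ih]
    | pi r _ => rfl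
    | piMul q r _ ih => simp [append, ih]

/-- The value of a `π`-term in a semigroup with a unary operation `p`, under an assignment `f`. -/
def lift {U : Type v} [Semigroup U] (p : U → U) (f : Λ → U) : PiTerm Λ → U
  | letter a => f a
  | letterMul a t => f a * lift p f t
  | pi s => p (lift p f s)
  | piMul s t => p (lift p f s) * lift p f t

/-- `PiTerm Λ` has the universal property of the free `π`-algebra generated by `Λ`. -/
theorem existsUnique_hom {U : Type v} [Semigroup U] (p : U → U) (f : Λ → U) :
    ∃! h : PiTerm Λ →ₙ* U, (∀ a, h (letter a) = f a) ∧ ∀ t, h (pi t) = p (h t) := by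
  refine ⟨⟨lift p f, fun s t => ?_⟩, ⟨fun a => rfl, fun t => rfl⟩, ?_⟩
  · change lift p f (append s t) = lift p f s * lift p f t
    induction s with
    | letter a => rfl
    | letterMul a r ih => simp [append, lift, ih, mul_assoc]
    | pi r _ => rfl
    | piMul q r _ ih => simp [append, lift, ih, mul_assoc]
  · rintro h ⟨h1, h2⟩
    ext t
    change h t = lift p f t
    induction t with
    | letter a => exact h1 a
    | letterMul a r ih =>
      have : h (letterMul a r) = h (letter a) * h r := map_mul h (letter a) r
      rw [this, h1, ih, lift]
    | pi r ih => rw [h2, ih, lift]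
    | piMul q r ih1 ih2 =>
      have : h (piMul q r) = h (pi q) * h r := map_mul h (pi q) r
      rw [this, h2, ih1, ih2, lift]

end PiTerm

/-! ### Identities in semigroups -/

/-- `posPow x n` is the positive power `x ^ (n + 1)` in a semigroup. -/
def posPow {S : Type v} [Semigroup S] (x : S) : ℕ → S
  | 0 => x
  | n + 1 => posPow x n * x

/-- The idempotent among the positive powers of `x`. In a finite semigroup it exists and is
unique. -/
noncomputable def idempotentPower {S : Type v} [Semigroup S] (x : S) : S :=
  @Classical.epsilon S ⟨x⟩ fun e => IsIdempotentElem e ∧ ∃ n, e = posPow x n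

/-- The identity `s = t` holds in the (finite) semigroup `S`: every `π`-algebra morphism into `S`,
with `π` interpreted as the idempotent power, maps `s` and `t` to the same element. -/
def HoldsIn {Λ : Type u} (s t : PiTerm Λ) (S : Type v) [Semigroup S] : Prop :=
  ∀ h : PiTerm Λ →ₙ* S, (∀ r, h (PiTerm.pi r) = idempotentPower (h r)) → h s = h t

/-! ### Syntactic semigroups

`FreeSemigroup A` is the semigroup `A⁺` of non-empty finite words over `A`. -/

/-- The list of letters of a non-empty word. -/
def toList {A : Type u} (w : FreeSemigroup A) : List A := w.head :: w.tail

/-- The syntactic congruence on `A⁺` of a language `L` of non-empty words: `w ≡ w'` if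
`x w y ∈ L ↔ x w' y ∈ L` for all, possibly empty, words `x` and `y`. -/
def syntacticCon {A : Type u} (L : Set (FreeSemigroup A)) : Con (FreeSemigroup A) where
  r w w' := ∀ x y : List A,
    x ++ toList w ++ y ∈ toList '' L ↔ x ++ toList w' ++ y ∈ toList '' L
  iseqv := ⟨fun _ _ _ => Iff.rfl, fun h x y => (h x y).symm,
    fun h h' x y => (h x y).trans (h' x y)⟩
  mul' := by
    intro w w' z z' h h' x y
    have e : ∀ a b : FreeSemigroup A, toList (a * b) = toList a ++ toList b := fun a b => rfl
    have h1 := h x (toList z ++ y)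
    have h2 := h' (x ++ toList w') y
    rw [e, e]
    simp only [List.append_assoc] at h1 h2 ⊢
    exact h1.trans h2

/-- The syntactic semigroup `A⁺ / ≡_L` of a language `L` of non-empty words. -/
abbrev SyntacticSemigroup {A : Type u} (L : Set (FreeSemigroup A)) : Type u :=
  (syntacticCon L).Quotient

/-! ### Generalized words -/

/-- A (countable) generalized word over `Λ`: a countable, possibly empty, linear ordering of
positions labeled by elements of `Λ`. -/
structure GWord (Λ : Type u) : Type (max u 1) where
  Pos : Type
  [order : LinearOrder Pos]
  [countable : Countable Pos]
  label : Pos → Λ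

attribute [instance] GWord.order GWord.countable

namespace GWord

variable {Λ : Type u}

/-- A finite word as a generalized word. -/
def ofList (w : List Λ) : GWord Λ where
  Pos := Fin w.length
  label := w.get

/-- The concatenation `u v`. -/
def concat (w w' : GWord Λ) : GWord Λ where
  Pos := w.Pos ⊕ₗ w'.Pos
  countable := inferInstanceAs (Countable (w.Pos ⊕ w'.Pos))
  label p := Sum.elim w.label w'.label (ofLex p)

/-- The `τ`-power of a word, where `τ` is the order type of `T`: a copy of the word for each
element of `T`, the copies being ordered as in `T`. -/
def power (T : Type) [LinearOrder T] [Countable T] (w : GWord Λ) : GWord Λ where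
  Pos := T ×ₗ w.Pos
  countable := inferInstanceAs (Countable (T × w.Pos))
  label p := w.label (ofLex p).2

end GWord

/-- A linear ordering of order type `ω + ζ · η + ω*`: a copy of `ℕ`, followed by `ℚ` many copies
of `ℤ`, followed by a reversed copy of `ℕ`. -/
abbrev Rho : Type := ℕ ⊕ₗ ((ℚ ×ₗ ℤ) ⊕ₗ ℕᵒᵈ)

instance : Countable Rho := inferInstanceAs (Countable (ℕ ⊕ ((ℚ × ℤ) ⊕ ℕ)))

/-- The value of a `π`-term among generalized words, where a letter `a` is interpreted as the
one-position word `a`, multiplication as concatenation, and `π` as the `ϱ`-power. -/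
def PiTerm.evalRho {Λ : Type u} : PiTerm Λ → GWord Λ
  | letter a => GWord.ofList [a]
  | letterMul a t => (GWord.ofList [a]).concat t.evalRho
  | pi s => s.evalRho.power Rho
  | piMul s t => (s.evalRho.power Rho).concat t.evalRho

/-- Isomorphism of generalized words; isomorphic words are identified. -/
def GWord.Isom {Λ : Type u} (w w' : GWord Λ) : Prop :=
  ∃ f : w.Pos ≃o w'.Pos, ∀ p, w'.label (f p) = w.label p

/-- Up to isomorphism, `evalRho` is multiplicative on all `π`-terms. Hence it is the unique morphism
of `π`-algebras that maps each letter `a` to the one-position word `a`. -/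
theorem PiTerm.evalRho_mul {Λ : Type u} (s t : PiTerm Λ) :
    (s * t).evalRho.Isom (s.evalRho.concat t.evalRho) := by
  have step : ∀ a b c d : GWord Λ, b.Isom (c.concat d) →
      (a.concat b).Isom ((a.concat c).concat d) := by
    rintro a b c d ⟨f, hf⟩
    let g : (a.Pos ⊕ₗ c.Pos) ⊕ₗ d.Pos ≃o a.Pos ⊕ₗ b.Pos :=
      (OrderIso.sumLexAssoc _ _ _).trans ((OrderIso.refl _).sumLexCongr f.symm)
    have hg : ∀ p, (a.concat b).label (g p) = ((a.concat c).concat d).label p := by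
      have hf' : ∀ q, b.label (f.symm q) = (c.concat d).label q := fun q => by
        rw [← hf, f.apply_symm_apply]
      rintro ((p | p) | p)
      · rfl
      · exact hf' (toLex (Sum.inl p))
      · exact hf' (toLex (Sum.inr p))
    exact ⟨g.symm, fun p => (hg (g.symm p)).symm.trans
      (congrArg (a.concat b).label (g.apply_symm_apply p))⟩
  change (s.append t).evalRho.Isom _
  induction s with
  | letter a => exact ⟨OrderIso.refl _, fun _ => rfl⟩
  | letterMul a r ih => exact step _ _ _ _ ih
  | pi r _ => exact ⟨OrderIso.refl _, fun _ => rfl⟩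
  | piMul q r _ ih => exact step _ _ _ _ ih

/-! ### First-order logic over words -/

/-- First-order formulae over words, with labels from `Λ` and variables from `V`. -/
inductive Formula (Λ : Type u) (V : Type v) : Type (max u v)
  | top : Formula Λ V
  | bot : Formula Λ V
  | empty : Formula Λ V
  | eq (x y : V) : Formula Λ V
  | lab (x : V) (a : Λ) : Formula Λ V
  | lt (x y : V) : Formula Λ V
  | le (x y : V) : Formula Λ V
  | suc (x y : V) : Formula Λ V
  | min (x : V) : Formula Λ V
  | max (x : V) : Formula Λ V
  | neg (φ : Formula Λ V) : Formula Λ V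
  | or (φ ψ : Formula Λ V) : Formula Λ V
  | and (φ ψ : Formula Λ V) : Formula Λ V
  | ex (x : V) (φ : Formula Λ V) : Formula Λ V
  | all (x : V) (φ : Formula Λ V) : Formula Λ V

/-- A valuation `⟨u, α⟩`: a word `u` together with a partial map `α` from the variables to the
positions of `u`. The domain of `α` is the set of variables at which it is not `none`. -/
structure Valuation (Λ : Type u) (V : Type v) : Type (max u v 1) where
  word : GWord Λ
  val : V → Option word.Pos

namespace Valuation

variable {Λ : Type u} {V : Type v}

/-- The domain of the partial map. -/
def dom (s : Valuation Λ V) : Set V := {x | s.val x ≠ none}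

open Classical in
/-- The valuation `⟨u, α[x/p]⟩`. -/
noncomputable def update (s : Valuation Λ V) (x : V) (p : s.word.Pos) : Valuation Λ V where
  word := s.word
  val := Function.update s.val x (some p)

/-- The valuation on `w` with empty domain. -/
def ofWord (w : GWord Λ) : Valuation Λ V where
  word := w
  val _ := none

end Valuation

namespace Formula

variable {Λ : Type u} {V : Type v}

/-- The free variables of a formula. -/
def FV : Formula Λ V → Set V
  | top | bot | empty => ∅
  | eq x y | lt x y | le x y | suc x y => {x, y}
  | lab x _ | min x | max x => {x}
  | neg φ => FV φ
  | or φ ψ | and φ ψ => FV φ ∪ FV ψ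
  | ex x φ | all x φ => FV φ \ {x}

/-- The satisfaction relation `⟨u, α⟩ ⊨ φ`. It is used only if the free variables of `φ` belong to
the domain of `α`. -/
def Sat : Formula Λ V → Valuation Λ V → Prop
  | top, _ => True
  | bot, _ => False
  | empty, s => IsEmpty s.word.Pos
  | eq x y, s => ∃ p q, s.val x = some p ∧ s.val y = some q ∧ p = q
  | lab x a, s => ∃ p, s.val x = some p ∧ s.word.label p = a
  | lt x y, s => ∃ p q, s.val x = some p ∧ s.val y = some q ∧ p < q
  | le x y, s => ∃ p q, s.val x = some p ∧ s.val y = some q ∧ p ≤ q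
  | suc x y, s => ∃ p q, s.val x = some p ∧ s.val y = some q ∧ p ⋖ q
  | min x, s => ∃ p, s.val x = some p ∧ IsBot p
  | max x, s => ∃ p, s.val x = some p ∧ IsTop p
  | neg φ, s => ¬ Sat φ s
  | or φ ψ, s => Sat φ s ∨ Sat ψ s
  | and φ ψ, s => Sat φ s ∧ Sat ψ s
  | ex x φ, s => ∃ p, Sat φ (s.update x p)
  | all x φ, s => ∀ p, Sat φ (s.update x p)

/-- Atomic formulae. -/
def IsAtomic : Formula Λ V → Prop
  | neg _ | or _ _ | and _ _ | ex _ _ | all _ _ => False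
  | _ => True

/-- A literal is an atomic formula or the negation of an atomic formula. -/
def IsLiteral (φ : Formula Λ V) : Prop :=
  φ.IsAtomic ∨ ∃ ψ : Formula Λ V, ψ.IsAtomic ∧ φ = neg ψ

end Formula

/-- A language `L ⊆ A⁺` over a finite alphabet `A ⊆ Λ` is definable in `F` over non-empty words if
`L = {w ∈ A⁺ | w ⊨ φ}` for some sentence `φ ∈ F`. -/
def Definable {Λ : Type u} {V : Type v} (F : Set (Formula Λ V)) {A : Finset Λ}
    (L : Set (FreeSemigroup A)) : Prop :=
  ∃ φ ∈ F, φ.FV = ∅ ∧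
    L = {w | φ.Sat (Valuation.ofWord (GWord.ofList ((toList w).map Subtype.val)))}

/-! ### Fragments -/

/-- A context: a formula with a unique occurrence of a placeholder `hole`. -/
inductive Context (Λ : Type u) (V : Type v) : Type (max u v)
  | hole : Context Λ V
  | neg (μ : Context Λ V) : Context Λ V
  | orLeft (μ : Context Λ V) (ψ : Formula Λ V) : Context Λ V
  | orRight (ψ : Formula Λ V) (μ : Context Λ V) : Context Λ V
  | andLeft (μ : Context Λ V) (ψ : Formula Λ V) : Context Λ V
  | andRight (ψ : Formula Λ V) (μ : Context Λ V) : Context Λ V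
  | ex (x : V) (μ : Context Λ V) : Context Λ V
  | all (x : V) (μ : Context Λ V) : Context Λ V

/-- `μ.fill φ` is `μ(φ)`, the result of replacing the placeholder in `μ` by `φ`. -/
def Context.fill {Λ : Type u} {V : Type v} : Context Λ V → Formula Λ V → Formula Λ V
  | hole, φ => φ
  | neg μ, φ => .neg (μ.fill φ)
  | orLeft μ ψ, φ => .or (μ.fill φ) ψ
  | orRight ψ μ, φ => .or ψ (μ.fill φ)
  | andLeft μ ψ, φ => .and (μ.fill φ) ψ
  | andRight ψ μ, φ => .and ψ (μ.fill φ)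
  | ex x μ, φ => .ex x (μ.fill φ)
  | all x μ, φ => .all x (μ.fill φ)

/-- Fragments of first-order logic over words. -/
structure IsFragment {Λ : Type u} {V : Type v} (F : Set (Formula Λ V)) : Prop where
  nonempty : F.Nonempty
  top_mem : ∀ (μ : Context Λ V) φ, μ.fill φ ∈ F → μ.fill .top ∈ F
  bot_mem : ∀ (μ : Context Λ V) φ, μ.fill φ ∈ F → μ.fill .bot ∈ F
  lab_mem : ∀ (μ : Context Λ V) φ x a, μ.fill φ ∈ F → μ.fill (.lab x a) ∈ F
  or_mem_iff : ∀ (μ : Context Λ V) φ ψ,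
    μ.fill (.or φ ψ) ∈ F ↔ μ.fill φ ∈ F ∧ μ.fill ψ ∈ F
  and_mem_iff : ∀ (μ : Context Λ V) φ ψ,
    μ.fill (.and φ ψ) ∈ F ↔ μ.fill φ ∈ F ∧ μ.fill ψ ∈ F
  neg_neg : ∀ (μ : Context Λ V) φ, μ.fill (.neg (.neg φ)) ∈ F → μ.fill φ ∈ F
  ex_elim : ∀ (μ : Context Λ V) x φ, μ.fill (.ex x φ) ∈ F → x ∉ φ.FV → μ.fill φ ∈ F
  all_elim : ∀ (μ : Context Λ V) x φ, μ.fill (.all x φ) ∈ F → x ∉ φ.FV → μ.fill φ ∈ F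

/-- Order-stability. -/
def OrderStable {Λ : Type u} {V : Type v} (F : Set (Formula Λ V)) : Prop :=
  ∀ (μ : Context Λ V) x y, μ.fill (.lt x y) ∈ F ↔ μ.fill (.le x y) ∈ F

/-- `suc`-stability. -/
structure SucStable {Λ : Type u} {V : Type v} (F : Set (Formula Λ V)) : Prop where
  suc_mem : ∀ (μ : Context Λ V) x y, μ.fill (.suc x y) ∈ F →
    μ.fill (.eq x y) ∈ F ∧ μ.fill (.max x) ∈ F ∧ μ.fill (.min y) ∈ F
  empty_mem : ∀ (μ : Context Λ V) x, μ.fill (.min x) ∈ F ∨ μ.fill (.max x) ∈ F →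
    μ.fill .empty ∈ F

/-! ### Ehrenfeucht-Fraïssé games for fragments -/

/-- The quantifiers `∃`, `∀`, `¬∃` and `¬∀`. -/
inductive Quant : Type
  | ex | all | negEx | negAll

/-- The formula `Q x φ`. -/
def Quant.app {Λ : Type u} {V : Type v} : Quant → V → Formula Λ V → Formula Λ V
  | ex, x, φ => .ex x φ
  | all, x, φ => .all x φ
  | negEx, x, φ => .neg (.ex x φ)
  | negAll, x, φ => .neg (.all x φ)

/-- The reduct of `F` by `Q x`. -/
def reduct {Λ : Type u} {V : Type v} (Q : Quant) (x : V) (F : Set (Formula Λ V)) :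
    Set (Formula Λ V) :=
  {φ | Q.app x φ ∈ F}

/-- A configuration `(G, ⟨u, α⟩, ⟨v, β⟩)` of the game. -/
structure Config (Λ : Type u) (V : Type v) : Type (max u v 1) where
  frag : Set (Formula Λ V)
  left : Valuation Λ V
  right : Valuation Λ V

namespace Config

variable {Λ : Type u} {V : Type v}

/-- The initial configuration `(F, u, v)` of the `F`-game on `(u, v)`. -/
def initial (F : Set (Formula Λ V)) (w w' : GWord Λ) : Config Λ V :=
  ⟨F, Valuation.ofWord w, Valuation.ofWord w'⟩

/-- The valuation in whose word Spoiler chooses his position, given his quantifier. -/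
def questSide (S : Config Λ V) : Quant → Valuation Λ V
  | .ex | .negAll => S.left
  | .all | .negEx => S.right

/-- The valuation in whose word Duplicator replies, given Spoiler's quantifier. -/
def replySide (S : Config Λ V) : Quant → Valuation Λ V
  | .ex | .negAll => S.right
  | .all | .negEx => S.left

/-- A complete choice of Spoiler in a round: a quantifier `Q` and a variable `x` for which the
reduct is non-empty, and a position in the appropriate word. -/
structure Quest (S : Config Λ V) where
  Q : Quant
  x : V
  reduct_nonempty : (reduct Q x S.frag).Nonempty
  pos : (S.questSide Q).word.Pos

/-- The replies among which Duplicator can choose. -/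
abbrev Reply {S : Config Λ V} (m : S.Quest) : Type := (S.replySide m.Q).word.Pos

/-- The configuration resulting from a round. For `Q = ∃` and `Q = ∀`, the words keep their roles;
for `Q = ¬∃` and `Q = ¬∀`, the roles are interchanged. -/
noncomputable def next {S : Config Λ V} (m : S.Quest) (r : Reply m) : Config Λ V :=
  let q' := (S.questSide m.Q).update m.x m.pos
  let r' := (S.replySide m.Q).update m.x r
  match m.Q with
  | .ex | .negEx => ⟨reduct m.Q m.x S.frag, q', r'⟩
  | .all | .negAll => ⟨reduct m.Q m.x S.frag, r', q'⟩

/-- The winning condition of Spoiler: some literal of the current fragment, all of whose free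
variables have values, holds on the left but not on the right. -/
def SpoilerWins (S : Config Λ V) : Prop :=
  ∃ φ ∈ S.frag, φ.IsLiteral ∧ φ.FV ⊆ S.left.dom ∧ φ.FV ⊆ S.right.dom ∧
    φ.Sat S.left ∧ ¬ φ.Sat S.right

end Config

/-- Finite sequences of complete rounds of the game, leading from `S₀` to a configuration. -/
inductive Play {Λ : Type u} {V : Type v} (S₀ : Config Λ V) : Config Λ V → Type (max u v 1)
  | start : Play S₀ S₀
  | round {S : Config Λ V} (h : Play S₀ S) (m : S.Quest) (r : Config.Reply m) :
      Play S₀ (Config.next m r)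

/-- A strategy of Duplicator in the game starting in `S₀`: it yields a reply, or none, depending on
the play so far and on Spoiler's current choice. -/
def Strategy {Λ : Type u} {V : Type v} (S₀ : Config Λ V) : Type (max u v 1) :=
  ∀ (S : Config Λ V), Play S₀ S → ∀ m : S.Quest, Option (Config.Reply m)

namespace Strategy

variable {Λ : Type u} {V : Type v} {S₀ : Config Λ V}

/-- The plays in which Duplicator has followed the strategy. -/
inductive Follows (σ : Strategy S₀) : ∀ S : Config Λ V, Play S₀ S → Prop
  | start : Follows σ S₀ .start
  | round {S : Config Λ V} {h : Play S₀ S} {m : S.Quest} {r : Config.Reply m} :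
      Follows σ S h → σ S h m = some r → Follows σ (Config.next m r) (.round h m r)

/-- A strategy is winning if no play following it reaches Spoiler's winning condition, and if it
provides a reply whenever Duplicator has to move. Plays that last forever, and plays in which
Spoiler is unable to move, are won by Duplicator. -/
def IsWinning (σ : Strategy S₀) : Prop :=
  ∀ (S : Config Λ V) (h : Play S₀ S), σ.Follows S h →
    ¬ S.SpoilerWins ∧ ∀ m : S.Quest, σ S h m ≠ none

end Strategy

/-- Duplicator has a winning strategy in the `F`-game on `(u, v)`. -/
def DuplicatorWins {Λ : Type u} {V : Type v} (F : Set (Formula Λ V)) (w w' : GWord Λ) : Prop :=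
  ∃ σ : Strategy (Config.initial F w w'), σ.IsWinning

end PiGames

namespace PiGames

universe u v w

/-! ### Partial valuations -/

section Partial

variable {V : Type v} {P : Type w} {Q : Type*}

/-! For finitely many quantifiers, the order type `Rho` cannot be told apart from a sufficiently
long finite chain. Both are discrete with endpoints, and such orderings are determined up to `k`
rounds by the distance between the endpoints, cut off at `2 ^ k` (`EF.of_sameDist`). Since
back-and-forth equivalence is compatible with concatenation and powers (`EF.concat`, `EF.power`),
the word of a term `s` satisfies a given sentence `φ` iff the finite word does that arises by
reading `π` as a large power `N + 1` (`PiTerm.ef_evalRho`). The same fact shows that powers in the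
syntactic semigroup of a definable language become stationary, so that the idempotent power is the
power `N + 1` and morphisms can be computed on these finite words (`hom_eq_evalPow`).

From games to identities: membership in the syntactic congruence concerns words `x σ(u) y`, where
`σ` replaces letters by non-empty words and `u` is the finite word of `s` or `t`. A winning strategy
on `(u, v)` is turned into one on `(x σ(u) y, x σ(v) y)` (`DuplicatorWins.frame`). Comparing two
positions there by an atomic formula may amount to comparing the underlying letters by a different
one, and the two stability conditions say that the fragment contains what is needed. Applied to the
given fragment this passes from `s` to `t`; applied to the fragment of bounded quantifier depth it
passes between the word of a term and its finite approximation.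

From identities to games: choosing the morphism that maps each letter to itself shows that every
sentence of `F` passes from the word of `s` to that of `t`, and conversely. Preservation of
sentences yields only replies that are good for finitely many formulae at a time, because the
conjunction of these belongs to the fragment. A reply that is good for all of them exists by
compactness: words of terms are saturated along ultrafilters (`PiTerm.saturated_evalRho`). This is
where the exact shape of `Rho` enters: between points at infinite distance there is always a point
at infinite distance from both (`Rho.denseGaps`). -/

open Classical in
/-- The partial map `α` with its value at `x` replaced by `o`. -/
noncomputable def upd (α : V → Option P) (x : V) (o : Option P) : V → Option P :=
  Function.update α x o

@[simp] theorem upd_same (α : V → Option P) (x : V) (o : Option P) : upd α x o x = o := by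
  classical exact Function.update_self ..

theorem upd_of_ne (α : V → Option P) {x y : V} (h : y ≠ x) (o : Option P) :
    upd α x o y = α y := by
  classical exact Function.update_of_ne h ..

theorem upd_apply (α : V → Option P) (x y : V) (o : Option P) [Decidable (y = x)] :
    upd α x o y = if y = x then o else α y := by
  split_ifs with h
  · subst h; simp
  · exact upd_of_ne α h o

@[simp] theorem upd_upd (α : V → Option P) (x : V) (o o' : Option P) :
    upd (upd α x o) x o' = upd α x o' := by
  classical
  funext z
  simp only [upd_apply]
  split_ifs <;> rfl

theorem upd_comm (α : V → Option P) {x y : V} (h : x ≠ y) (o o' : Option P) :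
    upd (upd α x o) y o' = upd (upd α y o') x o := by
  classical
  funext z
  simp only [upd_apply]
  split_ifs <;> simp_all

theorem upd_map (α : V → Option P) (x : V) (o : Option P) (f : P → Q) :
    (fun y => (upd α x o y).map f) = upd (fun y => (α y).map f) x (o.map f) := by
  classical
  funext z
  simp only [upd_apply]
  split_ifs <;> rfl

end Partial

variable {Λ : Type u} {V : Type v}

/-! ### Back-and-forth equivalence -/

/-- The pointed words `(u, α)` and `(v, β)` agree with respect to labels and order. -/
structure AtomEquiv (u v : GWord Λ) (α : V → Option u.Pos) (β : V → Option v.Pos) : Prop where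
  dom : ∀ x, α x = none ↔ β x = none
  label : ∀ x p p', α x = some p → β x = some p' → u.label p = v.label p'
  lt_iff : ∀ x y p q p' q', α x = some p → α y = some q → β x = some p' → β y = some q' →
    (p < q ↔ p' < q')

/-- Duplicator survives `k` rounds of the Ehrenfeucht-Fraïssé game on `(u, α)` and `(v, β)`. -/
def EF (u v : GWord Λ) : ℕ → (V → Option u.Pos) → (V → Option v.Pos) → Prop
  | 0, α, β => AtomEquiv u v α β
  | k + 1, α, β => EF u v k α β ∧
      (∀ x p, ∃ p', EF u v k (upd α x (some p)) (upd β x (some p'))) ∧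
      (∀ x p', ∃ p, EF u v k (upd α x (some p)) (upd β x (some p')))

namespace EF

variable {u v w : GWord Λ}

theorem mono {j k : ℕ} {α : V → Option u.Pos} {β : V → Option v.Pos}
    (h : EF u v k α β) (hjk : j ≤ k) : EF u v j α β := by
  induction hjk with
  | refl => exact h
  | step _ ih => exact ih h.1

theorem atom {k : ℕ} {α : V → Option u.Pos} {β : V → Option v.Pos}
    (h : EF u v k α β) : AtomEquiv u v α β := h.mono (Nat.zero_le k)

end EF

namespace AtomEquiv

variable {u v : GWord Λ} {α : V → Option u.Pos} {β : V → Option v.Pos}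

theorem exists_right (h : AtomEquiv u v α β) {x : V} {p : u.Pos} (hp : α x = some p) :
    ∃ p', β x = some p' := by
  rw [← Option.ne_none_iff_exists']
  intro hb
  rw [(h.dom x).2 hb] at hp
  cases hp

theorem exists_left (h : AtomEquiv u v α β) {x : V} {p : v.Pos} (hp : β x = some p) :
    ∃ p', α x = some p' := by
  rw [← Option.ne_none_iff_exists']
  intro hb
  rw [(h.dom x).1 hb] at hp
  cases hp

theorem eq_iff (h : AtomEquiv u v α β) {x y : V} {p q : u.Pos} {p' q' : v.Pos}
    (hp : α x = some p) (hq : α y = some q) (hp' : β x = some p') (hq' : β y = some q') :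
    p = q ↔ p' = q' := by
  have h1 := h.lt_iff x y p q p' q' hp hq hp' hq'
  have h2 := h.lt_iff y x q p q' p' hq hp hq' hp'
  constructor
  · rintro rfl
    exact le_antisymm (not_lt.1 fun hh => lt_irrefl _ (h2.2 hh))
      (not_lt.1 fun hh => lt_irrefl _ (h1.2 hh))
  · rintro rfl
    exact le_antisymm (not_lt.1 fun hh => lt_irrefl _ (h2.1 hh))
      (not_lt.1 fun hh => lt_irrefl _ (h1.1 hh))

theorem refl (u : GWord Λ) (α : V → Option u.Pos) : AtomEquiv u u α α := by
  refine ⟨fun _ => Iff.rfl, fun x p p' h h' => ?_, fun x y p q p' q' h1 h2 h3 h4 => ?_⟩ <;>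
    simp_all

theorem symm (h : AtomEquiv u v α β) : AtomEquiv v u β α :=
  ⟨fun x => (h.dom x).symm, fun x p p' h1 h2 => (h.label x p' p h2 h1).symm,
    fun x y p q p' q' h1 h2 h3 h4 => (h.lt_iff x y p' q' p q h3 h4 h1 h2).symm⟩

theorem trans {w : GWord Λ} {γ : V → Option w.Pos} (h : AtomEquiv u v α β)
    (h' : AtomEquiv v w β γ) : AtomEquiv u w α γ := by
  refine ⟨fun x => (h.dom x).trans (h'.dom x), fun x p p' h1 h2 => ?_,
    fun x y p q p' q' h1 h2 h3 h4 => ?_⟩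
  · obtain ⟨r, hr⟩ := h.exists_right h1
    exact (h.label x p r h1 hr).trans (h'.label x r p' hr h2)
  · obtain ⟨r, hr⟩ := h.exists_right h1
    obtain ⟨r', hr'⟩ := h.exists_right h2
    exact (h.lt_iff x y p q r r' h1 h2 hr hr').trans (h'.lt_iff x y r r' p' q' hr hr' h3 h4)

theorem erase (h : AtomEquiv u v α β) (x : V) :
    AtomEquiv u v (upd α x none) (upd β x none) := by
  classical
  refine ⟨fun y => ?_, fun y p p' h1 h2 => ?_, fun y z p q p' q' h1 h2 h3 h4 => ?_⟩
  · simp only [upd_apply]; split_ifs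
    · simp
    · exact h.dom y
  · simp only [upd_apply] at h1 h2; split_ifs at h1 h2
    exact h.label y p p' h1 h2
  · simp only [upd_apply] at h1 h2 h3 h4; split_ifs at h1 h2 h3 h4
    exact h.lt_iff y z p q p' q' h1 h2 h3 h4

end AtomEquiv

namespace EF

variable {u v w : GWord Λ}

theorem refl (u : GWord Λ) : ∀ (k : ℕ) (α : V → Option u.Pos), EF u u k α α
  | 0, α => AtomEquiv.refl u α
  | k + 1, α => ⟨refl u k α, fun _ p => ⟨p, refl u k _⟩, fun _ p => ⟨p, refl u k _⟩⟩

theorem symm : ∀ {k : ℕ} {α : V → Option u.Pos} {β : V → Option v.Pos},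
    EF u v k α β → EF v u k β α
  | 0, _, _, h => AtomEquiv.symm h
  | _ + 1, _, _, h => ⟨symm h.1, fun x p => (h.2.2 x p).imp fun _ hq => symm hq,
      fun x p => (h.2.1 x p).imp fun _ hq => symm hq⟩

theorem trans : ∀ {k : ℕ} {α : V → Option u.Pos} {β : V → Option v.Pos} {γ : V → Option w.Pos},
    EF u v k α β → EF v w k β γ → EF u w k α γ
  | 0, _, _, _, h, h' => AtomEquiv.trans h h'
  | k + 1, _, _, _, h, h' => by
    refine ⟨trans h.1 h'.1, fun x p => ?_, fun x p => ?_⟩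
    · obtain ⟨q, hq⟩ := h.2.1 x p
      obtain ⟨r, hr⟩ := h'.2.1 x q
      exact ⟨r, trans hq hr⟩
    · obtain ⟨q, hq⟩ := h'.2.2 x p
      obtain ⟨r, hr⟩ := h.2.2 x q
      exact ⟨r, trans hr hq⟩

/-- Needed for composition: when a variable is reused in one component of a compound word, it
disappears from the others. -/
theorem erase : ∀ {k : ℕ} {α : V → Option u.Pos} {β : V → Option v.Pos}
    (_ : EF u v k α β) (x : V), EF u v k (upd α x none) (upd β x none)
  | 0, _, _, h, x => AtomEquiv.erase h x
  | k + 1, α, β, h, x => by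
    refine ⟨erase h.1 x, fun y p => ?_, fun y p => ?_⟩
    · obtain ⟨q, hq⟩ := h.2.1 y p
      refine ⟨q, ?_⟩
      rcases eq_or_ne x y with rfl | hxy
      · simpa using hq
      · rw [upd_comm _ hxy, upd_comm _ hxy]
        exact erase hq x
    · obtain ⟨q, hq⟩ := h.2.2 y p
      refine ⟨q, ?_⟩
      rcases eq_or_ne x y with rfl | hxy
      · simpa using hq
      · rw [upd_comm _ hxy, upd_comm _ hxy]
        exact erase hq x

theorem of_orderIso (f : u.Pos ≃o v.Pos) (hf : ∀ p, v.label (f p) = u.label p) :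
    ∀ (k : ℕ) (α : V → Option u.Pos), EF u v k α (fun x => (α x).map f)
  | 0, α => by
    refine ⟨fun x => by simp, fun x p p' h h' => ?_, fun x y p q p' q' h1 h2 h3 h4 => ?_⟩
    · simp only [h, Option.map_some, Option.some.injEq] at h'
      rw [← h', hf]
    · simp only [h1, h2, Option.map_some, Option.some.injEq] at h3 h4
      rw [← h3, ← h4, f.lt_iff_lt]
  | k + 1, α => by
    refine ⟨of_orderIso f hf k α, fun x p => ⟨f p, ?_⟩, fun x p => ⟨f.symm p, ?_⟩⟩
    · simpa only [upd_map, Option.map_some] using of_orderIso f hf k (upd α x (some p))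
    · simpa only [upd_map, Option.map_some, f.apply_symm_apply] using
        of_orderIso f hf k (upd α x (some (f.symm p)))

theorem of_isom (h : u.Isom v) (k : ℕ) : EF u v k (fun _ : V => none) (fun _ => none) := by
  obtain ⟨f, hf⟩ := h
  simpa using of_orderIso f hf k (fun _ : V => none)

end EF

/-! ### Formulae and back-and-forth equivalence -/

namespace Formula

/-- The quantifier depth of a formula. -/
def depth : Formula Λ V → ℕ
  | neg φ => depth φ
  | or φ ψ | and φ ψ => Max.max (depth φ) (depth ψ)
  | ex _ φ | all _ φ => depth φ + 1
  | _ => 0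

end Formula

/-- The predicates `empty`, `suc`, `min` and `max` hide one quantifier. The single round pays for
it: a counterexample on the right is answered by one on the left. -/
theorem EF.sat_of_isAtomic [Infinite V] {u v : GWord Λ} {α : V → Option u.Pos}
    {β : V → Option v.Pos} (h : EF u v 1 α β) {φ : Formula Λ V} (hφ : φ.IsAtomic)
    (hs : φ.Sat ⟨u, α⟩) : φ.Sat ⟨v, β⟩ := by
  have h0 : AtomEquiv u v α β := h.1
  cases φ with
  | top => trivial
  | bot => exact hs
  | empty =>
    refine ⟨fun p' => ?_⟩
    obtain ⟨p, -⟩ := h.2.2 (Classical.arbitrary V) p'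
    exact hs.false p
  | eq x y =>
    obtain ⟨p, q, hp, hq, hpq⟩ := hs
    obtain ⟨p', hp'⟩ := h0.exists_right hp
    obtain ⟨q', hq'⟩ := h0.exists_right hq
    exact ⟨p', q', hp', hq', (h0.eq_iff hp hq hp' hq').1 hpq⟩
  | lab x a =>
    obtain ⟨p, hp, ha⟩ := hs
    obtain ⟨p', hp'⟩ := h0.exists_right hp
    exact ⟨p', hp', (h0.label x p p' hp hp').symm.trans ha⟩
  | lt x y =>
    obtain ⟨p, q, hp, hq, hpq⟩ := hs
    obtain ⟨p', hp'⟩ := h0.exists_right hp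
    obtain ⟨q', hq'⟩ := h0.exists_right hq
    exact ⟨p', q', hp', hq', (h0.lt_iff x y _ _ _ _ hp hq hp' hq').1 hpq⟩
  | le x y =>
    obtain ⟨p, q, hp, hq, hpq⟩ := hs
    obtain ⟨p', hp'⟩ := h0.exists_right hp
    obtain ⟨q', hq'⟩ := h0.exists_right hq
    refine ⟨p', q', hp', hq', not_lt.1 fun hh => ?_⟩
    exact absurd ((h0.lt_iff y x _ _ _ _ hq hp hq' hp').2 hh) (not_lt.2 hpq)
  | suc x y =>
    obtain ⟨p, q, hp, hq, hpq⟩ := hs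
    obtain ⟨p', hp'⟩ := h0.exists_right hp
    obtain ⟨q', hq'⟩ := h0.exists_right hq
    refine ⟨p', q', hp', hq', (h0.lt_iff x y _ _ _ _ hp hq hp' hq').1 hpq.1, fun c' h1 h2 => ?_⟩
    classical
    -- The extra position must be stored in a variable other than `x` and `y`, whose values are
    -- still needed.
    obtain ⟨z, hz⟩ := Infinite.exists_notMem_finset ({x, y} : Finset V)
    simp only [Finset.mem_insert, Finset.mem_singleton, not_or] at hz
    obtain ⟨c, hc⟩ := h.2.2 z c'
    have hc : AtomEquiv u v _ _ := hc
    have e1 := hc.lt_iff x z p c p' c' (by rwa [upd_of_ne _ (Ne.symm hz.1)]) (by simp)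
      (by rwa [upd_of_ne _ (Ne.symm hz.1)]) (by simp)
    have e2 := hc.lt_iff z y c q c' q' (by simp) (by rwa [upd_of_ne _ (Ne.symm hz.2)]) (by simp)
      (by rwa [upd_of_ne _ (Ne.symm hz.2)])
    exact hpq.2 (e1.2 h1) (e2.2 h2)
  | min x =>
    obtain ⟨p, hp, hb⟩ := hs
    obtain ⟨p', hp'⟩ := h0.exists_right hp
    refine ⟨p', hp', fun c' => not_lt.1 fun hlt => ?_⟩
    obtain ⟨z, hz⟩ := exists_ne x
    obtain ⟨c, hc⟩ := h.2.2 z c'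
    have hc : AtomEquiv u v _ _ := hc
    have e1 := hc.lt_iff z x c p c' p' (by simp) (by rwa [upd_of_ne _ (Ne.symm hz)])
      (by simp) (by rwa [upd_of_ne _ (Ne.symm hz)])
    exact absurd (e1.2 hlt) (not_lt.2 (hb c))
  | max x =>
    obtain ⟨p, hp, hb⟩ := hs
    obtain ⟨p', hp'⟩ := h0.exists_right hp
    refine ⟨p', hp', fun c' => not_lt.1 fun hlt => ?_⟩
    obtain ⟨z, hz⟩ := exists_ne x
    obtain ⟨c, hc⟩ := h.2.2 z c'
    have hc : AtomEquiv u v _ _ := hc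
    have e1 := hc.lt_iff x z p c p' c' (by rwa [upd_of_ne _ (Ne.symm hz)]) (by simp)
      (by rwa [upd_of_ne _ (Ne.symm hz)]) (by simp)
    exact absurd (e1.2 hlt) (not_lt.2 (hb c))
  | neg _ | or _ _ | and _ _ | ex _ _ | all _ _ => exact hφ.elim

/-- One round beyond the quantifier depth is kept in reserve for the atomic formulae. -/
theorem EF.sat_iff [Infinite V] {u v : GWord Λ} (φ : Formula Λ V) :
    ∀ {k : ℕ} {α : V → Option u.Pos} {β : V → Option v.Pos}, φ.depth ≤ k →
      EF u v (k + 1) α β → (φ.Sat ⟨u, α⟩ ↔ φ.Sat ⟨v, β⟩) := by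
  have atomic : ∀ {φ : Formula Λ V}, φ.IsAtomic → ∀ {k : ℕ} {α : V → Option u.Pos}
      {β : V → Option v.Pos}, EF u v (k + 1) α β → (φ.Sat ⟨u, α⟩ ↔ φ.Sat ⟨v, β⟩) := by
    intro φ hφ k α β h
    have h1 : EF u v 1 α β := h.mono (by omega)
    exact ⟨h1.sat_of_isAtomic hφ, h1.symm.sat_of_isAtomic hφ⟩
  induction φ with
  | top | bot | empty | eq | lab | lt | le | suc | min | max =>
    intro k α β _ h
    refine atomic ?_ h
    trivial
  | neg φ ih =>
    intro k α β hk h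
    exact not_congr (ih hk h)
  | or φ ψ ih1 ih2 =>
    intro k α β hk h
    exact or_congr (ih1 (le_trans (le_max_left _ _) hk) h) (ih2 (le_trans (le_max_right _ _) hk) h)
  | and φ ψ ih1 ih2 =>
    intro k α β hk h
    exact and_congr (ih1 (le_trans (le_max_left _ _) hk) h)
      (ih2 (le_trans (le_max_right _ _) hk) h)
  | ex x φ ih =>
    intro k α β hk h
    obtain ⟨k, rfl⟩ : ∃ j, k = j + 1 := ⟨k - 1, by simp only [Formula.depth] at hk; omega⟩
    have hk' : φ.depth ≤ k := by simp only [Formula.depth] at hk; omega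
    constructor
    · rintro ⟨p, hp⟩
      obtain ⟨q, hq⟩ := h.2.1 x p
      exact ⟨q, (ih hk' hq).1 hp⟩
    · rintro ⟨p, hp⟩
      obtain ⟨q, hq⟩ := h.2.2 x p
      exact ⟨q, (ih hk' hq).2 hp⟩
  | all x φ ih =>
    intro k α β hk h
    obtain ⟨k, rfl⟩ : ∃ j, k = j + 1 := ⟨k - 1, by simp only [Formula.depth] at hk; omega⟩
    have hk' : φ.depth ≤ k := by simp only [Formula.depth] at hk; omega
    constructor
    · intro hp q
      obtain ⟨p, hq⟩ := h.2.2 x q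
      exact (ih hk' hq).1 (hp p)
    · intro hp q
      obtain ⟨p, hq⟩ := h.2.1 x q
      exact (ih hk' hq).2 (hp p)

/-! ### Composition: concatenation -/

namespace GWord

variable {u v : GWord Λ}

/-- The embedding of `u` into `u v`. -/
def inl (p : u.Pos) : (u.concat v).Pos := toLex (Sum.inl p)

/-- The embedding of `v` into `u v`. -/
def inr (p : v.Pos) : (u.concat v).Pos := toLex (Sum.inr p)

/-- The position of `u` that corresponds to a position of `u v`, if any. -/
def getL (p : (u.concat v).Pos) : Option u.Pos := Sum.getLeft? (ofLex p)

/-- The position of `v` that corresponds to a position of `u v`, if any. -/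
def getR (p : (u.concat v).Pos) : Option v.Pos := Sum.getRight? (ofLex p)

@[simp] theorem getL_inl (p : u.Pos) : getL (inl p : (u.concat v).Pos) = some p := rfl
@[simp] theorem getR_inl (p : u.Pos) : getR (inl p : (u.concat v).Pos) = none := rfl
@[simp] theorem getL_inr (p : v.Pos) : getL (inr p : (u.concat v).Pos) = none := rfl
@[simp] theorem getR_inr (p : v.Pos) : getR (inr p : (u.concat v).Pos) = some p := rfl

theorem inl_or_inr (p : (u.concat v).Pos) : (∃ q, p = inl q) ∨ ∃ q, p = inr q := by
  rcases p with p | p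
  · exact Or.inl ⟨p, rfl⟩
  · exact Or.inr ⟨p, rfl⟩

theorem inl_lt_inl {p q : u.Pos} : (inl p : (u.concat v).Pos) < inl q ↔ p < q :=
  Sum.Lex.inl_lt_inl_iff

theorem inr_lt_inr {p q : v.Pos} : (inr p : (u.concat v).Pos) < inr q ↔ p < q :=
  Sum.Lex.inr_lt_inr_iff

theorem inl_lt_inr (p : u.Pos) (q : v.Pos) : (inl p : (u.concat v).Pos) < inr q :=
  Sum.Lex.inl_lt_inr _ _

end GWord

open GWord

namespace EF

/-- The part of a partial valuation of `u v` that lies in `u`. -/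
def leftVal {u v : GWord Λ} (α : V → Option (u.concat v).Pos) : V → Option u.Pos :=
  fun x => (α x).bind getL

/-- The part of a partial valuation of `u v` that lies in `v`. -/
def rightVal {u v : GWord Λ} (α : V → Option (u.concat v).Pos) : V → Option v.Pos :=
  fun x => (α x).bind getR

section

variable {u v u' v' : GWord Λ}

theorem upd_bind {P : Type*} {Q : Type*} (α : V → Option P) (x : V) (o : Option P)
    (f : P → Option Q) :
    (fun y => (upd α x o y).bind f) = upd (fun y => (α y).bind f) x (o.bind f) := by
  classical
  funext z
  simp only [upd_apply]
  split_ifs <;> rfl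

theorem leftVal_upd (α : V → Option (u.concat v).Pos) (x : V) (p : (u.concat v).Pos) :
    leftVal (upd α x (some p)) = upd (leftVal α) x (getL p) :=
  upd_bind ..

theorem rightVal_upd (α : V → Option (u.concat v).Pos) (x : V) (p : (u.concat v).Pos) :
    rightVal (upd α x (some p)) = upd (rightVal α) x (getR p) :=
  upd_bind ..

theorem _root_.PiGames.AtomEquiv.concat {α : V → Option (u.concat v).Pos}
    {β : V → Option (u'.concat v').Pos}
    (hl : AtomEquiv u u' (leftVal α) (leftVal β)) (hr : AtomEquiv v v' (rightVal α) (rightVal β)) :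
    AtomEquiv (u.concat v) (u'.concat v') α β := by
  have key : ∀ x, (α x = none ∧ β x = none) ∨
      (∃ p p', α x = some (inl p) ∧ β x = some (inl p') ∧
        leftVal α x = some p ∧ leftVal β x = some p') ∨
      (∃ p p', α x = some (inr p) ∧ β x = some (inr p') ∧
        rightVal α x = some p ∧ rightVal β x = some p') := by
    intro x
    have h1 := hl.dom x
    have h2 := hr.dom x
    have opt : ∀ w w' : GWord Λ, ∀ o : Option (w.concat w').Pos,
        o = none ∨ (∃ p, o = some (inl p)) ∨ ∃ p, o = some (inr p) := by
      intro w w' o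
      rcases o with _ | p
      · exact Or.inl rfl
      · rcases inl_or_inr p with ⟨q, rfl⟩ | ⟨q, rfl⟩
        · exact Or.inr (Or.inl ⟨q, rfl⟩)
        · exact Or.inr (Or.inr ⟨q, rfl⟩)
    rcases opt _ _ (α x) with ha | ⟨p, ha⟩ | ⟨p, ha⟩ <;>
      rcases opt _ _ (β x) with hb | ⟨q, hb⟩ | ⟨q, hb⟩ <;>
      simp [leftVal, rightVal, ha, hb] at h1 h2 ⊢
  refine ⟨fun x => ?_, fun x p p' h h' => ?_, fun x y p q p' q' h1 h2 h3 h4 => ?_⟩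
  · rcases key x with ⟨h, h'⟩ | ⟨p, p', h, h', -⟩ | ⟨p, p', h, h', -⟩ <;> simp [h, h']
  · rcases key x with ⟨e, e'⟩ | ⟨r, r', e, e', f, f'⟩ | ⟨r, r', e, e', f, f'⟩ <;>
      rw [h] at e <;> rw [h'] at e'
    · cases e
    · cases e; cases e'
      exact hl.label x r r' f f'
    · cases e; cases e'
      exact hr.label x r r' f f'
  · rcases key x with ⟨e, e'⟩ | ⟨r, r', e, e', f, f'⟩ | ⟨r, r', e, e', f, f'⟩ <;>
      rw [h1] at e <;> rw [h3] at e' <;>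
      rcases key y with ⟨g, g'⟩ | ⟨s, s', g, g', i, i'⟩ | ⟨s, s', g, g', i, i'⟩ <;>
      rw [h2] at g <;> rw [h4] at g' <;> cases e <;> cases e' <;> cases g <;> cases g'
    · exact inl_lt_inl.trans ((hl.lt_iff x y r s r' s' f i f' i').trans inl_lt_inl.symm)
    · exact iff_of_true (inl_lt_inr _ _) (inl_lt_inr _ _)
    · exact iff_of_false (inl_lt_inr _ _).not_gt (inl_lt_inr _ _).not_gt
    · exact inr_lt_inr.trans ((hr.lt_iff x y r s r' s' f i f' i').trans inr_lt_inr.symm)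

/-- Duplicator answers in the component where Spoiler played; in the other component the variable is
erased. -/
theorem concat : ∀ {k : ℕ} {α : V → Option (u.concat v).Pos} {β : V → Option (u'.concat v').Pos},
    EF u u' k (leftVal α) (leftVal β) → EF v v' k (rightVal α) (rightVal β) →
      EF (u.concat v) (u'.concat v') k α β
  | 0, _, _, hl, hr => AtomEquiv.concat hl hr
  | k + 1, α, β, hl, hr => by
    refine ⟨concat hl.1 hr.1, fun x p => ?_, fun x p => ?_⟩
    · rcases inl_or_inr p with ⟨p, rfl⟩ | ⟨p, rfl⟩
      · obtain ⟨q, hq⟩ := hl.2.1 x p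
        refine ⟨inl q, concat ?_ ?_⟩
        · rw [leftVal_upd, leftVal_upd]; exact hq
        · rw [rightVal_upd, rightVal_upd]; exact hr.1.erase x
      · obtain ⟨q, hq⟩ := hr.2.1 x p
        refine ⟨inr q, concat ?_ ?_⟩
        · rw [leftVal_upd, leftVal_upd]; exact hl.1.erase x
        · rw [rightVal_upd, rightVal_upd]; exact hq
    · rcases inl_or_inr p with ⟨p, rfl⟩ | ⟨p, rfl⟩
      · obtain ⟨q, hq⟩ := hl.2.2 x p
        refine ⟨inl q, concat ?_ ?_⟩
        · rw [leftVal_upd, leftVal_upd]; exact hq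
        · rw [rightVal_upd, rightVal_upd]; exact hr.1.erase x
      · obtain ⟨q, hq⟩ := hr.2.2 x p
        refine ⟨inr q, concat ?_ ?_⟩
        · rw [leftVal_upd, leftVal_upd]; exact hl.1.erase x
        · rw [rightVal_upd, rightVal_upd]; exact hq

theorem concat_none {k : ℕ} (hl : EF u u' k (fun _ : V => none) (fun _ => none))
    (hr : EF v v' k (fun _ : V => none) (fun _ => none)) :
    EF (u.concat v) (u'.concat v') k (fun _ : V => none) (fun _ => none) :=
  concat hl hr

end

end EF

/-! ### Composition: powers -/

/-- A countable linear ordering as a word over a one-letter alphabet. -/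
def plain (T : Type) [LinearOrder T] [Countable T] : GWord Unit where
  Pos := T
  label _ := ()

/-- The copy of `u` in which a position of a power of `u` lies. -/
def GWord.copy {T : Type} [LinearOrder T] [Countable T] {u : GWord Λ} (c : (u.power T).Pos) :
    (plain T).Pos := (show T × u.Pos from ofLex c).1

/-- The position of `u` that corresponds to a position of a power of `u`. -/
def GWord.base {T : Type} [LinearOrder T] [Countable T] {u : GWord Λ} (c : (u.power T).Pos) :
    u.Pos := (show T × u.Pos from ofLex c).2

/-- The position `p` in the copy of `u` at `t`. -/
def GWord.inPower {T : Type} [LinearOrder T] [Countable T] {u : GWord Λ} (t : (plain T).Pos)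
    (p : u.Pos) : (u.power T).Pos := toLex ((t, p) : T × u.Pos)

section Power

variable {T : Type} [LinearOrder T] [Countable T] {T' : Type} [LinearOrder T'] [Countable T']
  {u u' : GWord Λ}

theorem lt_power_iff {c d : (u.power T).Pos} :
    c < d ↔ copy c < copy d ∨ copy c = copy d ∧ base c < base d :=
  Prod.Lex.lt_iff

/-- The copies of `u` in which the values of a partial valuation of a power of `u` lie. -/
def copyVal (α : V → Option (u.power T).Pos) : V → Option (plain T).Pos :=
  fun x => (α x).map copy

/-- The part of a partial valuation of a power of `u` that lies in the copy of `u` at `t`. -/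
noncomputable def fibre (α : V → Option (u.power T).Pos) (t : (plain T).Pos) : V → Option u.Pos :=
  fun x => (α x).bind fun p => if copy p = t then some (base p) else none

theorem copyVal_upd (α : V → Option (u.power T).Pos) (x : V) (c : (u.power T).Pos) :
    copyVal (upd α x (some c)) = upd (copyVal α) x (some (copy c)) :=
  upd_map ..

theorem copyVal_of_eq_some {α : V → Option (u.power T).Pos} {x : V} {c : (u.power T).Pos}
    (h : α x = some c) : copyVal α x = some (copy c) := by
  simp [copyVal, h]

theorem exists_of_copyVal {α : V → Option (u.power T).Pos} {x : V} {t : (plain T).Pos}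
    (h : copyVal α x = some t) : ∃ c, α x = some c ∧ copy c = t := by
  simpa [copyVal] using h

theorem fibre_of_eq_some {α : V → Option (u.power T).Pos} {x : V} {c : (u.power T).Pos}
    (h : α x = some c) : fibre α (copy c) x = some (base c) := by
  simp [fibre, h]

theorem fibre_upd_self (α : V → Option (u.power T).Pos) (x : V) (c : (u.power T).Pos) :
    fibre (upd α x (some c)) (copy c) = upd (fibre α (copy c)) x (some (base c)) := by
  refine (EF.upd_bind ..).trans ?_
  simp only [Option.bind_some, if_true]
  rfl

theorem fibre_upd_of_ne (α : V → Option (u.power T).Pos) (x : V) {c : (u.power T).Pos} {t : (plain T).Pos}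
    (h : (copy c) ≠ t) : fibre (upd α x (some c)) t = upd (fibre α t) x none := by
  refine (EF.upd_bind ..).trans ?_
  simp only [Option.bind_some, h, if_false]
  rfl

/-- The values in the same copies are `k`-equivalent. -/
def FibresEquiv (u u' : GWord Λ) (k : ℕ) (α : V → Option (u.power T).Pos)
    (β : V → Option (u'.power T').Pos) : Prop :=
  ∀ x c c', α x = some c → β x = some c' →
    EF u u' k (fibre α (copy c)) (fibre β (copy c'))

/-- A copy different from the new one only loses the variable `x`, so equivalence after erasing `x`
suffices there. By `hcopy`, being in the new copy means the same on both sides. -/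
theorem FibresEquiv.upd {k : ℕ} {α : V → Option (u.power T).Pos}
    {β : V → Option (u'.power T').Pos} {x : V} {c : (u.power T).Pos} {c' : (u'.power T').Pos}
    (h : ∀ y ≠ x, ∀ d d', α y = some d → β y = some d' → (copy d) ≠ (copy c) →
      EF u u' k (PiGames.upd (fibre α (copy d)) x none)
        (PiGames.upd (fibre β (copy d')) x none))
    (hcopy : AtomEquiv (plain T) (plain T') (PiGames.upd (copyVal α) x (some (copy c)))
      (PiGames.upd (copyVal β) x (some (copy c'))))
    (hfib : EF u u' k (PiGames.upd (fibre α (copy c)) x (some (base c)))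
      (PiGames.upd (fibre β (copy c')) x (some (base c')))) :
    FibresEquiv u u' k (PiGames.upd α x (some c)) (PiGames.upd β x (some c')) := by
  rw [← fibre_upd_self, ← fibre_upd_self] at hfib
  rw [← copyVal_upd, ← copyVal_upd] at hcopy
  intro y d d' hd hd'
  have e := hcopy.eq_iff (copyVal_of_eq_some hd) (copyVal_of_eq_some (x := x) (upd_same ..))
    (copyVal_of_eq_some hd') (copyVal_of_eq_some (x := x) (upd_same ..))
  by_cases hdc : (copy d) = (copy c)
  · rw [hdc, e.1 hdc]
    exact hfib
  · have hdc' : (copy d') ≠ (copy c') := fun hh => hdc (e.2 hh)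
    have hyx : y ≠ x := by
      rintro rfl
      rw [upd_same] at hd
      cases hd
      exact hdc rfl
    rw [fibre_upd_of_ne _ _ (Ne.symm hdc), fibre_upd_of_ne _ _ (Ne.symm hdc')]
    rw [upd_of_ne _ hyx] at hd hd'
    exact h y hyx d d' hd hd' hdc

theorem fibre_upd_none {α : V → Option (u.power T).Pos} {x : V} {t : (plain T).Pos}
    (h : ∀ y ≠ x, ∀ c, α y = some c → (copy c) ≠ t) (o : Option u.Pos) :
    upd (fibre α t) x o = upd (fun _ => none) x o := by
  classical
  funext y
  simp only [upd_apply]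
  split_ifs with hy
  · rfl
  · rcases ha : α y with _ | c
    · simp [fibre, ha]
    · simp [fibre, ha, h y hy c ha]

theorem AtomEquiv.power {α : V → Option (u.power T).Pos} {β : V → Option (u'.power T').Pos}
    (hcopy : AtomEquiv (plain T) (plain T') (copyVal α) (copyVal β))
    (hfib : FibresEquiv u u' 0 α β) : AtomEquiv (u.power T) (u'.power T') α β := by
  refine ⟨fun x => ?_, fun x p p' h h' => ?_, fun x y p q p' q' h1 h2 h3 h4 => ?_⟩
  · simpa [copyVal] using hcopy.dom x
  · exact (hfib x p p' h h').label x _ _ (fibre_of_eq_some h) (fibre_of_eq_some h')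
  · have hlt := hcopy.lt_iff x y _ _ _ _ (copyVal_of_eq_some h1) (copyVal_of_eq_some h2)
      (copyVal_of_eq_some h3) (copyVal_of_eq_some h4)
    have heq := hcopy.eq_iff (copyVal_of_eq_some h1) (copyVal_of_eq_some h2)
      (copyVal_of_eq_some h3) (copyVal_of_eq_some h4)
    refine lt_power_iff.trans (Iff.trans (or_congr hlt ?_) lt_power_iff.symm)
    refine (and_congr_right fun he => ?_).trans (and_congr_left fun _ => heq)
    have f2 := fibre_of_eq_some h2
    have f4 := fibre_of_eq_some h4
    rw [← he] at f2
    rw [← heq.1 he] at f4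
    exact (hfib x p p' h1 h3).lt_iff x y _ _ _ _ (fibre_of_eq_some h1) f2 (fibre_of_eq_some h3) f4

/-- Duplicator's reply inside a copy. -/
theorem FibresEquiv.exists_reply {k : ℕ} {α : V → Option (u.power T).Pos}
    {β : V → Option (u'.power T').Pos} {x : V} {t : (plain T).Pos} {t' : (plain T').Pos}
    (hcopy : AtomEquiv (plain T) (plain T') (PiGames.upd (copyVal α) x (some t))
      (PiGames.upd (copyVal β) x (some t')))
    (h0 : EF u u' (k + 1) (fun _ : V => none) (fun _ => none))
    (hfib : FibresEquiv u u' (k + 1) α β) (p : u.Pos) :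
    ∃ p', EF u u' k (PiGames.upd (fibre α t) x (some p))
      (PiGames.upd (fibre β t') x (some p')) := by
  -- If another variable already lives in the copy at `t`, the game in this copy is continued.
  -- Otherwise neither copy holds another variable, and a fresh game on `(u, u')` is begun.
  by_cases hex : ∃ y ≠ x, ∃ c, α y = some c ∧ copy c = t
  · obtain ⟨y, hyx, c, hc, rfl⟩ := hex
    have hy : PiGames.upd (copyVal α) x (some (copy c)) y = some (copy c) := by
      rw [upd_of_ne _ hyx]; exact copyVal_of_eq_some hc
    obtain ⟨s', hs'⟩ := hcopy.exists_right hy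
    have e := (hcopy.eq_iff hy (upd_same ..) hs' (upd_same ..)).1 rfl
    rw [upd_of_ne _ hyx] at hs'
    obtain ⟨c', hc', rfl⟩ := exists_of_copyVal hs'
    subst e
    exact (hfib y c c' hc hc').2.1 x p
  · push Not at hex
    have hex' : ∀ y ≠ x, ∀ c, β y = some c → (copy c) ≠ t' := by
      rintro y hyx c hc rfl
      have hy : PiGames.upd (copyVal β) x (some (copy c)) y = some (copy c) := by
        rw [upd_of_ne _ hyx]; exact copyVal_of_eq_some hc
      obtain ⟨s, hs⟩ := hcopy.exists_left hy
      have e := (hcopy.eq_iff hs (upd_same ..) hy (upd_same ..)).2 rfl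
      rw [upd_of_ne _ hyx] at hs
      obtain ⟨d, hd, rfl⟩ := exists_of_copyVal hs
      exact hex y hyx d hd e
    obtain ⟨p', hp'⟩ := h0.2.1 x p
    refine ⟨p', ?_⟩
    rw [fibre_upd_none hex, fibre_upd_none hex']
    exact hp'

/-- Two games are combined: one on the orderings `T` and `T'` selects the copy, one inside the
selected copy selects the position. Copies that hold no variable are covered by the equivalence of
`u` and `u'` without parameters. -/
theorem EF.power : ∀ {k : ℕ} {α : V → Option (u.power T).Pos} {β : V → Option (u'.power T').Pos},
    EF (plain T) (plain T') k (copyVal α) (copyVal β) →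
      EF u u' k (fun _ : V => none) (fun _ => none) → FibresEquiv u u' k α β →
        EF (u.power T) (u'.power T') k α β
  | 0, _, _, hcopy, _, hfib => AtomEquiv.power hcopy hfib
  | k + 1, α, β, hcopy, h0, hfib => by
    refine ⟨power hcopy.1 h0.1 fun x c c' h h' => (hfib x c c' h h').1, fun x c => ?_,
      fun x c' => ?_⟩
    · obtain ⟨t', ht'⟩ := hcopy.2.1 x (copy c)
      obtain ⟨p', hp'⟩ := FibresEquiv.exists_reply ht'.atom h0 hfib (base c)
      refine ⟨inPower t' p', power ?_ h0.1 (FibresEquiv.upd ?_ ht'.atom hp')⟩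
      · rw [copyVal_upd, copyVal_upd]; exact ht'
      · exact fun y _ d d' hd hd' _ => (hfib y d d' hd hd').1.erase x
    · obtain ⟨t, ht⟩ := hcopy.2.2 x (copy c')
      obtain ⟨p, hp⟩ := FibresEquiv.exists_reply ht.atom.symm h0.symm
        (fun x c c' h h' => (hfib x c' c h' h).symm) (base c')
      refine ⟨inPower t p, power ?_ h0.1 (FibresEquiv.upd ?_ ht.atom hp.symm)⟩
      · rw [copyVal_upd, copyVal_upd]; exact ht
      · exact fun y _ d d' hd hd' _ => (hfib y d d' hd hd').1.erase x

theorem EF.power_none {k : ℕ} (hT : EF (plain T) (plain T') k (fun _ : V => none) (fun _ => none))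
    (h : EF u u' k (fun _ : V => none) (fun _ => none)) :
    EF (u.power T) (u'.power T') k (fun _ : V => none) (fun _ => none) :=
  power hT h fun _ _ _ hc => by cases hc

end Power

/-! ### Saturation -/

/-- Every family of positions has a limit along the ultrafilter `U`, with respect to all
back-and-forth equivalences over finitely many parameters. -/
def Saturated {J : Type w} (U : Ultrafilter J) (V : Type v) (u : GWord Λ) : Prop :=
  ∀ (α : V → Option u.Pos) (x : V) (q : J → u.Pos), {y | α y ≠ none}.Finite →
    ∃ p, ∀ k, ∀ᶠ j in U, EF u u k (upd α x (some (q j))) (upd α x (some p))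

namespace Saturated

variable {J : Type w} {U : Ultrafilter J} {u v : GWord Λ}

theorem of_subsingleton [Subsingleton u.Pos] : Saturated U V u := by
  intro α x q _
  obtain ⟨j⟩ : Nonempty J := Filter.nonempty_of_neBot (U : Filter J)
  refine ⟨q j, fun k => Filter.Eventually.of_forall fun i => ?_⟩
  rw [Subsingleton.elim (q i) (q j)]
  exact EF.refl _ _ _

/-- An ultrafilter decides in which factor the family lies; the limit is taken in that factor. The
default `p₀` only makes the family total. -/
theorem concat (hu : Saturated U V u) (hv : Saturated U V v) :
    Saturated U V (u.concat v) := by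
  intro α x q hα
  have hαl : {y | EF.leftVal α y ≠ none}.Finite := hα.subset fun y hy hn => hy (by
    simp [EF.leftVal, hn])
  have hαr : {y | EF.rightVal α y ≠ none}.Finite := hα.subset fun y hy hn => hy (by
    simp [EF.rightVal, hn])
  rcases U.eventually_or.1 (Filter.Eventually.of_forall (f := (U : Filter J)) fun j =>
    show (∃ p, q j = inl p) ∨ ∃ p, q j = inr p from inl_or_inr (q j)) with h | h
  · obtain ⟨-, p₀, -⟩ := h.exists
    obtain ⟨p, hp⟩ := hu (EF.leftVal α) x (fun j => (getL (q j)).getD p₀) hαl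
    refine ⟨inl p, fun k => ?_⟩
    filter_upwards [hp k, h] with j hj hq
    obtain ⟨r, hr⟩ := hq
    rw [hr] at hj ⊢
    refine EF.concat ?_ ?_
    · rw [EF.leftVal_upd, EF.leftVal_upd]; exact hj
    · rw [EF.rightVal_upd, EF.rightVal_upd]; exact EF.refl _ _ _
  · obtain ⟨-, p₀, -⟩ := h.exists
    obtain ⟨p, hp⟩ := hv (EF.rightVal α) x (fun j => (getR (q j)).getD p₀) hαr
    refine ⟨inr p, fun k => ?_⟩
    filter_upwards [hp k, h] with j hj hq
    obtain ⟨r, hr⟩ := hq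
    rw [hr] at hj ⊢
    refine EF.concat ?_ ?_
    · rw [EF.leftVal_upd, EF.leftVal_upd]; exact EF.refl _ _ _
    · rw [EF.rightVal_upd, EF.rightVal_upd]; exact hj

/-- First the copies have a limit `t`, then the positions inside the copies have a limit over the
parameters that lie in the copy at `t`. -/
theorem power {T : Type} [LinearOrder T] [Countable T] (hT : Saturated U V (plain T))
    (hu : Saturated U V u) : Saturated U V (u.power T) := by
  intro α x q hα
  have hαc : {y | copyVal α y ≠ none}.Finite := hα.subset fun y hy hn => hy (by
    simp [copyVal, hn])
  have hαf : ∀ t, {y | fibre α t y ≠ none}.Finite := fun t => hα.subset fun y hy hn => hy (by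
    simp [fibre, hn])
  obtain ⟨t, ht⟩ := hT (copyVal α) x (fun j => (copy (q j))) hαc
  obtain ⟨p, hp⟩ := hu (fibre α t) x (fun j => (base (q j))) (hαf t)
  refine ⟨inPower t p, fun k => ?_⟩
  filter_upwards [ht k, hp k] with j hj hjp
  refine EF.power (by rw [copyVal_upd, copyVal_upd]; exact hj) (EF.refl _ _ _)
    (FibresEquiv.upd ?_ hj.atom ?_)
  · intro y _ d d' hd hd' _
    rw [hd] at hd'
    cases hd'
    exact EF.refl _ _ _
  -- The limit `p` refers to the parameters in the copy at `t`, whereas those in the copy of `q j`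
  -- are wanted. If these copies differ, neither contains a parameter other than `x`: by `hj`, a
  -- parameter in one of them would lie in both.
  · have key : upd (fibre α (copy (q j))) x (some (base (q j))) =
        upd (fibre α t) x (some (base (q j))) := by
      by_cases e : (copy (q j)) = t
      · rw [e]
      · have hy : ∀ y ≠ x, ∀ c, α y = some c → ((copy c) = (copy (q j)) ↔
            copy c = t) := by
          intro y hyx c hc
          have hc' := copyVal_of_eq_some hc
          rw [← upd_of_ne (copyVal α) hyx (some (copy (q j)))] at hc'
          have hc'' := copyVal_of_eq_some hc
          rw [← upd_of_ne (copyVal α) hyx (some t)] at hc''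
          exact hj.atom.eq_iff hc' (upd_same ..) hc'' (upd_same ..)
        rw [fibre_upd_none fun y hyx c hc h1 => e (h1.symm.trans ((hy y hyx c hc).1 h1)),
          fibre_upd_none fun y hyx c hc h1 => e (((hy y hyx c hc).2 h1).symm.trans h1)]
    rw [key]
    exact hjp

end Saturated

/-! ### Distances in discrete linear orderings -/

/-- The number of steps from `a` up to `b`. It is `0` if `b ≤ a`. -/
noncomputable def dist {T : Type*} [LinearOrder T] (a b : T) : ℕ∞ := (Set.Ioc a b).encard

section Dist

variable {T : Type*} [LinearOrder T]

theorem dist_eq_zero {a b : T} : dist a b = 0 ↔ b ≤ a := by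
  rw [dist, Set.encard_eq_zero, Set.Ioc_eq_empty_iff, not_lt]

theorem dist_add {a b c : T} (hab : a ≤ b) (hbc : b ≤ c) : dist a c = dist a b + dist b c := by
  rw [dist, dist, dist, ← Set.Ioc_union_Ioc_eq_Ioc hab hbc, Set.encard_union_eq]
  exact Set.Ioc_disjoint_Ioc_of_le le_rfl

theorem eq_of_dist_eq {a z z' : T} {n : ℕ} (h : a ≤ z) (h' : a ≤ z') (hz : dist a z = n)
    (hz' : dist a z' = n) : z = z' := by
  wlog hle : z ≤ z' generalizing z z'
  · exact (this h' h hz' hz (le_of_not_ge hle)).symm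
  have e := dist_add h hle
  rw [hz, hz'] at e
  have : dist z z' = 0 := by
    cases hd : dist z z' with
    | top => rw [hd] at e; simp at e
    | coe m => rw [hd] at e; norm_cast at e ⊢; omega
  exact le_antisymm hle (dist_eq_zero.1 this)

theorem eq_of_dist_eq' {a z z' : T} {n : ℕ} (h : z ≤ a) (h' : z' ≤ a) (hz : dist z a = n)
    (hz' : dist z' a = n) : z = z' := by
  wlog hle : z ≤ z' generalizing z z'
  · exact (this h' h hz' hz (le_of_not_ge hle)).symm
  have e := dist_add hle h'
  rw [hz, hz'] at e
  have : dist z z' = 0 := by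
    cases hd : dist z z' with
    | top => rw [hd] at e; simp at e
    | coe m => rw [hd] at e; norm_cast at e ⊢; omega
  exact le_antisymm hle (dist_eq_zero.1 this)

end Dist

/-- Every element that is not the last one has an immediate successor, and every element that is
not the first one has an immediate predecessor. -/
structure Discrete (T : Type*) [LinearOrder T] : Prop where
  succ : ∀ a b : T, a < b → ∃ c, a < c ∧ ∀ e, a < e → c ≤ e
  pred : ∀ a b : T, a < b → ∃ c, c < b ∧ ∀ e, e < b → e ≤ c

section Discrete

variable {T : Type*} [LinearOrder T]

theorem Discrete.exists_dist_left (hT : Discrete T) {a b : T} (hab : a ≤ b) (n : ℕ)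
    (hn : n ≤ dist a b) : ∃ z, a ≤ z ∧ z ≤ b ∧ dist a z = n := by
  induction n with
  | zero => exact ⟨a, le_rfl, hab, by simpa using dist_eq_zero.2 le_rfl⟩
  | succ n ih =>
    obtain ⟨z, haz, hzb, hz⟩ := ih (le_trans (by exact_mod_cast n.le_succ) hn)
    have hlt : z < b := by
      refine lt_of_le_of_ne hzb ?_
      rintro rfl
      rw [hz] at hn
      norm_cast at hn
      omega
    obtain ⟨c, hzc, hc⟩ := hT.succ z b hlt
    have e : Set.Ioc z c = {c} := by
      ext y
      simp only [Set.mem_Ioc, Set.mem_singleton_iff]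
      exact ⟨fun h => le_antisymm h.2 (hc y h.1), fun h => by rw [h]; exact ⟨hzc, le_rfl⟩⟩
    refine ⟨c, haz.trans hzc.le, hc b hlt, ?_⟩
    rw [dist_add haz hzc.le, hz, dist, e, Set.encard_singleton]
    rfl

theorem Discrete.exists_dist_right (hT : Discrete T) {a b : T} (hab : a ≤ b) (n : ℕ)
    (hn : n ≤ dist a b) : ∃ z, a ≤ z ∧ z ≤ b ∧ dist z b = n := by
  induction n with
  | zero => exact ⟨b, hab, le_rfl, by simpa using dist_eq_zero.2 le_rfl⟩
  | succ n ih =>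
    obtain ⟨z, haz, hzb, hz⟩ := ih (le_trans (by exact_mod_cast n.le_succ) hn)
    have hlt : a < z := by
      refine lt_of_le_of_ne haz ?_
      rintro rfl
      rw [hz] at hn
      norm_cast at hn
      omega
    obtain ⟨c, hzc, hc⟩ := hT.pred a z hlt
    have e : Set.Ioc c z = {z} := by
      ext y
      simp only [Set.mem_Ioc, Set.mem_singleton_iff]
      refine ⟨fun h => le_antisymm h.2 (not_lt.1 fun hh => ?_), fun h => by rw [h]; exact ⟨hzc, le_rfl⟩⟩
      exact absurd h.1 (not_lt.2 (hc y hh))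
    refine ⟨c, hc a hlt, hzc.le.trans hzb, ?_⟩
    rw [dist_add hzc.le hzb, hz, dist, e, Set.encard_singleton, add_comm]
    rfl

end Discrete

/-! ### Back-and-forth equivalence of discrete linear orderings -/

/-- Equality of extended natural numbers up to the threshold `N`. -/
def SameUpTo (N : ℕ) (m n : ℕ∞) : Prop := m = n ∨ N ≤ m ∧ N ≤ n

namespace SameUpTo

variable {N : ℕ} {m n m' n' : ℕ∞}

theorem of_eq (h : m = n) : SameUpTo N m n := Or.inl h

theorem of_le (h : N ≤ m) (h' : N ≤ n) : SameUpTo N m n := Or.inr ⟨h, h'⟩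

theorem symm (h : SameUpTo N m n) : SameUpTo N n m := h.imp Eq.symm And.symm

theorem add (h : SameUpTo N m n) (h' : SameUpTo N m' n') : SameUpTo N (m + m') (n + n') := by
  rcases h with rfl | h
  · rcases h' with rfl | h'
    · exact of_eq rfl
    · exact of_le (h'.1.trans le_add_self) (h'.2.trans le_add_self)
  · exact of_le (h.1.trans le_self_add) (h.2.trans le_self_add)

theorem mono {M : ℕ} (h : SameUpTo N m n) (hM : M ≤ N) : SameUpTo M m n :=
  have hM' : (M : ℕ∞) ≤ N := by exact_mod_cast hM
  h.imp_right fun h => ⟨hM'.trans h.1, hM'.trans h.2⟩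

theorem zero_iff (h : SameUpTo N m n) (hN : 0 < N) : m = 0 ↔ n = 0 := by
  rcases h with rfl | h
  · rfl
  · have hN' : (0 : ℕ∞) < N := by exact_mod_cast hN
    exact iff_of_false (hN'.trans_le h.1).ne' (hN'.trans_le h.2).ne'

/-- Removing fewer than `N` steps from two lengths that agree up to `2 * N` leaves agreement up to
`N`; this is why each round halves the threshold. -/
theorem sub {a : ℕ} (h : SameUpTo (2 * N) (a + n) m') (ha : a < N) :
    ∃ c, m' = a + c ∧ SameUpTo N n c := by
  rcases h with rfl | ⟨h1, h2⟩
  · exact ⟨n, rfl, of_eq rfl⟩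
  · have ha' : ((a + N : ℕ) : ℕ∞) ≤ (2 * N : ℕ) := by norm_cast; omega
    rw [Nat.cast_add] at ha'
    refine ⟨m' - a, (add_tsub_cancel_of_le (le_self_add.trans (ha'.trans h2))).symm,
      of_le ?_ (ENat.le_sub_of_add_le_left (ENat.natCast_ne_top a) (ha'.trans h2))⟩
    exact (ENat.add_le_add_iff_left (ENat.natCast_ne_top a)).1 (ha'.trans h1)

theorem le_of_le (h : SameUpTo N m n) (hm : N ≤ m) : (N : ℕ∞) ≤ n :=
  h.elim (fun h => h ▸ hm) And.right

end SameUpTo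

/-- A point closer than `N` to one end is copied at the same distance from the corresponding end. -/
theorem Discrete.exists_split {T T' : Type*} [LinearOrder T] [LinearOrder T'] (hT' : Discrete T')
    {a p b : T} {a' b' : T'} {N : ℕ} (hap : a ≤ p) (hpb : p ≤ b) (hab : a' ≤ b')
    (h : SameUpTo (2 * N) (dist a b) (dist a' b')) :
    ∃ p', a' ≤ p' ∧ p' ≤ b' ∧ SameUpTo N (dist a p) (dist a' p') ∧
      SameUpTo N (dist p b) (dist p' b') := by
  rw [dist_add hap hpb] at h
  rcases lt_or_ge (dist a p) N with h1 | h1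
  · obtain ⟨n, hn⟩ := ENat.ne_top_iff_exists.1 (ne_top_of_lt h1)
    rw [← hn] at h h1
    obtain ⟨c, hc, hs⟩ := h.sub (by exact_mod_cast h1)
    obtain ⟨z, hz1, hz2, hz⟩ := hT'.exists_dist_left hab n (by rw [hc]; exact le_self_add)
    refine ⟨z, hz1, hz2, SameUpTo.of_eq (hn.symm.trans hz.symm), ?_⟩
    rw [dist_add hz1 hz2, hz] at hc
    rwa [ENat.add_right_injective_of_ne_top (ENat.natCast_ne_top n) hc]
  rcases lt_or_ge (dist p b) N with h2 | h2
  · obtain ⟨n, hn⟩ := ENat.ne_top_iff_exists.1 (ne_top_of_lt h2)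
    rw [← hn, add_comm] at h
    rw [← hn] at h2
    obtain ⟨c, hc, hs⟩ := h.sub (by exact_mod_cast h2)
    obtain ⟨z, hz1, hz2, hz⟩ := hT'.exists_dist_right hab n (by rw [hc]; exact le_self_add)
    refine ⟨z, hz1, hz2, ?_, .of_eq (hn.symm.trans hz.symm)⟩
    rw [dist_add hz1 hz2, hz, add_comm] at hc
    rwa [ENat.add_right_injective_of_ne_top (ENat.natCast_ne_top n) hc]
  · have h3 : ((2 * N : ℕ) : ℕ∞) ≤ dist a' b' := h.le_of_le (by
      rw [two_mul, Nat.cast_add]; exact add_le_add h1 h2)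
    -- Far from both ends, any point with at least `N` steps on either side will do.
    obtain ⟨z, hz1, hz2, hz⟩ := hT'.exists_dist_left hab N
      (le_trans (by norm_cast; omega) h3)
    refine ⟨z, hz1, hz2, .of_le h1 hz.ge, .of_le h2 ?_⟩
    rw [dist_add hz1 hz2, hz, two_mul, Nat.cast_add] at h3
    exact (ENat.add_le_add_iff_left (ENat.natCast_ne_top N)).1 h3

/-- The families `a` and `b` have the same distances up to `N`. -/
def SameDist {T T' : Type*} [LinearOrder T] [LinearOrder T'] {ι : Type*} (N : ℕ) (a : ι → T)
    (b : ι → T') : Prop :=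
  ∀ i j, SameUpTo N (dist (a i) (a j)) (dist (b i) (b j))

/-- Only the gap between the two entries nearest to `p` has to be split, since all other distances
add up through these. The endpoints belong to the family so that both neighbours exist. -/
theorem SameDist.exists_reply {T T' : Type*} [LinearOrder T] [LinearOrder T']
    (hT' : Discrete T') {ι : Type*} [Finite ι] {N : ℕ} (hN : 0 < N) {a : ι → T} {b : ι → T'}
    (h : SameDist (2 * N) a b) (hbot : ∃ i, IsBot (a i)) (htop : ∃ i, IsTop (a i)) (p : T) :
    ∃ p', SameDist N (fun o : Option ι => o.elim p a) (fun o => o.elim p' b) := by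
  obtain ⟨i₀, hi₀⟩ := hbot
  obtain ⟨j₀, hj₀⟩ := htop
  obtain ⟨i, hi, himax⟩ := Set.exists_max_image {i | a i ≤ p} a (Set.toFinite _) ⟨i₀, hi₀ p⟩
  obtain ⟨j, hj, hjmin⟩ := Set.exists_min_image {j | p ≤ a j} a (Set.toFinite _) ⟨j₀, hj₀ p⟩
  have le_of : ∀ {i j}, a i ≤ a j → b i ≤ b j := fun {i j} hij =>
    dist_eq_zero.1 (((h j i).zero_iff (by omega)).1 (dist_eq_zero.2 hij))
  obtain ⟨p', h1, h2, h3, h4⟩ := hT'.exists_split hi hj (le_of (le_trans hi hj)) (h i j)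
  have hle : N ≤ 2 * N := by omega
  have low : ∀ l, a l ≤ p → SameUpTo N (dist (a l) p) (dist (b l) p') ∧
      SameUpTo N (dist p (a l)) (dist p' (b l)) := by
    intro l hl
    have hli := himax l hl
    constructor
    · rw [dist_add hli hi, dist_add (le_of hli) h1]
      exact ((h l i).mono hle).add h3
    · rw [dist_eq_zero.2 hl, dist_eq_zero.2 ((le_of hli).trans h1)]
      exact .of_eq rfl
  have high : ∀ l, p ≤ a l → SameUpTo N (dist (a l) p) (dist (b l) p') ∧
      SameUpTo N (dist p (a l)) (dist p' (b l)) := by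
    intro l hl
    have hjl := hjmin l hl
    constructor
    · rw [dist_eq_zero.2 hl, dist_eq_zero.2 (h2.trans (le_of hjl))]
      exact .of_eq rfl
    · rw [dist_add hj hjl, dist_add h2 (le_of hjl)]
      exact h4.add ((h j l).mono hle)
  refine ⟨p', ?_⟩
  rintro (_ | l) (_ | m)
  · change SameUpTo N (dist p p) (dist p' p')
    rw [dist_eq_zero.2 le_rfl, dist_eq_zero.2 le_rfl]
    exact .of_eq rfl
  · exact (le_total (a m) p).elim (fun hm => (low m hm).2) (fun hm => (high m hm).2)
  · exact (le_total (a l) p).elim (fun hm => (low l hm).1) (fun hm => (high l hm).1)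
  · exact (h l m).mono hle

theorem SameDist.symm {T T' : Type*} [LinearOrder T] [LinearOrder T'] {ι : Type*} {N : ℕ}
    {a : ι → T} {b : ι → T'} (h : SameDist N a b) : SameDist N b a :=
  fun i j => (h i j).symm

/-- The family `a` may contain more than the current values, namely the endpoints and positions
since overwritten, so a round only adjoins one element to it. The threshold is `1` after the last
round, where a distance being zero or not describes the order. -/
theorem EF.of_sameDist {T T' : Type} [LinearOrder T] [LinearOrder T'] [Countable T] [Countable T']
    (hT : Discrete T) (hT' : Discrete T') (k : ℕ) : ∀ {ι : Type v} [Finite ι] {a : ι → T}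
    {b : ι → T'} {α : V → Option (plain T).Pos} {β : V → Option (plain T').Pos},
    SameDist (2 ^ k) a b → (∃ i, IsBot (a i) ∧ IsBot (b i)) → (∃ i, IsTop (a i) ∧ IsTop (b i)) →
    (∀ x, (α x = none ∧ β x = none) ∨ ∃ i, α x = some (a i) ∧ β x = some (b i)) →
    EF (plain T) (plain T') k α β := by
  induction k with
  | zero =>
    intro ι _ a b α β h _ _ hαβ
    refine ⟨fun x => ?_, fun _ _ _ _ _ => rfl, fun x y p q p' q' h1 h2 h3 h4 => ?_⟩
    · rcases hαβ x with ⟨h1, h2⟩ | ⟨i, h1, h2⟩ <;> simp [h1, h2]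
    · rcases hαβ x with ⟨e1, e2⟩ | ⟨i, e1, e2⟩
      · rw [h1] at e1; cases e1
      rcases hαβ y with ⟨e3, e4⟩ | ⟨j, e3, e4⟩
      · rw [h2] at e3; cases e3
      rw [h1] at e1; rw [h2] at e3; rw [h3] at e2; rw [h4] at e4
      cases e1; cases e2; cases e3; cases e4
      have e := (h i j).zero_iff (by norm_num)
      rw [dist_eq_zero, dist_eq_zero] at e
      exact lt_iff_lt_of_le_iff_le (show a j ≤ a i ↔ b j ≤ b i from e)
  | succ k ih =>
    intro ι _ a b α β h hbot htop hαβ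
    have h' : SameDist (2 * 2 ^ k) a b := by rw [← pow_succ']; exact h
    have ext : ∀ (x : V) (p : T) (p' : T'),
        SameDist (2 ^ k) (fun o : Option ι => o.elim p a) (fun o => o.elim p' b) →
        EF (plain T) (plain T') k (upd α x (some p)) (upd β x (some p')) := by
      intro x p p' hp
      refine ih hp (hbot.elim fun i hi => ⟨some i, hi⟩) (htop.elim fun i hi => ⟨some i, hi⟩) ?_
      intro y
      rcases eq_or_ne y x with rfl | hy
      · exact Or.inr ⟨none, upd_same .., upd_same ..⟩
      · rw [upd_of_ne _ hy, upd_of_ne _ hy]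
        rcases hαβ y with h1 | ⟨i, h1⟩
        · exact Or.inl h1
        · exact Or.inr ⟨some i, h1⟩
    have hpos : 0 < 2 ^ k := by positivity
    refine ⟨ih (fun i j => (h i j).mono (Nat.pow_le_pow_right (by norm_num) k.le_succ)) hbot htop
      hαβ, fun x p => ?_, fun x p' => ?_⟩
    · obtain ⟨p', hp'⟩ := h'.exists_reply hT' hpos (hbot.imp fun _ h => h.1)
        (htop.imp fun _ h => h.1) p
      exact ⟨p', ext x p p' hp'⟩
    · obtain ⟨p, hp⟩ := h'.symm.exists_reply hT hpos (hbot.imp fun _ h => h.2)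
        (htop.imp fun _ h => h.2) p'
      exact ⟨p, ext x p p' hp.symm⟩

theorem EF.plain_none {T T' : Type} [LinearOrder T] [LinearOrder T'] [Countable T] [Countable T']
    (hT : Discrete T) (hT' : Discrete T') {k : ℕ} {a b : T} {a' b' : T'} (ha : IsBot a)
    (hb : IsTop b) (ha' : IsBot a') (hb' : IsTop b')
    (h : SameUpTo (2 ^ k) (dist a b) (dist a' b')) :
    EF (plain T) (plain T') k (fun _ : V => none) (fun _ => none) := by
  refine of_sameDist (ι := ULift Bool) hT hT' k (a := fun i => bif i.1 then b else a)
    (b := fun i => bif i.1 then b' else a') ?_ ⟨⟨false⟩, ha, ha'⟩ ⟨⟨true⟩, hb, hb'⟩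
    fun _ => Or.inl ⟨rfl, rfl⟩
  rintro ⟨_ | _⟩ ⟨_ | _⟩
  · change SameUpTo _ (dist a a) (dist a' a')
    rw [dist_eq_zero.2 le_rfl, dist_eq_zero.2 le_rfl]
    exact .of_eq rfl
  · exact h
  · change SameUpTo _ (dist b a) (dist b' a')
    rw [dist_eq_zero.2 (ha b), dist_eq_zero.2 (ha' b')]
    exact .of_eq rfl
  · change SameUpTo _ (dist b b) (dist b' b')
    rw [dist_eq_zero.2 le_rfl, dist_eq_zero.2 le_rfl]
    exact .of_eq rfl

/-! ### Limits in discrete linear orderings -/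

/-- Elements at infinite distance have an element in between at infinite distance from both. -/
def DenseGaps (T : Type*) [LinearOrder T] : Prop :=
  ∀ a b : T, dist a b = ⊤ → ∃ c, a ≤ c ∧ c ≤ b ∧ dist a c = ⊤ ∧ dist c b = ⊤

/-- Either `q` is constant along `U`, or it leaves every finite neighbourhood of every parameter. In
the second case the parameters closest to `q` from below and from above are infinitely far apart,
and a point deep inside this gap is a limit. -/
theorem exists_limit {T : Type*} [LinearOrder T] (hd : DenseGaps T) {ι : Type*} [Finite ι]
    {J : Type w} (U : Ultrafilter J) {a : ι → T} (hbot : ∃ i, IsBot (a i))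
    (htop : ∃ i, IsTop (a i)) (q : J → T) :
    ∃ p, ∀ N, ∀ᶠ j in U, ∀ i, SameUpTo N (dist (a i) (q j)) (dist (a i) p) ∧
      SameUpTo N (dist (q j) (a i)) (dist p (a i)) := by
  by_cases hconst : ∃ p, ∀ᶠ j in U, q j = p
  · obtain ⟨p, hp⟩ := hconst
    refine ⟨p, fun N => hp.mono fun j hj i => ?_⟩
    rw [hj]
    exact ⟨.of_eq rfl, .of_eq rfl⟩
  have hne : ∀ p, ∀ᶠ j in U, q j ≠ p := fun p =>
    Ultrafilter.eventually_not.2 fun h => hconst ⟨p, h⟩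
  have hup : ∀ i (N : ℕ), ∀ᶠ j in U, a i ≤ q j → N ≤ dist (a i) (q j) := by
    intro i N
    -- At most one point lies at distance `n` above `a i`, and `q` avoids it along `U`.
    have : ∀ n ∈ Set.Iio N, ∀ᶠ j in U, a i ≤ q j → dist (a i) (q j) ≠ n := by
      intro n _
      by_cases hz : ∃ z, a i ≤ z ∧ dist (a i) z = n
      · obtain ⟨z, hz, hzn⟩ := hz
        filter_upwards [hne z] with j hj hle hn
        exact hj (eq_of_dist_eq hle hz hn hzn)
      · push Not at hz
        exact Filter.Eventually.of_forall fun j hle => hz _ hle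
    filter_upwards [(Filter.eventually_all_finite (Set.finite_Iio N)).2 this] with j hj hle
    by_contra hlt
    rw [not_le] at hlt
    obtain ⟨n, hn⟩ := ENat.ne_top_iff_exists.1 (ne_top_of_lt hlt)
    rw [← hn] at hlt
    exact hj n (by exact_mod_cast hlt) hle hn.symm
  have hdown : ∀ i (N : ℕ), ∀ᶠ j in U, q j ≤ a i → N ≤ dist (q j) (a i) := by
    intro i N
    have : ∀ n ∈ Set.Iio N, ∀ᶠ j in U, q j ≤ a i → dist (q j) (a i) ≠ n := by
      intro n _
      by_cases hz : ∃ z, z ≤ a i ∧ dist z (a i) = n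
      · obtain ⟨z, hz, hzn⟩ := hz
        filter_upwards [hne z] with j hj hle hn
        exact hj (eq_of_dist_eq' hle hz hn hzn)
      · push Not at hz
        exact Filter.Eventually.of_forall fun j hle => hz _ hle
    filter_upwards [(Filter.eventually_all_finite (Set.finite_Iio N)).2 this] with j hj hle
    by_contra hlt
    rw [not_le] at hlt
    obtain ⟨n, hn⟩ := ENat.ne_top_iff_exists.1 (ne_top_of_lt hlt)
    rw [← hn] at hlt
    exact hj n (by exact_mod_cast hlt) hle hn.symm
  obtain ⟨i₀, hi₀⟩ := hbot
  obtain ⟨j₀, hj₀⟩ := htop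
  obtain ⟨i, hi, himax⟩ := Set.exists_max_image {i | ∀ᶠ j in U, a i ≤ q j} a (Set.toFinite _)
    ⟨i₀, Filter.Eventually.of_forall fun j => hi₀ _⟩
  obtain ⟨l, hl, hlmin⟩ := Set.exists_min_image {i | ∀ᶠ j in U, q j ≤ a i} a (Set.toFinite _)
    ⟨j₀, Filter.Eventually.of_forall fun j => hj₀ _⟩
  have hinf : dist (a i) (a l) = ⊤ := by
    refine ENat.eq_top_iff_forall_ge.2 fun N => ?_
    obtain ⟨j, ⟨h1, h2⟩, h3⟩ := ((Filter.Eventually.and hi hl).and (hup i N)).exists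
    rw [dist_add h1 h2]
    exact (h3 h1).trans le_self_add
  obtain ⟨p, hp1, hp2, hp3, hp4⟩ := hd _ _ hinf
  refine ⟨p, fun N => Filter.eventually_all.2 fun m => ?_⟩
  rcases U.eventually_or.1 (Filter.Eventually.of_forall (f := (U : Filter J)) fun j =>
    le_total (a m) (q j)) with hm | hm
  · have hmi := himax m hm
    filter_upwards [hm, hup m N] with j h1 h2
    refine ⟨.of_le (h2 h1) ?_, ?_⟩
    · rw [dist_add hmi hp1, hp3, add_top]
      exact le_top
    · rw [dist_eq_zero.2 h1, dist_eq_zero.2 (hmi.trans hp1)]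
      exact .of_eq rfl
  · have hml := hlmin m hm
    filter_upwards [hm, hdown m N] with j h1 h2
    refine ⟨?_, .of_le (h2 h1) ?_⟩
    · rw [dist_eq_zero.2 h1, dist_eq_zero.2 (hp2.trans hml)]
      exact .of_eq rfl
    · rw [dist_add hp2 hml, hp4, top_add]
      exact le_top

theorem Saturated.plain {J : Type w} (U : Ultrafilter J) {T : Type} [LinearOrder T] [Countable T]
    (hT : Discrete T) (hd : DenseGaps T) (hbot : ∃ b : T, IsBot b) (htop : ∃ t : T, IsTop t) :
    Saturated U V (plain T) := by
  intro α x q hα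
  obtain ⟨b, hb⟩ := hbot
  obtain ⟨t, ht⟩ := htop
  have : Finite {y | α y ≠ none} := hα
  -- The parameters together with both endpoints. The default in `getD` never matters, since `α y`
  -- is defined.
  let a : Option (Option {y | α y ≠ none}) → T := fun o =>
    o.elim b fun o => o.elim t fun y => (α y).getD b
  obtain ⟨p, hp⟩ := exists_limit hd U (a := a) ⟨none, hb⟩ ⟨some none, ht⟩ q
  refine ⟨p, fun k => ?_⟩
  filter_upwards [hp (2 ^ k)] with j hj
  refine EF.of_sameDist hT hT k (a := fun o => o.elim (q j) a) (b := fun o => o.elim p a)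
    ?_ ⟨some none, hb, hb⟩ ⟨some (some none), ht, ht⟩ ?_
  · rintro (_ | l) (_ | m)
    · change SameUpTo _ (dist (q j) (q j)) (dist p p)
      have e1 : dist (q j) (q j) = 0 := dist_eq_zero.2 le_rfl
      have e2 : dist p p = 0 := dist_eq_zero.2 le_rfl
      rw [e1, e2]
      exact .of_eq rfl
    · exact (hj m).2
    · exact (hj l).1
    · exact .of_eq rfl
  · intro y
    rcases eq_or_ne y x with rfl | hy
    · exact Or.inr ⟨none, upd_same .., upd_same ..⟩
    · rw [upd_of_ne _ hy, upd_of_ne _ hy]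
      rcases hα' : α y with _ | c
      · exact Or.inl ⟨rfl, rfl⟩
      · refine Or.inr ⟨some (some (some ⟨y, by simp [hα']⟩)), ?_, ?_⟩ <;>
          exact (congrArg (fun o => some (o.getD b)) hα').symm

/-! ### The order types of finite powers and of `ϱ`-powers -/

theorem Discrete.fin (n : ℕ) : Discrete (Fin n) where
  succ a b h := ⟨⟨a + 1, by have := b.2; have : (a : ℕ) < b := h; omega⟩,
    Fin.lt_def.2 (by simp), fun e he => Fin.le_def.2 (by have : (a : ℕ) < e := he; simpa)⟩
  pred a b h := ⟨⟨b - 1, by have := b.2; omega⟩,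
    Fin.lt_def.2 (by have : (a : ℕ) < b := h; simp; omega),
    fun e he => Fin.le_def.2 (by have : (e : ℕ) < b := he; simp; omega)⟩

namespace Rho

/-- The elements of the initial copy of `ω`. -/
def lo (n : ℕ) : Rho := toLex (Sum.inl n)

/-- The elements of the copies of `ζ`. -/
def mid (q : ℚ) (z : ℤ) : Rho := toLex (Sum.inr (toLex (Sum.inl (toLex (q, z)))))

/-- The elements of the final copy of `ω*`. -/
def hi (n : ℕ) : Rho := toLex (Sum.inr (toLex (Sum.inr (OrderDual.toDual n))))

theorem cases (a : Rho) : (∃ n, a = lo n) ∨ (∃ q z, a = mid q z) ∨ ∃ n, a = hi n := by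
  rcases a with n | (⟨q, z⟩ | n)
  · exact Or.inl ⟨n, rfl⟩
  · exact Or.inr (Or.inl ⟨q, z, rfl⟩)
  · exact Or.inr (Or.inr ⟨n, rfl⟩)

@[simp] theorem lo_lt_lo {m n : ℕ} : lo m < lo n ↔ m < n := Sum.Lex.inl_lt_inl_iff

@[simp] theorem mid_lt_mid {q q' : ℚ} {z z' : ℤ} :
    mid q z < mid q' z' ↔ q < q' ∨ q = q' ∧ z < z' :=
  Sum.Lex.inr_lt_inr_iff.trans (Sum.Lex.inl_lt_inl_iff.trans Prod.Lex.lt_iff)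

@[simp] theorem hi_lt_hi {m n : ℕ} : hi m < hi n ↔ n < m :=
  Sum.Lex.inr_lt_inr_iff.trans (Sum.Lex.inr_lt_inr_iff.trans OrderDual.toDual_lt_toDual)

@[simp] theorem lo_lt_mid {m : ℕ} {q : ℚ} {z : ℤ} : lo m < mid q z := Sum.Lex.inl_lt_inr _ _
@[simp] theorem lo_lt_hi {m n : ℕ} : lo m < hi n := Sum.Lex.inl_lt_inr _ _
@[simp] theorem mid_lt_hi {m : ℕ} {q : ℚ} {z : ℤ} : mid q z < hi m :=
  Sum.Lex.inr_lt_inr_iff.2 (Sum.Lex.inl_lt_inr _ _)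
@[simp] theorem not_mid_lt_lo {m : ℕ} {q : ℚ} {z : ℤ} : ¬ mid q z < lo m := lo_lt_mid.not_gt
@[simp] theorem not_hi_lt_lo {m n : ℕ} : ¬ hi n < lo m := lo_lt_hi.not_gt
@[simp] theorem not_hi_lt_mid {m : ℕ} {q : ℚ} {z : ℤ} : ¬ hi m < mid q z := mid_lt_hi.not_gt

theorem isBot : IsBot (lo 0) := fun a => not_lt.1 (by
  rcases cases a with ⟨n, rfl⟩ | ⟨q, z, rfl⟩ | ⟨n, rfl⟩ <;> simp)

theorem isTop : IsTop (hi 0) := fun a => not_lt.1 (by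
  rcases cases a with ⟨n, rfl⟩ | ⟨q, z, rfl⟩ | ⟨n, rfl⟩ <;> simp)

theorem discrete : Discrete Rho where
  succ a b h := by
    rcases cases a with ⟨n, rfl⟩ | ⟨q, z, rfl⟩ | ⟨n, rfl⟩
    · refine ⟨lo (n + 1), by simp, fun e he => not_lt.1 fun h' => ?_⟩
      rcases cases e with ⟨m, rfl⟩ | ⟨q', z', rfl⟩ | ⟨m, rfl⟩ <;> simp at he h'
      omega
    · refine ⟨mid q (z + 1), by simp, fun e he => not_lt.1 fun h' => ?_⟩
      rcases cases e with ⟨m, rfl⟩ | ⟨q', z', rfl⟩ | ⟨m, rfl⟩ <;> simp at he h'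
      rcases he with he | ⟨rfl, he⟩
      · exact h'.elim (fun h => lt_asymm h he) fun h => he.ne' h.1
      · simp at h'; omega
    · rcases cases b with ⟨m, rfl⟩ | ⟨q', z', rfl⟩ | ⟨m, rfl⟩ <;> simp at h
      refine ⟨hi (n - 1), by simp; omega, fun e he => not_lt.1 fun h' => ?_⟩
      rcases cases e with ⟨m, rfl⟩ | ⟨q', z', rfl⟩ | ⟨m, rfl⟩ <;> simp at he h'
      omega
  pred a b h := by
    rcases cases b with ⟨n, rfl⟩ | ⟨q, z, rfl⟩ | ⟨n, rfl⟩
    · rcases cases a with ⟨m, rfl⟩ | ⟨q', z', rfl⟩ | ⟨m, rfl⟩ <;> simp at h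
      refine ⟨lo (n - 1), by simp; omega, fun e he => not_lt.1 fun h' => ?_⟩
      rcases cases e with ⟨m, rfl⟩ | ⟨q', z', rfl⟩ | ⟨m, rfl⟩ <;> simp at he h'
      omega
    · refine ⟨mid q (z - 1), by simp, fun e he => not_lt.1 fun h' => ?_⟩
      rcases cases e with ⟨m, rfl⟩ | ⟨q', z', rfl⟩ | ⟨m, rfl⟩ <;> simp at he h'
      rcases he with he | ⟨rfl, he⟩
      · exact h'.elim (fun h => lt_asymm h he) fun h => he.ne' h.1
      · simp at h'; omega
    · refine ⟨hi (n + 1), by simp, fun e he => not_lt.1 fun h' => ?_⟩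
      rcases cases e with ⟨m, rfl⟩ | ⟨q', z', rfl⟩ | ⟨m, rfl⟩ <;> simp at he h'
      omega

theorem dist_eq_top {a b : Rho} (f : ℕ → Rho) (hf : Function.Injective f)
    (h : ∀ n, a < f n ∧ ¬ b < f n) : dist a b = ⊤ :=
  Set.encard_eq_top (Set.infinite_of_injective_forall_mem hf fun n => ⟨(h n).1, not_lt.1 (h n).2⟩)

theorem lo_injective : Function.Injective lo := fun _ _ h => Sum.inl.inj h

theorem mid_injective (q : ℚ) : Function.Injective (mid q) := fun _ _ h =>
  (Prod.mk.inj (Sum.inl.inj (Sum.inr.inj h))).2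

theorem hi_injective : Function.Injective hi := fun _ _ h => Sum.inr.inj (Sum.inr.inj h)

theorem dist_lo_mid (m : ℕ) (q : ℚ) (z : ℤ) : dist (lo m) (mid q z) = ⊤ :=
  dist_eq_top (fun n => lo (m + 1 + n)) (fun _ _ h => by simpa using lo_injective h)
    fun n => ⟨by simp; omega, by simp⟩

theorem dist_lo_hi (m n : ℕ) : dist (lo m) (hi n) = ⊤ :=
  dist_eq_top (fun n => lo (m + 1 + n)) (fun _ _ h => by simpa using lo_injective h)
    fun n => ⟨by simp; omega, by simp⟩

theorem dist_mid_hi (m : ℕ) (q : ℚ) (z : ℤ) : dist (mid q z) (hi m) = ⊤ :=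
  dist_eq_top (fun n => hi (m + 1 + n)) (fun _ _ h => by simpa using hi_injective h)
    fun n => ⟨by simp, by simp; omega⟩

theorem dist_mid_mid {q q' : ℚ} (h : q < q') (z z' : ℤ) : dist (mid q z) (mid q' z') = ⊤ :=
  dist_eq_top (fun n => mid q (z + 1 + n)) (fun _ _ h => by simpa using mid_injective q h)
    fun n => ⟨by simp; omega, by simp [h.not_gt, h.ne']⟩

theorem dist_ne_top {ι : Type*} {a b : Rho} (f : ι → Rho) (s : Set ι) (hs : s.Finite)
    (h : ∀ c, a < c → ¬ b < c → ∃ i ∈ s, f i = c) : dist a b ≠ ⊤ := by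
  rw [dist, Set.encard_ne_top_iff]
  exact (hs.image f).subset fun c hc => h c hc.1 (not_lt.2 hc.2)

/-- Within one copy of `ω`, `ζ` or `ω*` all distances are finite. Between different copies there is
a further copy of `ζ`, because `ℚ` is dense without endpoints, and any of its points is infinitely
far from both. -/
theorem denseGaps : DenseGaps Rho := by
  intro a b hab
  rcases cases a with ⟨n, rfl⟩ | ⟨q, z, rfl⟩ | ⟨n, rfl⟩ <;>
    rcases cases b with ⟨m, rfl⟩ | ⟨q', z', rfl⟩ | ⟨m, rfl⟩
  · refine absurd hab (dist_ne_top lo (Set.Iic m) (Set.finite_Iic m) fun c h1 h2 => ?_)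
    rcases cases c with ⟨l, rfl⟩ | ⟨r, y, rfl⟩ | ⟨l, rfl⟩ <;> simp at h1 h2
    exact ⟨l, h2, rfl⟩
  · exact ⟨mid (q' - 1) 0, lo_lt_mid.le, (mid_lt_mid.2 (Or.inl (by linarith))).le,
      dist_lo_mid _ _ _, dist_mid_mid (by linarith) _ _⟩
  · exact ⟨mid 0 0, lo_lt_mid.le, mid_lt_hi.le, dist_lo_mid _ _ _, dist_mid_hi _ _ _⟩
  · rw [dist_eq_zero.2 lo_lt_mid.le] at hab; simp at hab
  · rcases lt_trichotomy q q' with h | rfl | h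
    · exact ⟨mid ((q + q') / 2) 0, (mid_lt_mid.2 (Or.inl (by linarith))).le,
        (mid_lt_mid.2 (Or.inl (by linarith))).le, dist_mid_mid (by linarith) _ _,
        dist_mid_mid (by linarith) _ _⟩
    · refine absurd hab (dist_ne_top (mid q) (Set.Ioc z z') (Set.finite_Ioc z z') fun c h1 h2 => ?_)
      rcases cases c with ⟨l, rfl⟩ | ⟨r, y, rfl⟩ | ⟨l, rfl⟩ <;> simp at h1 h2
      rcases h1 with h1 | ⟨rfl, h1⟩
      · exact absurd h1 (not_lt.2 h2.1)
      · exact ⟨y, ⟨h1, h2.2 rfl⟩, rfl⟩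
    · rw [dist_eq_zero.2 (mid_lt_mid.2 (Or.inl h)).le] at hab; simp at hab
  · exact ⟨mid (q + 1) 0, (mid_lt_mid.2 (Or.inl (by linarith))).le, mid_lt_hi.le,
      dist_mid_mid (by linarith) _ _, dist_mid_hi _ _ _⟩
  · rw [dist_eq_zero.2 lo_lt_hi.le] at hab; simp at hab
  · rw [dist_eq_zero.2 mid_lt_hi.le] at hab; simp at hab
  · refine absurd hab (dist_ne_top hi (Set.Iio n) (Set.finite_Iio n) fun c h1 h2 => ?_)
    rcases cases c with ⟨l, rfl⟩ | ⟨r, y, rfl⟩ | ⟨l, rfl⟩ <;> simp at h1 h2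
    exact ⟨l, h1, rfl⟩

end Rho

/-- The endpoints are infinitely far apart in `Rho` and `n` steps apart in the chain of `n + 1`
elements; the threshold `2 ^ k` hides the difference. -/
theorem EF.plain_rho_fin {k n : ℕ} (hn : 2 ^ k ≤ n) :
    EF (plain Rho) (plain (Fin (n + 1))) k (fun _ : V => none) (fun _ => none) := by
  refine plain_none Rho.discrete (Discrete.fin _) Rho.isBot Rho.isTop (a' := 0) (b' := Fin.last n)
    (fun a => Fin.zero_le a) (fun a => Fin.le_last a) (.of_le ?_ ?_)
  · rw [Rho.dist_lo_hi]
    exact le_top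
  · have : dist (0 : Fin (n + 1)) (Fin.last n) = n := by
      rw [dist, ← Finset.coe_Ioc, Set.encard_coe_eq_coe_finsetCard, Fin.card_Ioc]
      simp
    rw [this]
    exact_mod_cast hn

theorem PiTerm.saturated_evalRho {J : Type w} (U : Ultrafilter J) (s : PiTerm Λ) :
    Saturated U V s.evalRho := by
  have hρ : ∀ {u : GWord Λ}, Saturated U V u → Saturated U V (u.power Rho) :=
    Saturated.power (.plain U Rho.discrete Rho.denseGaps ⟨_, Rho.isBot⟩ ⟨_, Rho.isTop⟩)
  have hl : ∀ a : Λ, Saturated U V (GWord.ofList [a]) := fun a =>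
    have : Subsingleton (GWord.ofList [a]).Pos := inferInstanceAs (Subsingleton (Fin 1))
    Saturated.of_subsingleton
  induction s with
  | letter a => exact hl a
  | letterMul a t ih => exact (hl a).concat ih
  | pi s ih => exact hρ ih
  | piMul s t ih1 ih2 => exact (hρ ih1).concat ih2

/-! ### Reducts of fragments -/

/-- The context `Q x μ`. -/
def Quant.ctx : Quant → V → Context Λ V → Context Λ V
  | ex, x, μ => .ex x μ
  | all, x, μ => .all x μ
  | negEx, x, μ => .neg (.ex x μ)
  | negAll, x, μ => .neg (.all x μ)

theorem Quant.ctx_fill (Q : Quant) (x : V) (μ : Context Λ V) (φ : Formula Λ V) :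
    (Q.ctx x μ).fill φ = Q.app x (μ.fill φ) := by
  cases Q <;> rfl

theorem fill_mem_reduct {F : Set (Formula Λ V)} {Q : Quant} {x : V} {μ : Context Λ V}
    {φ : Formula Λ V} : μ.fill φ ∈ reduct Q x F ↔ (Q.ctx x μ).fill φ ∈ F := by
  rw [Quant.ctx_fill]
  rfl

/-- Closure conditions are stated for all contexts, so prefixing `Q x` to the context preserves
them. -/
theorem IsFragment.reduct {F : Set (Formula Λ V)} (hF : IsFragment F) {Q : Quant} {x : V}
    (h : (reduct Q x F).Nonempty) : IsFragment (reduct Q x F) := by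
  constructor <;> try simp only [fill_mem_reduct]
  · exact h
  · exact fun μ => hF.top_mem _
  · exact fun μ => hF.bot_mem _
  · exact fun μ => hF.lab_mem _
  · exact fun μ => hF.or_mem_iff _
  · exact fun μ => hF.and_mem_iff _
  · exact fun μ => hF.neg_neg _
  · exact fun μ => hF.ex_elim _
  · exact fun μ => hF.all_elim _

theorem SucStable.reduct {F : Set (Formula Λ V)} (hF : SucStable F) (Q : Quant) (x : V) :
    SucStable (reduct Q x F) := by
  constructor <;> simp only [fill_mem_reduct]
  · exact fun μ => hF.suc_mem _
  · exact fun μ => hF.empty_mem _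

theorem OrderStable.reduct {F : Set (Formula Λ V)} (hF : OrderStable F) (Q : Quant) (x : V) :
    OrderStable (reduct Q x F) := by
  unfold OrderStable
  simp only [fill_mem_reduct]
  exact fun μ => hF _

/-! ### Winning strategies as invariants -/

/-- A set of configurations that Duplicator can defend. -/
structure Invariant (W : Set (Config Λ V)) : Prop where
  not_spoilerWins : ∀ S ∈ W, ¬ S.SpoilerWins
  reply : ∀ S ∈ W, ∀ m : S.Quest, ∃ r, Config.next m r ∈ W

/-- The history of a play is irrelevant: the configurations reachable under a winning strategy form
an invariant, and conversely any reply that stays in `W` is good enough. -/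
theorem duplicatorWins_iff {F : Set (Formula Λ V)} {w w' : GWord Λ} :
    DuplicatorWins F w w' ↔ ∃ W, Invariant W ∧ Config.initial F w w' ∈ W := by
  classical
  constructor
  · rintro ⟨σ, hσ⟩
    refine ⟨{S | ∃ h, σ.Follows S h}, ⟨fun S ⟨h, hh⟩ => (hσ S h hh).1, ?_⟩, _, .start⟩
    rintro S ⟨h, hh⟩ m
    obtain ⟨r, hr⟩ := Option.ne_none_iff_exists'.1 ((hσ S h hh).2 m)
    exact ⟨r, _, hh.round hr⟩
  · rintro ⟨W, hW, h₀⟩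
    let σ : Strategy (Config.initial F w w') := fun S _ m =>
      if hS : ∃ r, Config.next m r ∈ W then some hS.choose else none
    have mem : ∀ S h, σ.Follows S h → S ∈ W := by
      intro S h hh
      induction hh with
      | start => exact h₀
      | @round S h m r _ hr ih =>
        have hS := hW.reply S ih m
        simp only [σ, dif_pos hS, Option.some.injEq] at hr
        exact hr ▸ hS.choose_spec
    refine ⟨σ, fun S h hh => ⟨hW.not_spoilerWins S (mem S h hh), fun m => ?_⟩⟩
    have hS := hW.reply S (mem S h hh) m
    simp [σ, dif_pos hS]

theorem dom_update (s : Valuation Λ V) (x : V) (p : s.word.Pos) :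
    (s.update x p).dom = insert x s.dom := by
  ext y
  rcases eq_or_ne y x with rfl | hy
  · simp only [Set.mem_insert_iff, true_or, iff_true]
    exact (congrArg (· ≠ none) (upd_same s.val y (some p))).mpr (Option.some_ne_none p)
  · simp only [Set.mem_insert_iff, hy, false_or]
    exact iff_of_eq (congrArg (· ≠ none) (upd_of_ne s.val hy (some p)))

/-- In a configuration that Duplicator can defend, all formulae of the fragment are preserved. -/
theorem Invariant.sat {W : Set (Config Λ V)} (hW : Invariant W) (φ : Formula Λ V) :
    ∀ S ∈ W, IsFragment S.frag → φ.FV ⊆ S.left.dom → φ.FV ⊆ S.right.dom →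
      (φ ∈ S.frag → φ.Sat S.left → φ.Sat S.right) ∧
      (.neg φ ∈ S.frag → φ.Sat S.right → φ.Sat S.left) := by
  have atomic : ∀ φ : Formula Λ V, φ.IsAtomic → ∀ S ∈ W, IsFragment S.frag →
      φ.FV ⊆ S.left.dom → φ.FV ⊆ S.right.dom → (φ ∈ S.frag → φ.Sat S.left → φ.Sat S.right) ∧
      (.neg φ ∈ S.frag → φ.Sat S.right → φ.Sat S.left) := by
    intro φ hφ S hS _ hl hr
    refine ⟨fun h hs => ?_, fun h hs => ?_⟩
    · by_contra hn
      exact hW.not_spoilerWins S hS ⟨φ, h, Or.inl hφ, hl, hr, hs, hn⟩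
    · by_contra hn
      exact hW.not_spoilerWins S hS ⟨_, h, Or.inr ⟨φ, hφ, rfl⟩, hl, hr, hn, not_not_intro hs⟩
  have dom : ∀ (φ : Formula Λ V) (x : V) (s : Valuation Λ V) (p : s.word.Pos),
      φ.FV \ {x} ⊆ s.dom → φ.FV ⊆ (s.update x p).dom := by
    intro φ x s p h
    rw [dom_update]
    exact Set.sdiff_singleton_subset_iff.1 h
  -- Both implications are proved together because negation turns one into the other. The second
  -- uses the moves `¬∃` and `¬∀`, which interchange the words.
  induction φ with
  | top | bot | empty | eq | lab | lt | le | suc | min | max =>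
    refine atomic _ ?_
    trivial
  | neg φ ih =>
    intro S hS hF hl hr
    have ih := ih S hS hF hl hr
    refine ⟨fun h => mt (ih.2 h), fun h => mt (ih.1 ?_)⟩
    exact hF.neg_neg .hole φ h
  | or φ ψ ih1 ih2 =>
    intro S hS hF hl hr
    have ih1 := ih1 S hS hF (Set.subset_union_left.trans hl) (Set.subset_union_left.trans hr)
    have ih2 := ih2 S hS hF (Set.subset_union_right.trans hl) (Set.subset_union_right.trans hr)
    refine ⟨fun h => ?_, fun h => ?_⟩
    · have h := (hF.or_mem_iff .hole φ ψ).1 h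
      exact Or.imp (ih1.1 h.1) (ih2.1 h.2)
    · have h := (hF.or_mem_iff (.neg .hole) φ ψ).1 h
      exact Or.imp (ih1.2 h.1) (ih2.2 h.2)
  | and φ ψ ih1 ih2 =>
    intro S hS hF hl hr
    have ih1 := ih1 S hS hF (Set.subset_union_left.trans hl) (Set.subset_union_left.trans hr)
    have ih2 := ih2 S hS hF (Set.subset_union_right.trans hl) (Set.subset_union_right.trans hr)
    refine ⟨fun h => ?_, fun h => ?_⟩
    · have h := (hF.and_mem_iff .hole φ ψ).1 h
      exact And.imp (ih1.1 h.1) (ih2.1 h.2)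
    · have h := (hF.and_mem_iff (.neg .hole) φ ψ).1 h
      exact And.imp (ih1.2 h.1) (ih2.2 h.2)
  | ex x φ ih =>
    intro S hS hF hl hr
    refine ⟨fun h => ?_, fun h => ?_⟩
    · rintro ⟨p, hp⟩
      have hne : (PiGames.reduct .ex x S.frag).Nonempty := ⟨φ, h⟩
      obtain ⟨r, hr'⟩ := hW.reply S hS ⟨.ex, x, hne, p⟩
      exact ⟨r, (ih _ hr' (hF.reduct hne) (dom _ _ _ _ hl) (dom _ _ _ _ hr)).1 h hp⟩
    · rintro ⟨p, hp⟩
      have hne : (PiGames.reduct .negEx x S.frag).Nonempty := ⟨φ, h⟩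
      obtain ⟨r, hr'⟩ := hW.reply S hS ⟨.negEx, x, hne, p⟩
      exact ⟨r, (ih _ hr' (hF.reduct hne) (dom _ _ _ _ hr) (dom _ _ _ _ hl)).1 h hp⟩
  | all x φ ih =>
    intro S hS hF hl hr
    refine ⟨fun h hp q => ?_, fun h hp q => ?_⟩
    · have hne : (PiGames.reduct .all x S.frag).Nonempty := ⟨φ, h⟩
      obtain ⟨r, hr'⟩ := hW.reply S hS ⟨.all, x, hne, q⟩
      exact (ih _ hr' (hF.reduct hne) (dom _ _ _ _ hl) (dom _ _ _ _ hr)).1 h (hp r)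
    · have hne : (PiGames.reduct .negAll x S.frag).Nonempty := ⟨φ, h⟩
      obtain ⟨r, hr'⟩ := hW.reply S hS ⟨.negAll, x, hne, q⟩
      exact (ih _ hr' (hF.reduct hne) (dom _ _ _ _ hr) (dom _ _ _ _ hl)).1 h (hp r)

theorem DuplicatorWins.sat {F : Set (Formula Λ V)} (hF : IsFragment F) {w w' : GWord Λ}
    (h : DuplicatorWins F w w') {φ : Formula Λ V} (hφ : φ ∈ F) (hFV : φ.FV = ∅)
    (hs : φ.Sat (.ofWord w)) : φ.Sat (.ofWord w') := by
  obtain ⟨W, hW, h₀⟩ := duplicatorWins_iff.1 h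
  exact (hW.sat φ _ h₀ hF (hFV ▸ Set.empty_subset _) (hFV ▸ Set.empty_subset _)).1 hφ hs

/-! ### Games on saturated words -/

/-- Finitely many requirements on a reply become a single formula of the fragment, to which
preservation of quantified formulae applies. -/
theorem IsFragment.exists_conj {F : Set (Formula Λ V)} (hF : IsFragment F)
    (s : Finset (Formula Λ V)) (D : Set V) (hs : ∀ φ ∈ s, φ ∈ F ∧ φ.FV ⊆ D) :
    ∃ ψ ∈ F, ψ.FV ⊆ D ∧ ∀ w, ψ.Sat w ↔ ∀ φ ∈ s, φ.Sat w := by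
  classical
  induction s using Finset.induction with
  | empty =>
    obtain ⟨φ, hφ⟩ := hF.nonempty
    exact ⟨.top, hF.top_mem .hole φ hφ, Set.empty_subset _, fun w => by simp [Formula.Sat]⟩
  | insert φ s _ ih =>
    simp only [Finset.mem_insert, forall_eq_or_imp] at hs ⊢
    obtain ⟨ψ, h1, h2, h3⟩ := ih hs.2
    exact ⟨.and φ ψ, (hF.and_mem_iff .hole φ ψ).2 ⟨hs.1.1, h1⟩, Set.union_subset hs.1.2 h2,
      fun w => and_congr_right fun _ => h3 w⟩

theorem IsFragment.exists_disj {F : Set (Formula Λ V)} (hF : IsFragment F)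
    (s : Finset (Formula Λ V)) (D : Set V) (hs : ∀ φ ∈ s, φ ∈ F ∧ φ.FV ⊆ D) :
    ∃ ψ ∈ F, ψ.FV ⊆ D ∧ ∀ w, ψ.Sat w ↔ ∃ φ ∈ s, φ.Sat w := by
  classical
  induction s using Finset.induction with
  | empty =>
    obtain ⟨φ, hφ⟩ := hF.nonempty
    exact ⟨.bot, hF.bot_mem .hole φ hφ, Set.empty_subset _, fun w => by simp [Formula.Sat]⟩
  | insert φ s _ ih =>
    simp only [Finset.mem_insert, forall_eq_or_imp, exists_eq_or_imp] at hs ⊢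
    obtain ⟨ψ, h1, h2, h3⟩ := ih hs.2
    exact ⟨.or φ ψ, (hF.or_mem_iff .hole φ ψ).2 ⟨hs.1.1, h1⟩, Set.union_subset hs.1.2 h2,
      fun w => or_congr_right (h3 w)⟩

/-- The ultrafilter along which limits are taken to realize finitely satisfiable sets of
formulae. -/
noncomputable def formulaUltrafilter (Λ : Type u) (V : Type v) :
    Ultrafilter (Finset (Formula Λ V)) :=
  Ultrafilter.of Filter.atTop

/-- Compactness: a solution `q s` is chosen for each finite set `s` of formulae. A given formula
belongs to `s` for almost all `s`, so the limit of the `q s` satisfies it. -/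
theorem Saturated.exists_sat [Infinite V] {v : GWord Λ}
    (hv : Saturated (formulaUltrafilter Λ V) V v) {β : V → Option v.Pos}
    (hβ : {y | β y ≠ none}.Finite) (x : V) (Φ : Set (Formula Λ V))
    (h : ∀ s : Finset (Formula Λ V), ↑s ⊆ Φ →
      ∃ q, ∀ φ ∈ s, φ.Sat ⟨v, upd β x (some q)⟩) :
    ∃ q, ∀ φ ∈ Φ, φ.Sat ⟨v, upd β x (some q)⟩ := by
  classical
  choose q hq using fun s : Finset (Formula Λ V) =>
    -- The index `s` ranges over all finite sets of formulae, so it is first cut down to `Φ`.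
    h (s.filter (· ∈ Φ)) fun _ hφ => (Finset.mem_filter.1 hφ).2
  obtain ⟨p, hp⟩ := hv β x q hβ
  refine ⟨p, fun φ hφ => ?_⟩
  have hmem : ∀ᶠ s in (formulaUltrafilter Λ V : Filter (Finset (Formula Λ V))), φ ∈ s := by
    refine Ultrafilter.of_le Filter.atTop ?_
    filter_upwards [Filter.eventually_ge_atTop {φ}] with s hs
    exact hs (Finset.mem_singleton_self φ)
  obtain ⟨s, h1, h2⟩ := ((hp (φ.depth + 1)).and hmem).exists
  exact (EF.sat_iff φ le_rfl h1).1 (hq s φ (Finset.mem_filter.2 ⟨h2, hφ⟩))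

/-- The reply to an existential move realizes all formulae of `G` that hold at `p`; finite parts are
realizable by preservation of `∃ x ψ`, with `ψ` their conjunction. -/
theorem Saturated.exists_reply [Infinite V] {u v : GWord Λ}
    (hv : Saturated (formulaUltrafilter Λ V) V v) {α : V → Option u.Pos} {β : V → Option v.Pos}
    (hβ : {y | β y ≠ none}.Finite) {x : V} {G : Set (Formula Λ V)} (hG : IsFragment G)
    {D : Set V} (h : ∀ ψ ∈ G, ψ.FV ⊆ D → (∃ p, ψ.Sat ⟨u, upd α x (some p)⟩) →
      ∃ q, ψ.Sat ⟨v, upd β x (some q)⟩) (p : u.Pos) :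
    ∃ q, ∀ ψ ∈ G, ψ.FV ⊆ D → ψ.Sat ⟨u, upd α x (some p)⟩ → ψ.Sat ⟨v, upd β x (some q)⟩ := by
  obtain ⟨q, hq⟩ := hv.exists_sat hβ x
    {ψ | (ψ ∈ G ∧ ψ.FV ⊆ D) ∧ ψ.Sat ⟨u, upd α x (some p)⟩} fun s hs => by
      obtain ⟨ψ, h1, h2, h3⟩ := hG.exists_conj s D fun φ hφ => (hs hφ).1
      obtain ⟨q, hq⟩ := h ψ h1 h2 ⟨p, (h3 _).2 fun φ hφ => (hs hφ).2⟩
      exact ⟨q, (h3 _).1 hq⟩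
  exact ⟨q, fun ψ h1 h2 h3 => hq ψ ⟨⟨h1, h2⟩, h3⟩⟩

/-- The reply to a universal move must falsify all formulae of `G` that fail at `q`. If a finite
part could not be falsified at once, its disjunction would hold at every `p`, hence at `q`. -/
theorem Saturated.exists_reply' [Infinite V] {u v : GWord Λ}
    (hu : Saturated (formulaUltrafilter Λ V) V u) {α : V → Option u.Pos} {β : V → Option v.Pos}
    (hα : {y | α y ≠ none}.Finite) {x : V} {G : Set (Formula Λ V)} (hG : IsFragment G)
    {D : Set V} (h : ∀ ψ ∈ G, ψ.FV ⊆ D → (∀ p, ψ.Sat ⟨u, upd α x (some p)⟩) →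
      ∀ q, ψ.Sat ⟨v, upd β x (some q)⟩) (q : v.Pos) :
    ∃ p, ∀ ψ ∈ G, ψ.FV ⊆ D → ψ.Sat ⟨u, upd α x (some p)⟩ → ψ.Sat ⟨v, upd β x (some q)⟩ := by
  classical
  obtain ⟨p, hp⟩ := hu.exists_sat hα x
    (Formula.neg '' {ψ | (ψ ∈ G ∧ ψ.FV ⊆ D) ∧ ¬ ψ.Sat ⟨v, upd β x (some q)⟩}) fun s hs => by
      obtain ⟨t, ht, rfl⟩ := Finset.subset_set_image_iff.1 hs
      obtain ⟨ψ, h1, h2, h3⟩ := hG.exists_disj t D fun φ hφ => (ht hφ).1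
      have hn : ¬ ψ.Sat ⟨v, upd β x (some q)⟩ := by
        rw [h3]
        rintro ⟨φ, hφ, hs'⟩
        exact (ht hφ).2 hs'
      obtain ⟨p, hp⟩ := not_forall.1 fun hh => hn (h ψ h1 h2 hh q)
      refine ⟨p, fun φ hφ => ?_⟩
      obtain ⟨χ, hχ, rfl⟩ := Finset.mem_image.1 hφ
      exact fun hs' => hp ((h3 _).2 ⟨χ, hχ, hs'⟩)
  refine ⟨p, fun ψ h1 h2 h3 => ?_⟩
  by_contra hn
  exact hp _ ⟨ψ, ⟨⟨h1, h2⟩, hn⟩, rfl⟩ h3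

/-- On saturated words, Duplicator wins if all sentences of the fragment are preserved. -/
theorem duplicatorWins_of_saturated [Infinite V] {F : Set (Formula Λ V)} (hF : IsFragment F)
    {w w' : GWord Λ} (hw : Saturated (formulaUltrafilter Λ V) V w)
    (hw' : Saturated (formulaUltrafilter Λ V) V w')
    (h : ∀ φ ∈ F, φ.FV = ∅ → φ.Sat (.ofWord w) → φ.Sat (.ofWord w')) :
    DuplicatorWins F w w' := by
  let W : Set (Config Λ V) := {S | IsFragment S.frag ∧
    Saturated (formulaUltrafilter Λ V) V S.left.word ∧
    Saturated (formulaUltrafilter Λ V) V S.right.word ∧ S.left.dom.Finite ∧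
    S.left.dom = S.right.dom ∧
    ∀ φ ∈ S.frag, φ.FV ⊆ S.left.dom → φ.Sat S.left → φ.Sat S.right}
  refine duplicatorWins_iff.2 ⟨W, ⟨?_, ?_⟩, hF, hw, hw', ?_, ?_, ?_⟩
  · rintro S ⟨-, -, -, -, -, hS⟩ ⟨φ, h1, -, h2, -, h3, h4⟩
    exact h4 (hS φ h1 h2 h3)
  · rintro S ⟨hG, hl, hr, hfin, hdom, hS⟩ ⟨Q, x, hne, p⟩
    have hfin' : S.right.dom.Finite := hdom ▸ hfin
    have hG' := hG.reduct hne
    have hFV : ∀ {ψ : Formula Λ V}, ψ.FV ⊆ insert x S.left.dom → ψ.FV \ {x} ⊆ S.left.dom :=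
      Set.sdiff_singleton_subset_iff.2
    have close : ∀ (l r : Valuation Λ V) (p : l.word.Pos) (q : r.word.Pos),
        l.dom = S.left.dom → r.dom = S.left.dom →
        (l.update x p).dom.Finite ∧ (l.update x p).dom = (r.update x q).dom ∧
        (l.update x p).dom = insert x S.left.dom := by
      intro l r p q e1 e2
      rw [dom_update, dom_update, e1, e2]
      exact ⟨hfin.insert x, rfl, rfl⟩
    cases Q with
    | ex =>
      obtain ⟨q, hq⟩ := hr.exists_reply (α := S.left.val) hfin' (x := x) hG'
        (D := insert x S.left.dom) (fun ψ h1 h2 => hS (.ex x ψ) h1 (hFV h2)) p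
      obtain ⟨c1, c2, c3⟩ := close S.left S.right p q rfl hdom.symm
      exact ⟨q, hG', hl, hr, c1, c2, fun φ h1 h2 => hq φ h1 (h2.trans c3.subset)⟩
    | all =>
      obtain ⟨q, hq⟩ := hl.exists_reply' (β := S.right.val) hfin (x := x) hG'
        (D := insert x S.left.dom) (fun ψ h1 h2 => hS (.all x ψ) h1 (hFV h2)) p
      obtain ⟨c1, c2, c3⟩ := close S.left S.right q p rfl hdom.symm
      exact ⟨q, hG', hl, hr, c1, c2, fun φ h1 h2 => hq φ h1 (h2.trans c3.subset)⟩
    | negEx =>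
      obtain ⟨q, hq⟩ := hl.exists_reply (α := S.right.val) hfin (x := x) hG'
        (D := insert x S.left.dom)
        -- Preservation of `¬∃ x ψ` from left to right is preservation of `∃ x ψ` from right to
        -- left, in accordance with the interchange of the words.
        (fun ψ h1 h2 => not_imp_not.1 (hS (.neg (.ex x ψ)) h1 (hFV h2))) p
      obtain ⟨c1, c2, c3⟩ := close S.right S.left p q hdom.symm rfl
      exact ⟨q, hG', hr, hl, c1, c2, fun φ h1 h2 => hq φ h1 (h2.trans c3.subset)⟩
    | negAll =>
      obtain ⟨q, hq⟩ := hr.exists_reply' (β := S.left.val) hfin' (x := x) hG'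
        (D := insert x S.left.dom)
        (fun ψ h1 h2 => not_imp_not.1 (hS (.neg (.all x ψ)) h1 (hFV h2))) p
      obtain ⟨c1, c2, c3⟩ := close S.right S.left q p hdom.symm rfl
      exact ⟨q, hG', hr, hl, c1, c2, fun φ h1 h2 => hq φ h1 (h2.trans c3.subset)⟩
  · exact Set.finite_empty.subset fun x hx => hx rfl
  · ext x
    exact iff_of_false (fun h => h rfl) fun h => h rfl
  · exact fun φ hφ hFV => h φ hφ (Set.subset_empty_iff.1 fun x hx => (hFV hx) rfl)

/-! ### The fragment of bounded quantifier depth -/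

namespace Formula

/-- The formulae of quantifier depth at most `k`. -/
def depthLE (Λ : Type u) (V : Type v) (k : ℕ) : Set (Formula Λ V) := {φ | φ.depth ≤ k}

end Formula

/-- The number of quantifiers in a context that bind the placeholder. -/
def Context.nesting : Context Λ V → ℕ
  | hole => 0
  | neg μ | orLeft μ _ | orRight _ μ | andLeft μ _ | andRight _ μ => μ.nesting
  | ex _ μ | all _ μ => μ.nesting + 1

/-- The quantifier depth of the part of a context that does not depend on the placeholder. -/
def Context.base : Context Λ V → ℕ
  | hole => 0
  | neg μ => μ.base
  | orLeft μ ψ | orRight ψ μ | andLeft μ ψ | andRight ψ μ => Max.max μ.base ψ.depth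
  | ex _ μ | all _ μ => μ.base + 1

theorem Context.depth_fill (μ : Context Λ V) (φ : Formula Λ V) :
    (μ.fill φ).depth = Max.max μ.base (φ.depth + μ.nesting) := by
  induction μ with
  | hole => simp [fill, base, nesting]
  | neg μ ih => simpa [fill, base, nesting, Formula.depth] using ih
  | orLeft | orRight | andLeft | andRight | ex | all =>
    simp only [fill, base, nesting, Formula.depth, *]
    omega

/-- With bounded quantifier depth as an instance of a fragment, the transfer of strategies to `x
σ(u) y` also covers back-and-forth equivalent words. -/
theorem isFragment_depthLE (k : ℕ) : IsFragment (Formula.depthLE Λ V k) := by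
  have key : ∀ (μ : Context Λ V) φ, μ.fill φ ∈ Formula.depthLE Λ V k ↔
      μ.base ≤ k ∧ φ.depth + μ.nesting ≤ k := by
    intro μ φ
    rw [← max_le_iff, ← Context.depth_fill]
    rfl
  constructor
  · exact ⟨.top, Nat.zero_le k⟩
  all_goals
    simp only [key, Formula.depth]
    intros
    omega

theorem sucStable_depthLE (k : ℕ) : SucStable (Formula.depthLE Λ V k) := by
  constructor <;>
    simp only [Formula.depthLE, Set.mem_ofPred_eq, Context.depth_fill, Formula.depth] <;>
    intros <;> simp_all

theorem orderStable_depthLE (k : ℕ) : OrderStable (Formula.depthLE Λ V k) := by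
  simp only [OrderStable, Formula.depthLE, Set.mem_ofPred_eq, Context.depth_fill, Formula.depth,
    implies_true]

/-- Each move of Spoiler uses up one quantifier of the fragment and one round of the equivalence;
the spare round serves the literals. -/
theorem EF.duplicatorWins [Infinite V] {k : ℕ} {w w' : GWord Λ}
    (h : EF w w' (k + 1) (fun _ : V => none) (fun _ => none)) :
    DuplicatorWins (Formula.depthLE Λ V k) w w' := by
  let W : Set (Config Λ V) := {S | ∃ k, S.frag ⊆ Formula.depthLE Λ V k ∧
    EF S.left.word S.right.word (k + 1) S.left.val S.right.val}
  refine duplicatorWins_iff.2 ⟨W, ⟨?_, ?_⟩, k, subset_rfl, h⟩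
  · rintro S ⟨k, hk, hS⟩ ⟨φ, h1, -, -, -, h3, h4⟩
    exact h4 ((hS.sat_iff φ (hk h1)).1 h3)
  · rintro S ⟨k, hk, hS⟩ ⟨Q, x, hne, p⟩
    have hdepth : ∀ φ ∈ reduct Q x S.frag, φ.depth + 1 ≤ k := by
      intro φ hφ
      have := hk hφ
      cases Q <;> exact this
    obtain ⟨k, rfl⟩ : ∃ j, k = j + 1 := by
      obtain ⟨φ, hφ⟩ := hne
      exact ⟨k - 1, by have := hdepth φ hφ; omega⟩
    have hsub : reduct Q x S.frag ⊆ Formula.depthLE Λ V k :=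
      fun φ hφ => Nat.succ_le_succ_iff.1 (hdepth φ hφ)
    cases Q with
    | ex =>
      obtain ⟨r, hr⟩ := hS.2.1 x p
      exact ⟨r, k, hsub, hr⟩
    | all =>
      obtain ⟨r, hr⟩ := hS.2.2 x p
      exact ⟨r, k, hsub, hr⟩
    | negEx =>
      obtain ⟨r, hr⟩ := hS.2.2 x p
      exact ⟨r, k, hsub, hr.symm⟩
    | negAll =>
      obtain ⟨r, hr⟩ := hS.2.1 x p
      exact ⟨r, k, hsub, hr.symm⟩

/-! ### Concatenation of a family of finite words -/

/-- The concatenation of the finite words `W c`, in the order of the indices `c`. -/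
def blocks {C : Type} [LinearOrder C] [Countable C] (W : C → List Λ) : GWord Λ where
  Pos := {c : C ×ₗ ℕ // (ofLex c).2 < (W (ofLex c).1).length}
  countable :=
    have : Countable (C ×ₗ ℕ) := inferInstanceAs (Countable (C × ℕ))
    inferInstance
  label c := (W (ofLex c.1).1)[(ofLex c.1).2]'c.2

namespace blocks

variable {C : Type} [LinearOrder C] [Countable C] {W : C → List Λ}

/-- The index of the word in which a position lies. -/
def idx (p : (blocks W).Pos) : C := (ofLex (show {_c : C ×ₗ ℕ // _} from p).1).1

/-- The position inside this word. -/
def off (p : (blocks W).Pos) : ℕ := (ofLex (show {_c : C ×ₗ ℕ // _} from p).1).2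

/-- The `i`-th position of the word with index `c`. -/
def pos (c : C) (i : ℕ) (h : i < (W c).length) : (blocks W).Pos :=
  (⟨toLex (c, i), h⟩ : {c : C ×ₗ ℕ // (ofLex c).2 < (W (ofLex c).1).length})

@[simp] theorem idx_pos (c : C) (i : ℕ) (h : i < (W c).length) : idx (pos c i h) = c := rfl

@[simp] theorem off_pos (c : C) (i : ℕ) (h : i < (W c).length) : off (pos c i h) = i := rfl

theorem off_lt (p : (blocks W).Pos) : off p < (W (idx p)).length :=
  (show {c : C ×ₗ ℕ // (ofLex c).2 < (W (ofLex c).1).length} from p).2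

theorem ext {p q : (blocks W).Pos} (h : idx p = idx q) (h' : off p = off q) : p = q :=
  Subtype.ext (Prod.ext h h')

theorem lt_iff {p q : (blocks W).Pos} :
    p < q ↔ idx p < idx q ∨ idx p = idx q ∧ off p < off q :=
  Prod.Lex.lt_iff

theorem le_iff {p q : (blocks W).Pos} :
    p ≤ q ↔ idx p < idx q ∨ idx p = idx q ∧ off p ≤ off q :=
  Prod.Lex.le_iff

theorem covBy_iff {p q : (blocks W).Pos} : p ⋖ q ↔ (idx p = idx q ∧ off q = off p + 1) ∨
    (off p + 1 = (W (idx p)).length ∧ off q = 0 ∧ idx p < idx q ∧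
      ∀ e, idx p < e → e < idx q → W e = []) := by
  constructor
  · rintro ⟨hlt, h⟩
    have h : ∀ c i (hi : i < (W c).length), p < pos c i hi → ¬ pos c i hi < q :=
      fun c i hi h1 => h h1
    simp only [lt_iff, idx_pos, off_pos] at h
    have hp := off_lt p
    have hq := off_lt q
    rcases lt_iff.1 hlt with hlt | ⟨he, hlt⟩
    · refine Or.inr ⟨?_, ?_, hlt, fun e h1 h2 => ?_⟩
      · by_contra hne
        exact h (idx p) (off p + 1) (by omega) (Or.inr ⟨rfl, by omega⟩) (Or.inl hlt)
      · by_contra hne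
        exact h (idx q) 0 (by omega) (Or.inl hlt) (Or.inr ⟨rfl, by omega⟩)
      · by_contra hne
        exact h e 0 (List.length_pos_iff.2 hne) (Or.inl h1) (Or.inl h2)
    · refine Or.inl ⟨he, ?_⟩
      by_contra hne
      exact h (idx p) (off p + 1) (by rw [he]; omega) (Or.inr ⟨rfl, by omega⟩)
        (Or.inr ⟨he, by omega⟩)
  · rintro (⟨h1, h2⟩ | ⟨h1, h2, h3, h4⟩)
    · refine ⟨lt_iff.2 (Or.inr ⟨h1, by omega⟩), fun r hr hr' => ?_⟩
      rw [lt_iff] at hr hr'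
      rcases hr with hr | hr <;> rcases hr' with hr' | hr'
      · exact lt_irrefl _ (h1 ▸ hr.trans hr')
      · exact hr.ne (h1.trans hr'.1.symm)
      · exact hr'.ne (hr.1.symm.trans h1)
      · omega
    · refine ⟨lt_iff.2 (Or.inl h3), fun r hr hr' => ?_⟩
      rw [lt_iff] at hr hr'
      have h5 := off_lt r
      rcases hr with hr | hr <;> rcases hr' with hr' | hr'
      · rw [h4 _ hr hr'] at h5
        simp at h5
      · omega
      · rw [← hr.1] at h5
        omega
      · omega

theorem isBot_iff {p : (blocks W).Pos} :
    IsBot p ↔ off p = 0 ∧ ∀ e, e < idx p → W e = [] := by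
  constructor
  · intro h
    have h : ∀ c i (hi : i < (W c).length), ¬ pos c i hi < p := fun c i hi => not_lt.2 (h _)
    simp only [lt_iff, idx_pos, off_pos] at h
    have hp := off_lt p
    refine ⟨?_, fun e he => ?_⟩
    · by_contra hne
      exact h (idx p) 0 (by omega) (Or.inr ⟨rfl, by omega⟩)
    · by_contra hne
      exact h e 0 (List.length_pos_iff.2 hne) (Or.inl he)
  · rintro ⟨h1, h2⟩ r
    refine not_lt.1 fun hr => ?_
    have h5 := off_lt r
    rcases lt_iff.1 hr with hr | hr
    · rw [h2 _ hr] at h5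
      simp at h5
    · omega

theorem isTop_iff {p : (blocks W).Pos} :
    IsTop p ↔ off p + 1 = (W (idx p)).length ∧ ∀ e, idx p < e → W e = [] := by
  constructor
  · intro h
    have h : ∀ c i (hi : i < (W c).length), ¬ p < pos c i hi := fun c i hi => not_lt.2 (h _)
    simp only [lt_iff, idx_pos, off_pos] at h
    have hp := off_lt p
    refine ⟨?_, fun e he => ?_⟩
    · by_contra hne
      exact h (idx p) (off p + 1) (by omega) (Or.inr ⟨rfl, by omega⟩)
    · by_contra hne
      exact h e 0 (List.length_pos_iff.2 hne) (Or.inl he)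
  · rintro ⟨h1, h2⟩ r
    refine not_lt.1 fun hr => ?_
    have h5 := off_lt r
    rcases lt_iff.1 hr with hr | hr
    · rw [h2 _ hr] at h5
      simp at h5
    · rw [← hr.1] at h5
      omega

end blocks

open blocks

/-! ### Substitution of finite words for the letters, within a context of finite words -/

/-- A linear ordering with a new first and a new last element. -/
abbrev Ext (P : Type) : Type := WithBot (WithTop P)

theorem Ext.cases {P : Type} (c : Ext P) :
    c = ⊥ ∨ c = (⊤ : Ext P) ∨ ∃ p : P, c = ((p : WithTop P) : Ext P) := by
  induction c using WithBot.recBotCoe with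
  | bot => exact Or.inl rfl
  | coe c =>
    induction c using WithTop.recTopCoe with
    | top => exact Or.inr (Or.inl rfl)
    | coe p => exact Or.inr (Or.inr ⟨p, rfl⟩)

instance Ext.countable {P : Type} [Countable P] : Countable (Ext P) :=
  inferInstanceAs (Countable (Option (Option P)))

namespace Ext

variable {P : Type} [LinearOrder P]

theorem bot_lt_coe (p : P) : (⊥ : Ext P) < ((p : WithTop P) : Ext P) := WithBot.bot_lt_coe _

theorem coe_lt_top (p : P) : ((p : WithTop P) : Ext P) < ⊤ :=
  WithBot.coe_lt_coe.2 (WithTop.coe_lt_top p)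

theorem coe_covBy_coe {p q : P} :
    ((p : WithTop P) : Ext P) ⋖ ((q : WithTop P) : Ext P) ↔ p ⋖ q :=
  WithBot.coe_covBy_coe.trans WithTop.coe_covBy_coe

theorem coe_covBy_top {p : P} : ((p : WithTop P) : Ext P) ⋖ ⊤ ↔ IsTop p := by
  rw [← WithBot.coe_top, WithBot.coe_covBy_coe, WithTop.coe_covBy_top, isTop_iff_isMax]

theorem bot_lt_top : (⊥ : Ext P) < ⊤ := WithBot.bot_lt_coe _

theorem coe_lt_coe {p q : P} : ((p : WithTop P) : Ext P) < ((q : WithTop P) : Ext P) ↔ p < q :=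
  WithBot.coe_lt_coe.trans WithTop.coe_lt_coe


theorem bot_covBy_coe {p : P} : (⊥ : Ext P) ⋖ ((p : WithTop P) : Ext P) ↔ IsBot p := by
  rw [WithBot.bot_covBy_coe, ← isBot_iff_isMin]
  exact ⟨fun h q => WithTop.coe_le_coe.1 (h q), fun h q => by
    induction q using WithTop.recTopCoe with
    | top => exact le_top
    | coe q => exact WithTop.coe_le_coe.2 (h q)⟩

end Ext

section Frame

variable (x y : List Λ) (σ : Λ → List Λ)

/-- The words of which `x σ(u) y` is composed. -/
def frameWord (u : GWord Λ) (c : Ext u.Pos) : List Λ :=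
  WithBot.recBotCoe x (WithTop.recTopCoe y fun p => σ (u.label p)) c

/-- The word `x σ(u) y`. -/
def frame (u : GWord Λ) : GWord Λ := blocks (frameWord x y σ u)

variable {x y σ} {u v : GWord Λ}

@[simp] theorem frameWord_bot : frameWord x y σ u ⊥ = x := rfl

@[simp] theorem frameWord_top : frameWord x y σ u (⊤ : Ext u.Pos) = y := rfl

@[simp] theorem frameWord_coe (p : u.Pos) :
    frameWord x y σ u ((p : WithTop u.Pos) : Ext u.Pos) = σ (u.label p) := rfl

/-- The indices `c` and `d` correspond to each other, provided that `p` corresponds to `q`. -/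
def Corr {P Q : Type} (p : P) (q : Q) (c : Ext P) (d : Ext Q) : Prop :=
  (c = ⊥ ∧ d = ⊥) ∨ (c = (⊤ : Ext P) ∧ d = (⊤ : Ext Q)) ∨
    (c = ((p : WithTop P) : Ext P) ∧ d = ((q : WithTop Q) : Ext Q))

namespace Corr

variable {P Q : Type} {p p₂ : P} {q q₂ : Q} {c c₂ : Ext P} {d d₂ : Ext Q}

theorem symm (h : Corr p q c d) : Corr q p d c :=
  h.imp And.symm (Or.imp And.symm And.symm)

variable [LinearOrder P]

theorem eq (h : Corr p q c d) (h₂ : Corr p₂ q₂ c₂ d₂) (hpq : p = p₂ → q = q₂) (hc : c = c₂) :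
    d = d₂ := by
  subst hc
  rcases h with ⟨rfl, rfl⟩ | ⟨rfl, rfl⟩ | ⟨rfl, rfl⟩ <;>
    rcases h₂ with ⟨e, rfl⟩ | ⟨e, rfl⟩ | ⟨e, rfl⟩
  · rfl
  · exact absurd e Ext.bot_lt_top.ne
  · exact absurd e (Ext.bot_lt_coe _).ne
  · exact absurd e Ext.bot_lt_top.ne'
  · rfl
  · exact absurd e (Ext.coe_lt_top _).ne'
  · exact absurd e (Ext.bot_lt_coe _).ne'
  · exact absurd e (Ext.coe_lt_top _).ne
  · exact congrArg _ (congrArg _ (hpq (WithTop.coe_inj.1 (WithBot.coe_inj.1 e))))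

variable [LinearOrder Q]

theorem lt (h : Corr p q c d) (h₂ : Corr p₂ q₂ c₂ d₂) (hpq : p < p₂ → q < q₂) (hc : c < c₂) :
    d < d₂ := by
  rcases h with ⟨rfl, rfl⟩ | ⟨rfl, rfl⟩ | ⟨rfl, rfl⟩ <;>
    rcases h₂ with ⟨rfl, rfl⟩ | ⟨rfl, rfl⟩ | ⟨rfl, rfl⟩
  · exact absurd hc (lt_irrefl _)
  · exact Ext.bot_lt_top
  · exact Ext.bot_lt_coe _
  · exact absurd hc not_lt_bot
  · exact absurd hc (lt_irrefl _)
  · exact absurd hc not_top_lt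
  · exact absurd hc not_lt_bot
  · exact Ext.coe_lt_top _
  · exact Ext.coe_lt_coe.2 (hpq (Ext.coe_lt_coe.1 hc))

theorem le (h : Corr p q c d) (h₂ : Corr p₂ q₂ c₂ d₂) (hpq : p ≤ p₂ → q ≤ q₂) (hc : c ≤ c₂) :
    d ≤ d₂ := by
  rcases h with ⟨rfl, rfl⟩ | ⟨rfl, rfl⟩ | ⟨rfl, rfl⟩ <;>
    rcases h₂ with ⟨rfl, rfl⟩ | ⟨rfl, rfl⟩ | ⟨rfl, rfl⟩
  · exact le_rfl
  · exact bot_le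
  · exact bot_le
  · exact absurd Ext.bot_lt_top (not_lt.2 hc)
  · exact le_rfl
  · exact absurd (Ext.coe_lt_top _) (not_lt.2 hc)
  · exact absurd (Ext.bot_lt_coe _) (not_lt.2 hc)
  · exact le_top
  · exact WithBot.coe_le_coe.2 (WithTop.coe_le_coe.2
      (hpq (WithTop.coe_le_coe.1 (WithBot.coe_le_coe.1 hc))))

end Corr

theorem Corr.frameWord_eq {p : u.Pos} {q : v.Pos} {c : Ext u.Pos} {d : Ext v.Pos}
    (h : Corr p q c d) (hl : u.label p = v.label q) :
    frameWord x y σ u c = frameWord x y σ v d := by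
  rcases h with ⟨rfl, rfl⟩ | ⟨rfl, rfl⟩ | ⟨rfl, rfl⟩ <;> simp [hl]

/-- Translates a move of Spoiler: `p` is played in the auxiliary game on `(u, v)` before the answer
`q` is known. If `P` lies in `x` or `y`, an arbitrary `p` is played, for which a position must
exist. -/
theorem exists_corr (hu : Nonempty u.Pos) (P : (frame x y σ u).Pos) :
    ∃ p : u.Pos, ∀ (v : GWord Λ) (q : v.Pos), u.label p = v.label q →
      ∃ Q : (frame x y σ v).Pos, off P = off Q ∧ Corr p q (idx P) (idx Q) := by
  have hP := off_lt P
  have key : ∀ p : u.Pos, (∀ (v : GWord Λ) (q : v.Pos), u.label p = v.label q →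
      ∃ d, Corr p q (idx P) d) → ∀ (v : GWord Λ) (q : v.Pos), u.label p = v.label q →
        ∃ Q : (frame x y σ v).Pos, off P = off Q ∧ Corr p q (idx P) (idx Q) := by
    intro p hp v q hl
    obtain ⟨d, hd⟩ := hp v q hl
    exact ⟨blocks.pos d (off P) (by rwa [← hd.frameWord_eq hl]), rfl, hd⟩
  rcases Ext.cases (idx P) with h | h | ⟨p, h⟩
  · exact ⟨hu.some, key _ fun v q _ => ⟨_, Or.inl ⟨h, rfl⟩⟩⟩
  · exact ⟨hu.some, key _ fun v q _ => ⟨_, Or.inr (Or.inl ⟨h, rfl⟩)⟩⟩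
  · exact ⟨p, key _ fun v q _ => ⟨_, Or.inr (Or.inr ⟨h, rfl⟩)⟩⟩

/-- The words `x` and `y` may be empty, but their indices are extremal and never lie strictly
between two others. -/
theorem forall_between_frameWord_iff (hσ : ∀ a, σ a ≠ []) {c d : Ext u.Pos} :
    (c < d ∧ ∀ e, c < e → e < d → frameWord x y σ u e = []) ↔ c ⋖ d := by
  refine and_congr_right fun _ => forall_congr' fun e => imp_congr_right fun h1 => ?_
  refine ⟨fun h h2 => ?_, fun h h2 => absurd h2 h⟩
  rcases Ext.cases e with rfl | rfl | ⟨p, rfl⟩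
  · simp at h1
  · rcases Ext.cases d with rfl | rfl | ⟨p, rfl⟩ <;> simp at h2
  · exact hσ _ (h h2)

/-- Adjacency across the border to `x` or `y` is minimality or maximality in `u`, which is the
reason for the clauses on `min` and `max` in `suc`-stability. As `P` is non-empty, the two new
endpoints are never adjacent. -/
theorem Corr.covBy {P Q : Type} [LinearOrder P] [LinearOrder Q] [Nonempty P] {p p₂ : P} {q q₂ : Q}
    {c c₂ : Ext P} {d d₂ : Ext Q}
    (h : Corr p q c d) (h₂ : Corr p₂ q₂ c₂ d₂) (hsuc : p ⋖ p₂ → q ⋖ q₂)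
    (hmax : IsTop p → IsTop q) (hmin : IsBot p₂ → IsBot q₂) (hc : c ⋖ c₂) : d ⋖ d₂ := by
  rcases h with ⟨rfl, rfl⟩ | ⟨rfl, rfl⟩ | ⟨rfl, rfl⟩ <;>
    rcases h₂ with ⟨rfl, rfl⟩ | ⟨rfl, rfl⟩ | ⟨rfl, rfl⟩
  · exact absurd rfl hc.ne
  · obtain ⟨p⟩ := ‹Nonempty P›
    exact absurd (Ext.coe_lt_top p) (hc.2 (Ext.bot_lt_coe p))
  · exact Ext.bot_covBy_coe.2 (hmin (Ext.bot_covBy_coe.1 hc))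
  · exact absurd hc.1 not_lt_bot
  · exact absurd rfl hc.ne
  · exact absurd hc.1 not_top_lt
  · exact absurd hc.1 not_lt_bot
  · exact Ext.coe_covBy_top.2 (hmax (Ext.coe_covBy_top.1 hc))
  · exact Ext.coe_covBy_coe.2 (hsuc (Ext.coe_covBy_coe.1 hc))



end Frame

/-! ### Linked positions, and the transfer of strategies to substituted words -/

section Frame

variable {x y : List Λ} {σ : Λ → List Λ} {u v : GWord Λ}

/-- The values `P` in `x σ(u) y` and `Q` in `x σ(v) y` correspond to each other, provided that `p`
corresponds to `q`. -/
structure Linked (x y : List Λ) (σ : Λ → List Λ) (u v : GWord Λ) (P : (frame x y σ u).Pos)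
    (Q : (frame x y σ v).Pos) (p : u.Pos) (q : v.Pos) : Prop where
  off_eq : off P = off Q
  corr : Corr p q (idx P) (idx Q)
  label_eq : u.label p = v.label q

namespace Linked

variable {P P₂ : (frame x y σ u).Pos} {Q Q₂ : (frame x y σ v).Pos} {p p₂ : u.Pos} {q q₂ : v.Pos}

theorem symm (h : Linked x y σ u v P Q p q) : Linked x y σ v u Q P q p :=
  ⟨h.1.symm, h.2.symm, h.3.symm⟩

theorem frameWord_eq (h : Linked x y σ u v P Q p q) :
    frameWord x y σ u (idx P) = frameWord x y σ v (idx Q) :=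
  h.corr.frameWord_eq h.label_eq

theorem frame_label_eq (h : Linked x y σ u v P Q p q) :
    (frame x y σ u).label P = (frame x y σ v).label Q := by
  have e : ∀ {l l' : List Λ} {i j : ℕ} (hi : i < l.length) (hj : j < l'.length), l = l' → i = j →
      l[i] = l'[j] := by
    rintro l _ i _ hi hj rfl rfl
    rfl
  exact e (off_lt P) (off_lt Q) h.frameWord_eq h.off_eq

theorem eq (h : Linked x y σ u v P Q p q) (h₂ : Linked x y σ u v P₂ Q₂ p₂ q₂)
    (hpq : p = p₂ → q = q₂) (hP : P = P₂) : Q = Q₂ := by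
  subst hP
  exact blocks.ext (h.corr.eq h₂.corr hpq rfl) (h.off_eq.symm.trans h₂.off_eq)

/-- Both hypotheses are needed, whence order-stability: in different blocks the order is that of the
indices, while in the same block only `p ≤ p₂` is available and the offsets decide. -/
theorem lt (h : Linked x y σ u v P Q p q) (h₂ : Linked x y σ u v P₂ Q₂ p₂ q₂)
    (hlt : p < p₂ → q < q₂) (hle : p ≤ p₂ → q ≤ q₂) (hP : P < P₂) : Q < Q₂ := by
  refine lt_iff.2 ?_
  rcases lt_iff.1 hP with hP | ⟨h1, h2⟩
  · exact Or.inl (h.corr.lt h₂.corr hlt hP)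
  · rw [h.off_eq, h₂.off_eq] at h2
    rcases (h.corr.le h₂.corr hle h1.le).lt_or_eq with h3 | h3
    · exact Or.inl h3
    · exact Or.inr ⟨h3, h2⟩

theorem le (h : Linked x y σ u v P Q p q) (h₂ : Linked x y σ u v P₂ Q₂ p₂ q₂)
    (hlt : p < p₂ → q < q₂) (hle : p ≤ p₂ → q ≤ q₂) (hP : P ≤ P₂) : Q ≤ Q₂ := by
  refine le_iff.2 ?_
  rcases le_iff.1 hP with hP | ⟨h1, h2⟩
  · exact Or.inl (h.corr.lt h₂.corr hlt hP)
  · rw [h.off_eq, h₂.off_eq] at h2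
    rcases (h.corr.le h₂.corr hle h1.le).lt_or_eq with h3 | h3
    · exact Or.inl h3
    · exact Or.inr ⟨h3, h2⟩

/-- Successors inside one block require equality of the underlying letters, successors across blocks
require adjacency of the indices. Together these use all of the first clause of `suc`-stability. -/
theorem covBy (hσ : ∀ a, σ a ≠ []) (h : Linked x y σ u v P Q p q)
    (h₂ : Linked x y σ u v P₂ Q₂ p₂ q₂) (heq : p = p₂ → q = q₂) (hsuc : p ⋖ p₂ → q ⋖ q₂)
    (hmax : IsTop p → IsTop q) (hmin : IsBot p₂ → IsBot q₂) (hP : P ⋖ P₂) : Q ⋖ Q₂ := by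
  have : Nonempty u.Pos := ⟨p⟩
  refine blocks.covBy_iff.2 ?_
  rcases blocks.covBy_iff.1 hP with ⟨h1, h2⟩ | ⟨h1, h2, h3⟩
  · exact Or.inl ⟨h.corr.eq h₂.corr heq h1, by rw [← h.off_eq, ← h₂.off_eq, h2]⟩
  · refine Or.inr ⟨by rw [← h.off_eq, h1, h.frameWord_eq], by rw [← h₂.off_eq, h2], ?_⟩
    exact (forall_between_frameWord_iff hσ).2
      (h.corr.covBy h₂.corr hsuc hmax hmin ((forall_between_frameWord_iff hσ).1 h3))

theorem isBot (hσ : ∀ a, σ a ≠ []) (h : Linked x y σ u v P Q p q) (hmin : IsBot p → IsBot q)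
    (hP : IsBot P) : IsBot Q := by
  obtain ⟨h1, h2⟩ := isBot_iff.1 hP
  refine isBot_iff.2 ⟨h.off_eq.symm.trans h1, fun e he => ?_⟩
  rcases h.corr with ⟨e1, e2⟩ | ⟨e1, e2⟩ | ⟨e1, e2⟩
  · rw [e2] at he
    exact absurd he not_lt_bot
  · rw [e1] at h2
    -- A first position cannot lie in `y`, because the block of the letter at `p` comes before and
    -- is non-empty.
    exact absurd (h2 _ (Ext.coe_lt_top p)) (hσ _)
  · rw [e1] at h2
    rw [e2] at he
    have hq : IsBot q := hmin fun r => not_lt.1 fun hr => hσ _ (h2 _ (Ext.coe_lt_coe.2 hr))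
    rcases Ext.cases e with rfl | rfl | ⟨r, rfl⟩
    · exact h2 _ (Ext.bot_lt_coe p)
    · exact absurd he not_top_lt
    · exact absurd (Ext.coe_lt_coe.1 he) (not_lt.2 (hq r))

theorem isTop (hσ : ∀ a, σ a ≠ []) (h : Linked x y σ u v P Q p q) (hmax : IsTop p → IsTop q)
    (hP : IsTop P) : IsTop Q := by
  obtain ⟨h1, h2⟩ := isTop_iff.1 hP
  refine isTop_iff.2 ⟨by rw [← h.off_eq, h1, h.frameWord_eq], fun e he => ?_⟩
  rcases h.corr with ⟨e1, e2⟩ | ⟨e1, e2⟩ | ⟨e1, e2⟩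
  · rw [e1] at h2
    exact absurd (h2 _ (Ext.bot_lt_coe p)) (hσ _)
  · rw [e2] at he
    exact absurd he not_top_lt
  · rw [e1] at h2
    rw [e2] at he
    have hq : IsTop q := hmax fun r => not_lt.1 fun hr => hσ _ (h2 _ (Ext.coe_lt_coe.2 hr))
    rcases Ext.cases e with rfl | rfl | ⟨r, rfl⟩
    · exact absurd he not_lt_bot
    · exact h2 _ (Ext.coe_lt_top p)
    · exact absurd (Ext.coe_lt_coe.1 he) (not_lt.2 (hq r))

end Linked

/-- All values of `A` and `B` correspond to each other. -/
def LinkedVal (x y : List Λ) (σ : Λ → List Λ) (u v : GWord Λ) (A : V → Option (frame x y σ u).Pos)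
    (B : V → Option (frame x y σ v).Pos) (α : V → Option u.Pos) (β : V → Option v.Pos) : Prop :=
  ∀ z, (A z = none ∧ B z = none) ∨ ∃ P Q p q, A z = some P ∧ B z = some Q ∧ α z = some p ∧
    β z = some q ∧ Linked x y σ u v P Q p q

namespace LinkedVal

variable {A : V → Option (frame x y σ u).Pos} {B : V → Option (frame x y σ v).Pos}
  {α : V → Option u.Pos} {β : V → Option v.Pos}

theorem symm (h : LinkedVal x y σ u v A B α β) : LinkedVal x y σ v u B A β α := fun z =>
  (h z).imp And.symm fun ⟨P, Q, p, q, h1, h2, h3, h4, h5⟩ => ⟨Q, P, q, p, h2, h1, h4, h3, h5.symm⟩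

theorem get (h : LinkedVal x y σ u v A B α β) {z : V} {P : (frame x y σ u).Pos}
    (hP : A z = some P) : ∃ Q p q, B z = some Q ∧ α z = some p ∧ β z = some q ∧
      Linked x y σ u v P Q p q := by
  rcases h z with ⟨h1, -⟩ | ⟨P', Q, p, q, h1, h2, h3, h4, h5⟩
  · rw [hP] at h1
    cases h1
  · rw [hP] at h1
    cases h1
    exact ⟨Q, p, q, h2, h3, h4, h5⟩

theorem upd (h : LinkedVal x y σ u v A B α β) (z : V) {P : (frame x y σ u).Pos}
    {Q : (frame x y σ v).Pos} {p : u.Pos} {q : v.Pos} (hl : Linked x y σ u v P Q p q) :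
    LinkedVal x y σ u v (upd A z (some P)) (PiGames.upd B z (some Q)) (PiGames.upd α z (some p))
      (PiGames.upd β z (some q)) := by
  intro z'
  rcases eq_or_ne z' z with rfl | hz
  · exact Or.inr ⟨P, Q, p, q, upd_same .., upd_same .., upd_same .., upd_same .., hl⟩
  · rw [upd_of_ne _ hz, upd_of_ne _ hz, upd_of_ne _ hz, upd_of_ne _ hz]
    exact h z'

/-- If certain atomic formulae are preserved from `u` to `v`, then they are preserved from
`x σ(u) y` to `x σ(v) y`. -/
theorem sat_of_isAtomic (hσ : ∀ a, σ a ≠ []) (hu : Nonempty u.Pos)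
    (h : LinkedVal x y σ u v A B α β) {Γ : Set (Formula Λ V)}
    (hsuc : ∀ z z', .suc z z' ∈ Γ → .eq z z' ∈ Γ ∧ .max z ∈ Γ ∧ .min z' ∈ Γ)
    (hord : ∀ z z', .lt z z' ∈ Γ ↔ .le z z' ∈ Γ)
    (hpres : ∀ φ ∈ Γ, φ.IsAtomic → φ.FV ⊆ (Valuation.mk u α).dom →
      φ.FV ⊆ (Valuation.mk v β).dom → φ.Sat ⟨u, α⟩ → φ.Sat ⟨v, β⟩)
    {φ : Formula Λ V} (hφ : φ ∈ Γ) (hat : φ.IsAtomic) (hs : φ.Sat ⟨frame x y σ u, A⟩) :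
    φ.Sat ⟨frame x y σ v, B⟩ := by
  have dom₁ : ∀ {w : GWord Λ} {γ : V → Option w.Pos} {z : V} {r : w.Pos}, γ z = some r →
      {z} ⊆ (Valuation.mk w γ).dom := by
    rintro w γ z r hz _ rfl hn
    cases hz.symm.trans hn
  have dom₂ : ∀ {w : GWord Λ} {γ : V → Option w.Pos} {z z' : V} {r r' : w.Pos}, γ z = some r →
      γ z' = some r' → {z, z'} ⊆ (Valuation.mk w γ).dom := fun h h' =>
    Set.insert_subset (Set.singleton_subset_iff.1 (dom₁ h)) (dom₁ h')
  have hmin : ∀ {z p q}, α z = some p → β z = some q → .min z ∈ Γ → IsBot p → IsBot q := by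
    intro z p q h1 h2 hΓ hp
    obtain ⟨q', e, hq⟩ := hpres _ hΓ trivial (dom₁ h1) (dom₁ h2) ⟨p, h1, hp⟩
    cases h2.symm.trans e
    exact hq
  have hmax : ∀ {z p q}, α z = some p → β z = some q → .max z ∈ Γ → IsTop p → IsTop q := by
    intro z p q h1 h2 hΓ hp
    obtain ⟨q', e, hq⟩ := hpres _ hΓ trivial (dom₁ h1) (dom₁ h2) ⟨p, h1, hp⟩
    cases h2.symm.trans e
    exact hq
  have heq : ∀ {z z' p q p' q'}, α z = some p → β z = some q → α z' = some p' → β z' = some q' →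
      .eq z z' ∈ Γ → p = p' → q = q' := by
    intro z z' p q p' q' h1 h2 h3 h4 hΓ hp
    obtain ⟨q₁, q₂, e₁, e₂, hq⟩ := hpres _ hΓ trivial (dom₂ h1 h3) (dom₂ h2 h4)
      ⟨p, p', h1, h3, hp⟩
    cases h2.symm.trans e₁
    cases h4.symm.trans e₂
    exact hq
  have hlt : ∀ {z z' p q p' q'}, α z = some p → β z = some q → α z' = some p' → β z' = some q' →
      .lt z z' ∈ Γ → p < p' → q < q' := by
    intro z z' p q p' q' h1 h2 h3 h4 hΓ hp
    obtain ⟨q₁, q₂, e₁, e₂, hq⟩ := hpres _ hΓ trivial (dom₂ h1 h3) (dom₂ h2 h4)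
      ⟨p, p', h1, h3, hp⟩
    cases h2.symm.trans e₁
    cases h4.symm.trans e₂
    exact hq
  have hle : ∀ {z z' p q p' q'}, α z = some p → β z = some q → α z' = some p' → β z' = some q' →
      .le z z' ∈ Γ → p ≤ p' → q ≤ q' := by
    intro z z' p q p' q' h1 h2 h3 h4 hΓ hp
    obtain ⟨q₁, q₂, e₁, e₂, hq⟩ := hpres _ hΓ trivial (dom₂ h1 h3) (dom₂ h2 h4)
      ⟨p, p', h1, h3, hp⟩
    cases h2.symm.trans e₁
    cases h4.symm.trans e₂
    exact hq
  have hcov : ∀ {z z' p q p' q'}, α z = some p → β z = some q → α z' = some p' →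
      β z' = some q' → .suc z z' ∈ Γ → p ⋖ p' → q ⋖ q' := by
    intro z z' p q p' q' h1 h2 h3 h4 hΓ hp
    obtain ⟨q₁, q₂, e₁, e₂, hq⟩ := hpres _ hΓ trivial (dom₂ h1 h3) (dom₂ h2 h4)
      ⟨p, p', h1, h3, hp⟩
    cases h2.symm.trans e₁
    cases h4.symm.trans e₂
    exact hq
  cases φ with
  | top => trivial
  | bot => exact hs
  | empty =>
    -- Vacuous: any letter of `u` contributes a position.
    obtain ⟨p⟩ := hu
    exact (hs.false (blocks.pos ((p : WithTop u.Pos) : Ext u.Pos) 0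
      (List.length_pos_iff.2 (hσ _)))).elim
  | lab z a =>
    obtain ⟨P, hP, ha⟩ := hs
    obtain ⟨Q, p, q, h1, h2, h3, hl⟩ := h.get hP
    exact ⟨Q, h1, hl.frame_label_eq.symm.trans ha⟩
  | min z =>
    obtain ⟨P, hP, hb⟩ := hs
    obtain ⟨Q, p, q, h1, h2, h3, hl⟩ := h.get hP
    exact ⟨Q, h1, hl.isBot hσ (hmin h2 h3 hφ) hb⟩
  | max z =>
    obtain ⟨P, hP, hb⟩ := hs
    obtain ⟨Q, p, q, h1, h2, h3, hl⟩ := h.get hP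
    exact ⟨Q, h1, hl.isTop hσ (hmax h2 h3 hφ) hb⟩
  | eq z z' =>
    obtain ⟨P, P', hP, hP', hPP⟩ := hs
    obtain ⟨Q, p, q, h1, h2, h3, hl⟩ := h.get hP
    obtain ⟨Q', p', q', h1', h2', h3', hl'⟩ := h.get hP'
    exact ⟨Q, Q', h1, h1', hl.eq hl' (heq h2 h3 h2' h3' hφ) hPP⟩
  | lt z z' =>
    obtain ⟨P, P', hP, hP', hPP⟩ := hs
    obtain ⟨Q, p, q, h1, h2, h3, hl⟩ := h.get hP
    obtain ⟨Q', p', q', h1', h2', h3', hl'⟩ := h.get hP'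
    exact ⟨Q, Q', h1, h1', hl.lt hl' (hlt h2 h3 h2' h3' hφ)
      (hle h2 h3 h2' h3' ((hord z z').1 hφ)) hPP⟩
  | le z z' =>
    obtain ⟨P, P', hP, hP', hPP⟩ := hs
    obtain ⟨Q, p, q, h1, h2, h3, hl⟩ := h.get hP
    obtain ⟨Q', p', q', h1', h2', h3', hl'⟩ := h.get hP'
    exact ⟨Q, Q', h1, h1', hl.le hl' (hlt h2 h3 h2' h3' ((hord z z').2 hφ))
      (hle h2 h3 h2' h3' hφ) hPP⟩
  | suc z z' =>
    obtain ⟨P, P', hP, hP', hPP⟩ := hs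
    obtain ⟨Q, p, q, h1, h2, h3, hl⟩ := h.get hP
    obtain ⟨Q', p', q', h1', h2', h3', hl'⟩ := h.get hP'
    obtain ⟨g1, g2, g3⟩ := hsuc z z' hφ
    exact ⟨Q, Q', h1, h1', hl.covBy hσ hl' (heq h2 h3 h2' h3' g1) (hcov h2 h3 h2' h3' hφ)
      (hmax h2 h3 g2) (hmin h2' h3' g3) hPP⟩
  | neg _ | or _ _ | and _ _ | ex _ _ | all _ _ => exact hat.elim

end LinkedVal

/-- Every fragment contains all formulae `λ(x) = a`, so undefeated replies carry the right letter
and hence stand for the same word under `σ`. -/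
theorem label_eq_of_not_spoilerWins {G : Set (Formula Λ V)} (hG : IsFragment G)
    {α : V → Option u.Pos} {β : V → Option v.Pos}
    (h : ¬ Config.SpoilerWins ⟨G, ⟨u, α⟩, ⟨v, β⟩⟩) {z : V} {p : u.Pos} {q : v.Pos}
    (hp : α z = some p) (hq : β z = some q) : u.label p = v.label q := by
  by_contra hne
  obtain ⟨φ, hφ⟩ := hG.nonempty
  refine h ⟨.lab z (u.label p), hG.lab_mem .hole φ z _ hφ, Or.inl trivial, ?_, ?_, ⟨p, hp, rfl⟩, ?_⟩
  · rintro _ rfl hn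
    cases hp.symm.trans hn
  · rintro _ rfl hn
    cases hq.symm.trans hn
  · rintro ⟨q', hq', e⟩
    cases hq.symm.trans hq'
    exact hne e.symm

/-- A winning strategy on `(u, v)` carries over to `(x σ(u) y, x σ(v) y)`. -/
theorem DuplicatorWins.frame {F : Set (Formula Λ V)} (hF : IsFragment F) (hsuc : SucStable F)
    (hord : OrderStable F) (hσ : ∀ a, σ a ≠ []) (hu : Nonempty u.Pos) (hv : Nonempty v.Pos)
    (h : DuplicatorWins F u v) (x y : List Λ) :
    DuplicatorWins F (frame x y σ u) (PiGames.frame x y σ v) := by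
  obtain ⟨W, hW, h₀⟩ := duplicatorWins_iff.1 h
  -- The words are quantified existentially because negated quantifiers interchange them. The
  -- auxiliary valuations `α` and `β` record a simultaneous play in `W`.
  let W' : Set (Config Λ V) := {S' | ∃ (G : Set (Formula Λ V)) (u v : GWord Λ)
    (A : V → Option (PiGames.frame x y σ u).Pos) (B : V → Option (PiGames.frame x y σ v).Pos)
    (α : V → Option u.Pos) (β : V → Option v.Pos),
    (IsFragment G ∧ SucStable G ∧ OrderStable G ∧ Nonempty u.Pos ∧ Nonempty v.Pos) ∧
    S' = ⟨G, ⟨PiGames.frame x y σ u, A⟩, ⟨PiGames.frame x y σ v, B⟩⟩ ∧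
    (⟨G, ⟨u, α⟩, ⟨v, β⟩⟩ : Config Λ V) ∈ W ∧ LinkedVal x y σ u v A B α β}
  refine duplicatorWins_iff.2 ⟨W', ⟨?_, ?_⟩, F, u, v, fun _ => none, fun _ => none, fun _ => none,
    fun _ => none, ⟨hF, hsuc, hord, hu, hv⟩, rfl, h₀, fun _ => Or.inl ⟨rfl, rfl⟩⟩
  · rintro _ ⟨G, u, v, A, B, α, β, ⟨hG, hGs, hGo, hu, hv⟩, rfl, hmem, hlink⟩
      ⟨φ, hφ, hlit, -, -, hs, hns⟩
    have hno := hW.not_spoilerWins _ hmem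
    rcases hlit with hat | ⟨ψ, hat, rfl⟩
    · refine hns (hlink.sat_of_isAtomic hσ hu (hGs.suc_mem .hole) (hGo .hole) ?_ hφ hat hs)
      intro χ hχ hat h1 h2 h3
      by_contra h4
      exact hno ⟨χ, hχ, Or.inl hat, h1, h2, h3, h4⟩
    -- A negated atom is preserved from left to right iff the atom is preserved from right to left,
    -- so the roles of `u` and `v` are exchanged and stability is used in the context `¬`.
    · refine hs (hlink.symm.sat_of_isAtomic (Γ := {χ | Formula.neg χ ∈ G}) hσ hv
        (hGs.suc_mem (.neg .hole)) (hGo (.neg .hole)) ?_ hφ hat (not_not.1 hns))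
      intro χ hχ hat h1 h2 h3
      by_contra h4
      exact hno ⟨_, hχ, Or.inr ⟨χ, hat, rfl⟩, h2, h1, h4, not_not_intro h3⟩
  · rintro _ ⟨G, u, v, A, B, α, β, ⟨hG, hGs, hGo, hu, hv⟩, rfl, hmem, hlink⟩ ⟨Q, z, hne, P⟩
    have hGr : IsFragment (reduct Q z G) := hG.reduct hne
    have hGrs := hGs.reduct Q z
    have hGro := hGo.reduct Q z
    cases Q with
    | ex =>
      obtain ⟨p, hp⟩ := exists_corr hu P
      obtain ⟨q, hq⟩ := hW.reply _ hmem ⟨.ex, z, hne, p⟩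
      have hl := label_eq_of_not_spoilerWins hGr (hW.not_spoilerWins _ hq)
        (upd_same α z (some p)) (upd_same β z (some q))
      obtain ⟨R, h1, h2⟩ := hp v q hl
      exact ⟨R, _, u, v, _, _, _, _, ⟨hGr, hGrs, hGro, hu, hv⟩, rfl, hq, hlink.upd z ⟨h1, h2, hl⟩⟩
    | negAll =>
      obtain ⟨p, hp⟩ := exists_corr hu P
      obtain ⟨q, hq⟩ := hW.reply _ hmem ⟨.negAll, z, hne, p⟩
      have hl := label_eq_of_not_spoilerWins hGr (hW.not_spoilerWins _ hq)
        (upd_same β z (some q)) (upd_same α z (some p))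
      obtain ⟨R, h1, h2⟩ := hp v q hl.symm
      exact ⟨R, _, v, u, _, _, _, _, ⟨hGr, hGrs, hGro, hv, hu⟩, rfl, hq,
        (hlink.upd z ⟨h1, h2, hl.symm⟩).symm⟩
    | all =>
      obtain ⟨q, hq⟩ := exists_corr hv P
      obtain ⟨p, hp⟩ := hW.reply _ hmem ⟨.all, z, hne, q⟩
      have hl := label_eq_of_not_spoilerWins hGr (hW.not_spoilerWins _ hp)
        (upd_same α z (some p)) (upd_same β z (some q))
      obtain ⟨R, h1, h2⟩ := hq u p hl.symm
      exact ⟨R, _, u, v, _, _, _, _, ⟨hGr, hGrs, hGro, hu, hv⟩, rfl, hp,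
        (hlink.symm.upd z ⟨h1, h2, hl.symm⟩).symm⟩
    | negEx =>
      obtain ⟨q, hq⟩ := exists_corr hv P
      obtain ⟨p, hp⟩ := hW.reply _ hmem ⟨.negEx, z, hne, q⟩
      have hl := label_eq_of_not_spoilerWins hGr (hW.not_spoilerWins _ hp)
        (upd_same β z (some q)) (upd_same α z (some p))
      obtain ⟨R, h1, h2⟩ := hq u p hl
      exact ⟨R, _, v, u, _, _, _, _, ⟨hGr, hGrs, hGro, hv, hu⟩, rfl, hp,
        hlink.symm.upd z ⟨h1, h2, hl⟩⟩

end Frame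

/-! ### Finite words -/

namespace GWord

theorem isom_of_strictMono {u v : GWord Λ} (f : u.Pos → v.Pos) (hf : StrictMono f)
    (hs : Function.Surjective f) (hl : ∀ p, v.label (f p) = u.label p) : u.Isom v :=
  ⟨hf.orderIsoOfSurjective f hs, hl⟩

theorem Isom.refl (u : GWord Λ) : u.Isom u := ⟨OrderIso.refl _, fun _ => rfl⟩

theorem Isom.symm {u v : GWord Λ} (h : u.Isom v) : v.Isom u := by
  obtain ⟨f, hf⟩ := h
  exact ⟨f.symm, fun p => by rw [← hf, f.apply_symm_apply]⟩

theorem Isom.trans {u v w : GWord Λ} (h : u.Isom v) (h' : v.Isom w) : u.Isom w := by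
  obtain ⟨f, hf⟩ := h
  obtain ⟨g, hg⟩ := h'
  exact ⟨f.trans g, fun p => (hg _).trans (hf p)⟩

theorem concat_strictMono {u v : GWord Λ} {T : Type} [LinearOrder T] {f : (u.concat v).Pos → T}
    (h1 : ∀ p q, p < q → f (inl p) < f (inl q)) (h2 : ∀ p q, p < q → f (inr p) < f (inr q))
    (h3 : ∀ p q, f (inl p) < f (inr q)) : StrictMono f := by
  intro p q hpq
  rcases inl_or_inr p with ⟨p, rfl⟩ | ⟨p, rfl⟩ <;> rcases inl_or_inr q with ⟨q, rfl⟩ | ⟨q, rfl⟩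
  · exact h1 p q (inl_lt_inl.1 hpq)
  · exact h3 p q
  · exact absurd hpq (inl_lt_inr q p).not_gt
  · exact h2 p q (inr_lt_inr.1 hpq)

theorem Isom.concat {u u' v v' : GWord Λ} (h : u.Isom u') (h' : v.Isom v') :
    (u.concat v).Isom (u'.concat v') := by
  obtain ⟨f, hf⟩ := h
  obtain ⟨g, hg⟩ := h'
  refine ⟨f.sumLexCongr g, fun p => ?_⟩
  rcases p with p | p
  · exact hf p
  · exact hg p

theorem isom_ofList_append (l l' : List Λ) :
    ((ofList l).concat (ofList l')).Isom (ofList (l ++ l')) := by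
  let f : ((ofList l).concat (ofList l')).Pos → Fin (l ++ l').length := fun p =>
    Sum.elim (fun i : Fin l.length => ⟨i, by have := i.2; simp; omega⟩)
      (fun j : Fin l'.length => ⟨l.length + j, by have := j.2; simp⟩) (ofLex p)
  refine isom_of_strictMono f (concat_strictMono (fun i j h => h) (fun i j h => ?_)
    fun i j => ?_) ?_ ?_
  · exact Fin.mk_lt_mk.2 (Nat.add_lt_add_left h _)
  · exact Fin.mk_lt_mk.2 ((show Fin l.length from i).2.trans_le le_self_add)
  · intro (i : Fin (l ++ l').length)
    have hi : (i : ℕ) < l.length + l'.length := i.2.trans_eq List.length_append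
    by_cases h : (i : ℕ) < l.length
    · exact ⟨inl (⟨i, h⟩ : Fin l.length), rfl⟩
    · refine ⟨inr (⟨i - l.length, by omega⟩ : Fin l'.length), Fin.ext ?_⟩
      change l.length + (i - l.length) = i
      omega
  · intro p
    rcases inl_or_inr p with ⟨i, rfl⟩ | ⟨i, rfl⟩
    · exact List.getElem_append_left (show Fin l.length from i).2
    · change (l ++ l')[l.length + (show Fin l'.length from i).1]'_ = l'[(show Fin l'.length from i).1]'_
      simp

end GWord

section Blocks

variable {C D : Type} [LinearOrder C] [LinearOrder D] [Countable C] [Countable D]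

theorem blocks.isom_cons (W : D → List Λ) (d : D) (f : C → D) (hf : StrictMono f)
    (hd : ∀ c, d < f c) (hD : ∀ e, e = d ∨ ∃ c, f c = e) :
    ((ofList (W d)).concat (blocks (W ∘ f))).Isom (blocks W) := by
  let g : ((ofList (W d)).concat (blocks (W ∘ f))).Pos → (blocks W).Pos := fun p =>
    Sum.elim (fun i : Fin (W d).length => blocks.pos d i i.2)
      (fun q : (blocks (W ∘ f)).Pos => blocks.pos (f (idx q)) (off q) (off_lt q)) (ofLex p)
  refine isom_of_strictMono g (concat_strictMono (fun i j h => ?_) (fun p q h => ?_)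
    fun i q => ?_) ?_ ?_
  · exact blocks.lt_iff.2 (Or.inr ⟨rfl, h⟩)
  · exact blocks.lt_iff.2 ((blocks.lt_iff.1 h).imp (fun h => hf h)
      fun h => ⟨congrArg f h.1, h.2⟩)
  · exact blocks.lt_iff.2 (Or.inl (hd _))
  · intro p
    have hp := off_lt p
    rcases hD (idx p) with h | ⟨c, h⟩
    · exact ⟨inl (⟨off p, h ▸ hp⟩ : Fin (W d).length), blocks.ext h.symm rfl⟩
    · exact ⟨inr (blocks.pos c (off p) (by simpa [h] using hp)), blocks.ext h rfl⟩
  · intro p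
    rcases inl_or_inr p with ⟨i, rfl⟩ | ⟨q, rfl⟩ <;> rfl

theorem blocks.isom_snoc (W : D → List Λ) (d : D) (f : C → D) (hf : StrictMono f)
    (hd : ∀ c, f c < d) (hD : ∀ e, e = d ∨ ∃ c, f c = e) :
    ((blocks (W ∘ f)).concat (ofList (W d))).Isom (blocks W) := by
  let g : ((blocks (W ∘ f)).concat (ofList (W d))).Pos → (blocks W).Pos := fun p =>
    Sum.elim (fun q : (blocks (W ∘ f)).Pos => blocks.pos (f (idx q)) (off q) (off_lt q))
      (fun i : Fin (W d).length => blocks.pos d i i.2) (ofLex p)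
  refine isom_of_strictMono g (concat_strictMono (fun p q h => ?_) (fun i j h => ?_)
    fun q i => ?_) ?_ ?_
  · exact blocks.lt_iff.2 ((blocks.lt_iff.1 h).imp (fun h => hf h)
      fun h => ⟨congrArg f h.1, h.2⟩)
  · exact blocks.lt_iff.2 (Or.inr ⟨rfl, h⟩)
  · exact blocks.lt_iff.2 (Or.inl (hd _))
  · intro p
    have hp := off_lt p
    rcases hD (idx p) with h | ⟨c, h⟩
    · exact ⟨inr (⟨off p, h ▸ hp⟩ : Fin (W d).length), blocks.ext h.symm rfl⟩
    · exact ⟨inl (blocks.pos c (off p) (by simpa [h] using hp)), blocks.ext h rfl⟩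
  · intro p
    rcases inl_or_inr p with ⟨i, rfl⟩ | ⟨q, rfl⟩ <;> rfl

theorem blocks.isom_ofFn : ∀ {n : ℕ} (W : Fin n → List Λ),
    (blocks W).Isom (ofList (List.ofFn W).flatten)
  | 0, W => by
    have : IsEmpty (blocks W).Pos := ⟨fun p => (idx p).elim0⟩
    have : IsEmpty (ofList (List.ofFn W).flatten).Pos :=
      ⟨fun p => Fin.elim0 (show Fin (List.ofFn W).flatten.length from p)⟩
    exact isom_of_strictMono isEmptyElim (fun p => isEmptyElim p) (fun p => isEmptyElim p)
      fun p => isEmptyElim p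
  | n + 1, W => by
    rw [List.ofFn_succ, List.flatten_cons]
    refine Isom.trans (blocks.isom_cons W 0 Fin.succ (Fin.strictMono_succ) Fin.succ_pos
      fun e => ?_).symm (((Isom.refl _).concat (blocks.isom_ofFn _)).trans (isom_ofList_append _ _))
    exact (Fin.eq_zero_or_eq_succ e).imp_right fun ⟨j, hj⟩ => ⟨j, hj.symm⟩

end Blocks

theorem GWord.isom_power_ofList (n : ℕ) (l : List Λ) :
    ((ofList l).power (Fin n)).Isom (ofList (List.replicate n l).flatten) := by
  rw [← List.ofFn_const]
  refine Isom.trans ?_ (blocks.isom_ofFn _)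
  refine isom_of_strictMono
    (fun p => blocks.pos (W := fun _ : Fin n => l) (copy p) (show Fin l.length from base p).1
      (show Fin l.length from base p).2) (fun p q h => ?_) (fun p => ?_) fun p => rfl
  · exact blocks.lt_iff.2 (lt_power_iff.1 h)
  · exact ⟨inPower (idx p) (⟨off p, off_lt p⟩ : Fin l.length), rfl⟩

theorem isom_frame_ofList (x y : List Λ) (σ : Λ → List Λ) (l : List Λ) :
    (frame x y σ (ofList l)).Isom (ofList (x ++ (l.flatMap σ ++ y))) := by
  have h1 : (blocks fun i : Fin l.length => σ (l.get i)).Isom (ofList (l.flatMap σ)) := by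
    have : l.flatMap σ = (List.ofFn fun i : Fin l.length => σ (l.get i)).flatten := by
      rw [List.flatMap_def]
      congr 1
      exact (List.ext_get (by simp) (by simp))
    rw [this]
    exact blocks.isom_ofFn _
  let W' : WithTop (Fin l.length) → List Λ := WithTop.recTopCoe y fun i => σ (l.get i)
  have h2 : (blocks W').Isom (ofList (l.flatMap σ ++ y)) := by
    refine Isom.trans (blocks.isom_snoc W' ⊤ (fun i : Fin l.length => (i : WithTop (Fin l.length)))
      WithTop.coe_strictMono WithTop.coe_lt_top fun e => ?_).symm
      ((h1.concat (Isom.refl _)).trans (isom_ofList_append _ _))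
    induction e using WithTop.recTopCoe with
    | top => exact Or.inl rfl
    | coe i => exact Or.inr ⟨i, rfl⟩
  refine Isom.trans (blocks.isom_cons (frameWord x y σ (ofList l)) ⊥
    (fun c : WithTop (Fin l.length) => (c : Ext (Fin l.length)))
      WithBot.coe_strictMono WithBot.bot_lt_coe fun e => ?_).symm
      (((Isom.refl _).concat h2).trans (isom_ofList_append _ _))
  induction e using WithBot.recBotCoe with
  | bot => exact Or.inl rfl
  | coe c => exact Or.inr ⟨c, rfl⟩

theorem EF.ofList_append {k : ℕ} {l l' : List Λ}
    (h : EF (ofList l) (ofList l') k (fun _ : V => none) (fun _ => none)) (x y : List Λ) :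
    EF (ofList (x ++ l ++ y)) (ofList (x ++ l' ++ y)) k (fun _ : V => none) (fun _ => none) := by
  have e : ∀ m : List Λ, (((ofList x).concat (ofList m)).concat (ofList y)).Isom
      (ofList (x ++ m ++ y)) := fun m =>
    ((isom_ofList_append _ _).concat (Isom.refl _)).trans (isom_ofList_append _ _)
  exact ((EF.of_isom (e l).symm k).trans
    (EF.concat_none (EF.concat_none (EF.refl _ _ _) h) (EF.refl _ _ _))).trans
      (EF.of_isom (e l') k)

theorem EF.replicate {k n : ℕ} (hn : 2 ^ k ≤ n) {u : GWord Λ} {l : List Λ}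
    (h : EF u (ofList l) k (fun _ : V => none) (fun _ => none)) :
    EF (u.power Rho) (ofList (List.replicate (n + 1) l).flatten) k (fun _ : V => none)
      (fun _ => none) :=
  (EF.power_none (EF.plain_rho_fin hn) h).trans (EF.of_isom (isom_power_ofList _ _) k)

/-! ### Positive powers -/

section PosPow

variable {S : Type*} [Semigroup S]

theorem posPow_mul_posPow (x : S) (m n : ℕ) : posPow x m * posPow x n = posPow x (m + n + 1) := by
  induction n with
  | zero => rfl
  | succ n ih =>
    change posPow x m * (posPow x n * x) = posPow x (m + n + 1) * x
    rw [← mul_assoc, ih]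

theorem posPow_of_isIdempotentElem {e : S} (he : IsIdempotentElem e) (n : ℕ) :
    posPow e n = e := by
  induction n with
  | zero => rfl
  | succ n ih => rw [posPow, ih, he.eq]

theorem exists_posPow_posPow (x : S) (n m : ℕ) :
    ∃ r, m ≤ r ∧ posPow (posPow x n) m = posPow x r := by
  induction m with
  | zero => exact ⟨n, Nat.zero_le n, rfl⟩
  | succ m ih =>
    obtain ⟨r, hr, e⟩ := ih
    exact ⟨r + n + 1, by omega, by rw [posPow, e, posPow_mul_posPow]⟩

/-- Stationary powers are idempotent. Conversely, an idempotent power of `x` equals its own higher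
powers, and these are late enough powers of `x`. -/
theorem idempotentPower_eq_posPow {x : S} {N : ℕ} (h : ∀ n, N ≤ n → posPow x n = posPow x N) :
    idempotentPower x = posPow x N := by
  have : Nonempty S := ⟨x⟩
  have hN : IsIdempotentElem (posPow x N) := by
    rw [IsIdempotentElem, posPow_mul_posPow, h _ (by omega)]
  obtain ⟨h1, n, h2⟩ : IsIdempotentElem (idempotentPower x) ∧ ∃ n, idempotentPower x = posPow x n :=
    Classical.epsilon_spec (p := fun e => IsIdempotentElem e ∧ ∃ n, e = posPow x n)
      ⟨posPow x N, hN, N, rfl⟩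
  obtain ⟨r, hr, e⟩ := exists_posPow_posPow x n N
  rw [← posPow_of_isIdempotentElem h1 N, h2, e, h r hr]

theorem map_posPow {T : Type*} [Semigroup T] (f : S →ₙ* T) (x : S) (n : ℕ) :
    f (posPow x n) = posPow (f x) n := by
  induction n with
  | zero => rfl
  | succ n ih => rw [posPow, map_mul, ih, posPow]

end PosPow

/-! ### Finite words that approximate the words of `π`-terms -/

theorem toList_mul {A : Type*} (w w' : FreeSemigroup A) : toList (w * w') = toList w ++ toList w' :=
  rfl

theorem toList_injective {A : Type*} : Function.Injective (toList (A := A)) := by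
  rintro ⟨a, l⟩ ⟨b, m⟩ h
  cases h
  rfl

theorem toList_posPow {A : Type*} (w : FreeSemigroup A) (n : ℕ) :
    toList (posPow w n) = (List.replicate (n + 1) (toList w)).flatten := by
  induction n with
  | zero => simp [posPow]
  | succ n ih =>
    rw [posPow, toList_mul, ih, List.replicate_succ' (n := n + 1), List.flatten_append]
    simp

/-- The finite word obtained from a `π`-term by interpreting `π` as the power `N + 1`, and the
letters as finite words. -/
def PiTerm.evalPow {A : Type*} (N : ℕ) (f : Λ → FreeSemigroup A) (s : PiTerm Λ) :
    FreeSemigroup A :=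
  PiTerm.lift (fun w => posPow w N) f s

theorem PiTerm.ef_evalRho {k N : ℕ} (hN : 2 ^ k ≤ N) (s : PiTerm Λ) :
    EF s.evalRho (ofList (toList (s.evalPow N FreeSemigroup.of))) k (fun _ : V => none)
      (fun _ => none) := by
  induction s with
  | letter a => exact EF.refl _ _ _
  | letterMul a t ih =>
    exact (EF.concat_none (EF.refl _ _ _) ih).trans (EF.of_isom (isom_ofList_append _ _) k)
  | pi s ih =>
    have e : toList ((PiTerm.pi s).evalPow N FreeSemigroup.of) = _ := toList_posPow _ N
    rw [e]
    exact EF.replicate hN ih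
  | piMul s t ih1 ih2 =>
    have e : toList ((PiTerm.piMul s t).evalPow N FreeSemigroup.of) = _ ++ _ :=
      congrArg (· ++ _) (toList_posPow _ N)
    rw [e]
    exact (EF.concat_none (EF.replicate hN ih1) ih2).trans (EF.of_isom (isom_ofList_append _ _) k)

theorem PiTerm.map_toList_evalPow {A : Finset Λ} (N : ℕ) (f : Λ → FreeSemigroup A)
    (s : PiTerm Λ) : (toList (s.evalPow N f)).map Subtype.val =
      (toList (s.evalPow N FreeSemigroup.of)).flatMap fun a => (toList (f a)).map Subtype.val := by
  have mul : ∀ {w w' : FreeSemigroup A} {z z' : FreeSemigroup Λ},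
      (toList w).map Subtype.val = (toList z).flatMap (fun a => (toList (f a)).map Subtype.val) →
      (toList w').map Subtype.val = (toList z').flatMap (fun a => (toList (f a)).map Subtype.val) →
      (toList (w * w')).map Subtype.val =
        (toList (z * z')).flatMap (fun a => (toList (f a)).map Subtype.val) := by
    intro w w' z z' h h'
    rw [toList_mul, toList_mul, List.map_append, List.flatMap_append, h, h']
  have pow : ∀ {w : FreeSemigroup A} {z : FreeSemigroup Λ},
      (toList w).map Subtype.val = (toList z).flatMap (fun a => (toList (f a)).map Subtype.val) →
      (toList (posPow w N)).map Subtype.val =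
        (toList (posPow z N)).flatMap (fun a => (toList (f a)).map Subtype.val) := by
    intro w z h
    induction N with
    | zero => exact h
    | succ N ih => exact mul ih h
  have letter : ∀ a, (toList (f a)).map Subtype.val =
      (toList (FreeSemigroup.of a)).flatMap (fun a => (toList (f a)).map Subtype.val) :=
    fun a => (List.flatMap_singleton ..).symm
  induction s with
  | letter a => exact letter a
  | letterMul a t ih => exact mul (letter a) ih
  | pi s ih => exact pow ih
  | piMul s t ih1 ih2 => exact mul (pow ih1) ih2

theorem PiTerm.nonempty_evalRho (s : PiTerm Λ) : Nonempty s.evalRho.Pos := by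
  have hl : ∀ a : Λ, Nonempty (ofList [a]).Pos := fun a => inferInstanceAs (Nonempty (Fin 1))
  induction s with
  | letter a => exact hl a
  | letterMul a t _ => exact (hl a).map inl
  | pi s ih => exact ih.map (inPower (Rho.lo 0))
  | piMul s t ih1 _ => exact ih1.map fun p => inl (inPower (Rho.lo 0) p)

/-! ### Syntactic semigroups of definable languages -/

section Syntactic

variable {A : Finset Λ}

/-- The language of non-empty words over `A` that is defined by `φ`. -/
def langOf (A : Finset Λ) (φ : Formula Λ V) : Set (FreeSemigroup A) :=
  {w | φ.Sat (.ofWord (ofList ((toList w).map Subtype.val)))}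

theorem mem_image_langOf_iff {φ : Formula Λ V} (x y : List A) (w : FreeSemigroup A) :
    x ++ toList w ++ y ∈ toList '' langOf A φ ↔
      φ.Sat (.ofWord (ofList ((x ++ toList w ++ y).map Subtype.val))) := by
  obtain ⟨z, hz⟩ : ∃ z : FreeSemigroup A, toList z = x ++ toList w ++ y := by
    rcases e : x ++ toList w ++ y with _ | ⟨a, l⟩
    · simp [toList] at e
    · exact ⟨⟨a, l⟩, rfl⟩
  rw [← hz, toList_injective.mem_set_image]
  rfl

/-- First-order definable languages are aperiodic: in every context, both powers of a representing
word are indistinguishable by `φ` from its `ϱ`-power. The exponent `φ.depth + 1` accounts for the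
spare round in `EF.sat_iff`. -/
theorem posPow_eq_of_le [Infinite V] {φ : Formula Λ V} {N : ℕ} (hN : 2 ^ (φ.depth + 1) ≤ N)
    (c : SyntacticSemigroup (langOf A φ)) {n : ℕ} (hn : N ≤ n) : posPow c n = posPow c N := by
  obtain ⟨w, rfl⟩ : ∃ w, (syntacticCon (langOf A φ)).mkMulHom w = c := Quotient.exists_rep c
  have e : ∀ m, posPow ((syntacticCon (langOf A φ)).mkMulHom w) m =
      (syntacticCon (langOf A φ)).mkMulHom (posPow w m) := fun m =>
    (map_posPow (syntacticCon (langOf A φ)).mkMulHom w m).symm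
  rw [e, e]
  refine (Con.eq _).2 fun x y => ?_
  rw [mem_image_langOf_iff, mem_image_langOf_iff]
  simp only [List.map_append, toList_posPow, List.map_flatten, List.map_replicate]
  refine EF.sat_iff φ le_rfl (EF.ofList_append ?_ _ _)
  exact (EF.replicate (hN.trans hn) (EF.refl _ _ _)).symm.trans (EF.replicate hN (EF.refl _ _ _))

/-- All idempotent powers are attained at the same exponent `N + 1`, so one finite word represents
the value of the whole term. -/
theorem hom_eq_evalPow [Infinite V] {φ : Formula Λ V} {N : ℕ} (hN : 2 ^ (φ.depth + 1) ≤ N)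
    (h : PiTerm Λ →ₙ* SyntacticSemigroup (langOf A φ))
    (hh : ∀ r, h (PiTerm.pi r) = idempotentPower (h r)) (f : Λ → FreeSemigroup A)
    (hf : ∀ a, h (.letter a) = (f a : SyntacticSemigroup (langOf A φ))) (s : PiTerm Λ) :
    h s = (s.evalPow N f : FreeSemigroup A) := by
  have hpi : ∀ r, h r = (r.evalPow N f : FreeSemigroup A) →
      h (.pi r) = ((posPow (r.evalPow N f) N : FreeSemigroup A) :
        SyntacticSemigroup (langOf A φ)) := by
    intro r hr
    rw [hh, idempotentPower_eq_posPow fun n hn => posPow_eq_of_le hN _ hn, hr]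
    exact (map_posPow (syntacticCon (langOf A φ)).mkMulHom _ N).symm
  induction s with
  | letter a => exact hf a
  | letterMul a t ih =>
    have : h (.letterMul a t) = h (.letter a) * h t := map_mul h (.letter a) t
    rw [this, hf, ih]
    rfl
  | pi s ih => exact hpi s ih
  | piMul s t ih1 ih2 =>
    have : h (.piMul s t) = h (.pi s) * h t := map_mul h (.pi s) t
    rw [this, hpi s ih1, ih2]
    rfl

end Syntactic

/-! ### The main theorem -/

variable [Infinite V] {F : Set (Formula Λ V)}

theorem sat_of_duplicatorWins (hF : IsFragment F) (hsuc : SucStable F) (hord : OrderStable F)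
    {s t : PiTerm Λ} (hst : DuplicatorWins F s.evalRho t.evalRho) {φ : Formula Λ V} (hφ : φ ∈ F)
    (hFV : φ.FV = ∅) {N : ℕ} (hN : 2 ^ (φ.depth + 1) ≤ N) {σ : Λ → List Λ} (hσ : ∀ a, σ a ≠ [])
    (x y : List Λ)
    (h : φ.Sat (.ofWord (ofList
      (x ++ ((toList (s.evalPow N FreeSemigroup.of)).flatMap σ ++ y))))) :
    φ.Sat (.ofWord (ofList (x ++ ((toList (t.evalPow N FreeSemigroup.of)).flatMap σ ++ y)))) := by
  -- The finite approximation of `r` may be replaced by the word of `r` inside the frame.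
  have e : ∀ r : PiTerm Λ,
      φ.Sat (.ofWord (ofList (x ++ ((toList (r.evalPow N FreeSemigroup.of)).flatMap σ ++ y)))) ↔
      φ.Sat (.ofWord (frame x y σ r.evalRho)) := by
    intro r
    refine (EF.sat_iff φ le_rfl (EF.of_isom (isom_frame_ofList x y σ _).symm _)).trans ?_
    have hne : Nonempty (ofList (toList (r.evalPow N FreeSemigroup.of))).Pos :=
      inferInstanceAs (Nonempty (Fin (_ + 1)))
    have hr := PiTerm.ef_evalRho (V := V) hN r
    -- Compatibility of the equivalence with frames comes from `DuplicatorWins.frame` for the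
    -- fragment of formulae of depth at most `φ.depth`; the stability of `F` is not involved here.
    have key := fun {u v : GWord Λ} (hu : Nonempty u.Pos) (hv : Nonempty v.Pos)
      (huv : EF u v (φ.depth + 1) (fun _ : V => none) (fun _ => none)) =>
        ((EF.duplicatorWins huv).frame (isFragment_depthLE _) (sucStable_depthLE _)
          (orderStable_depthLE _) hσ hu hv x y).sat (isFragment_depthLE _)
            (φ := φ) (le_refl φ.depth) hFV
    exact ⟨key hne r.nonempty_evalRho hr.symm, key r.nonempty_evalRho hne hr⟩
  exact (e t).2 ((hst.frame hF hsuc hord hσ s.nonempty_evalRho t.nonempty_evalRho x y).sat hF hφ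
    hFV ((e s).1 h))

theorem holdsIn_of_duplicatorWins (hF : IsFragment F) (hsuc : SucStable F) (hord : OrderStable F)
    {s t : PiTerm Λ} (hst : DuplicatorWins F s.evalRho t.evalRho)
    (hts : DuplicatorWins F t.evalRho s.evalRho) {A : Finset Λ} {φ : Formula Λ V} (hφ : φ ∈ F)
    (hFV : φ.FV = ∅) : HoldsIn s t (SyntacticSemigroup (langOf A φ)) := by
  intro h hh
  -- Representatives of the values of the letters provide the substitution `σ`.
  have hsurj : ∀ a, ∃ w : FreeSemigroup A, (w : SyntacticSemigroup (langOf A φ)) = h (.letter a) :=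
    fun a => Quotient.exists_rep (h (.letter a))
  choose f hf using hsurj
  have hN := le_refl (2 ^ (φ.depth + 1))
  rw [hom_eq_evalPow hN h hh f (fun a => (hf a).symm) s,
    hom_eq_evalPow hN h hh f (fun a => (hf a).symm) t]
  refine (Con.eq _).2 fun x y => ?_
  rw [mem_image_langOf_iff, mem_image_langOf_iff]
  simp only [List.map_append, PiTerm.map_toList_evalPow, List.append_assoc]
  have hσ : ∀ a, (toList (f a)).map Subtype.val ≠ [] := fun a => by simp [toList]
  exact ⟨sat_of_duplicatorWins hF hsuc hord hst hφ hFV hN hσ _ _,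
    sat_of_duplicatorWins hF hsuc hord hts hφ hFV hN hσ _ _⟩

theorem duplicatorWins_of_holdsIn (hF : IsFragment F) {s t : PiTerm Λ}
    (h : ∀ (A : Finset Λ), ∀ φ ∈ F, φ.FV = ∅ → HoldsIn s t (SyntacticSemigroup (langOf A φ))) :
    DuplicatorWins F s.evalRho t.evalRho := by
  classical
  refine duplicatorWins_of_saturated hF (s.saturated_evalRho _) (t.saturated_evalRho _)
    fun φ hφ hFV hs => ?_
  obtain ⟨N, hN⟩ : ∃ N, 2 ^ (φ.depth + 1) ≤ N := ⟨_, le_rfl⟩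
  -- The alphabet consists of the letters that occur in the two approximations. On it `f` is the
  -- identity; the value `a₀` for other letters is never used.
  let A : Finset Λ := (toList (s.evalPow N FreeSemigroup.of) ++
    toList (t.evalPow N FreeSemigroup.of)).toFinset
  let a₀ : A := ⟨(s.evalPow N FreeSemigroup.of).head, by simp [A, toList]⟩
  let f : Λ → FreeSemigroup A := fun a => FreeSemigroup.of (if ha : a ∈ A then ⟨a, ha⟩ else a₀)
  obtain ⟨g, hg, hgπ⟩ := (PiTerm.existsUnique_hom (idempotentPower (S :=
    SyntacticSemigroup (langOf A φ))) fun a => (f a : SyntacticSemigroup (langOf A φ))).exists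
  have hst := h A φ hφ hFV g hgπ
  rw [hom_eq_evalPow hN g hgπ f hg s, hom_eq_evalPow hN g hgπ f hg t] at hst
  -- With empty contexts, syntactic congruence says that both approximations satisfy `φ` or neither
  -- does.
  have key := (Con.eq _).1 hst [] []
  rw [mem_image_langOf_iff, mem_image_langOf_iff] at key
  have e : ∀ l : List Λ, (∀ a ∈ l, a ∈ A) →
      l.flatMap (fun a => (toList (f a)).map Subtype.val) = l := by
    intro l hl
    induction l with
    | nil => rfl
    | cons a l ih =>
      rw [List.flatMap_cons, ih fun b hb => hl b (List.mem_cons_of_mem _ hb)]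
      have ha := hl a List.mem_cons_self
      simp [f, toList, FreeSemigroup.of, ha]
  simp only [List.nil_append, List.append_nil, PiTerm.map_toList_evalPow] at key
  rw [e _ fun a ha => by simp [A, ha], e _ fun a ha => by simp [A, ha]] at key
  exact (EF.sat_iff φ le_rfl (PiTerm.ef_evalRho hN t)).2
    (key.1 ((EF.sat_iff φ le_rfl (PiTerm.ef_evalRho hN s)).1 hs))

end PiGames

theorem theorem4p2 {Λ : Type*} {V : Type*} [Countable Λ] [Infinite Λ] [Countable V] [Infinite V]
    (F : Set (PiGames.Formula Λ V)) (hF : PiGames.IsFragment F)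
    (hsuc : PiGames.SucStable F) (hord : PiGames.OrderStable F) (s t : PiGames.PiTerm Λ) :
    (∀ (A : Finset Λ) (L : Set (FreeSemigroup A)), PiGames.Definable F L →
        PiGames.HoldsIn s t (PiGames.SyntacticSemigroup L)) ↔
      PiGames.DuplicatorWins F s.evalRho t.evalRho ∧
        PiGames.DuplicatorWins F t.evalRho s.evalRho := by
  constructor
  · intro h
    have h' : ∀ (A : Finset Λ), ∀ φ ∈ F, φ.FV = ∅ →
        PiGames.HoldsIn s t (PiGames.SyntacticSemigroup (PiGames.langOf A φ)) :=
      fun A φ hφ hFV => h A _ ⟨φ, hφ, hFV, rfl⟩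
    exact ⟨PiGames.duplicatorWins_of_holdsIn hF h', PiGames.duplicatorWins_of_holdsIn hF
      fun A φ hφ hFV g hg => (h' A φ hφ hFV g hg).symm⟩
  · rintro ⟨hst, hts⟩ A L ⟨φ, hφ, hFV, rfl⟩
    exact PiGames.holdsIn_of_duplicatorWins hF hsuc hord hst hts hφ hFV
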